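/- Let $F$ be a local field: a non-archimedean local field, $\mathbb R$ or $\mathbb C$ (for instance the completion of a number field at any place). Let $|x|$ be its module, defined by $d(tx)=|t|\,dx$ for additive Haar measures $dx$, with $|0|=0$ (so $|z|=z\bar z$ on $\mathbb C$). Let $\mathcal S$ be the space of Schwartz–Bruhat functions on $F$ and $\mathcal S_0\subset\mathcal S$ the subspace of those with compact support that vanish identically in a neighbourhood of $0$. Fix a non-trivial continuous unitary additive character $\lambda$ of $F$ (for instance the standard one $\exp(2\pi i\{\mathrm{Sp}(x)\})$). There is a unique additive Haar measure $dx$ such that $\mathcal F\varphi(y)=\int_F\varphi(x)\lambda(-yx)\,dx$ satisfies $\mathcal F\mathcal F\varphi(x)=\varphi(-x)$ for all $\varphi\in\mathcal S$; let $L^2=L^2(F,dx)$. Let $A$ be multiplication by $\log|x|$, let $B=\mathcal F A\mathcal F^{-1}$ and let $K=i[B,A]=i(BA-AB)$, with initial domain $\mathcal S_0$. **Theorem E3.** $A\mathcal S_0\subset\mathcal S_0$, the integrals defining $B$ on $\mathcal S$ converge absolutely, and $K$ is a well-defined linear operator from $\mathcal S_0$ to $L^2$. Moreover: 1. $(K,\mathcal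 S_0)$ is essentially self-adjoint: it is densely defined and closable and its closure is self-adjoint. 2. It is bounded: its closure, again denoted $K$, is a bounded operator defined on all of $L^2$. 3. For every $t\in F^\times$, the map $(U(t)f)(x)=|t|^{-1/2}f(x/t)$ is unitary on $L^2$ and $KU(t)=U(t)K$. The Fourier transform $\mathcal F$ extends from $\mathcal S$ to a unitary operator on $L^2$, and $K\mathcal F=-\mathcal F K$. The inversion $(If)(x)=|x|^{-1}f(1/x)$ is unitary on $L^2$, and $KI=-IK$. 4. For every continuous unitary character $\chi$ of $F^\times$ there is a function $s\mapsto\Gamma(\chi,s)$, holomorphic and without zeros in the strip $0<\mathrm{Re}(s)<1$, such that there, for all $\alpha\in\mathcal S$, $$\int_F\mathcal F\alpha(y)\,\chi(y)|y|^{s-1}\,dy=\Gamma(\chi,s)\int_F\alpha(x)\,\chi^{-1}(x)|x|^{-s}\,dx$$ (both integrals converging absolutely). With $$K(\chi,s)=-i\,\frac{\partial^2}{\partial s^2}\log\Gamma(\chi,s)=-i\,\frac{\partial}{\partial s}\frac{\Gamma'(\chi,s)}{\Gamma(\chi,s)},$$ the identity $K(\chi^{-1}|x|^{-s})=K(\chi,s)\,\chi^{-1}|x|^{-s}$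 holds in the sense of distributions on $F\setminus\{0\}$: for all $\varphi\in\mathcal S_0$, all $\chi$ and $0<\mathrm{Re}(s)<1$, $$\int_F\overline{K\varphi(x)}\,\chi^{-1}(x)|x|^{-s}\,dx=K(\chi,s)\int_F\overline{\varphi(x)}\,\chi^{-1}(x)|x|^{-s}\,dx,$$ the left integral converging absolutely. Finally, $K(\chi,s)$ is bounded on the critical line $\mathrm{Re}(s)=\tfrac12$, uniformly in $\chi$. -/

import Mathlib

open MeasureTheory Topology ComplexConjugate
open scoped SchwartzMap

noncomputable section

namespace CommutatorOperator

/-! ### Test functions -/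

/-- `IsSchwartzBruhatSpace F 𝒮` says that `F` is a local field (a non-archimedean one, `ℝ` or `ℂ`)
and that `𝒮` is the space of Schwartz-Bruhat functions on it: the locally constant functions with
compact support in the non-archimedean case, the Schwartz functions on `ℝ` or `ℂ`. A non-archimedean
local field is a locally compact field whose topology comes from a nontrivial ultrametric absolute
value (for instance the completion of a number field at a finite place). -/
inductive IsSchwartzBruhatSpace :
    (F : Type) → [Field F] → [TopologicalSpace F] → Set (F → ℂ) → Prop
  | nonarchimedean (F : Type) [NontriviallyNormedField F] [IsUltrametricDist F]
      [LocallyCompactSpace F] :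
      IsSchwartzBruhatSpace F {φ : F → ℂ | IsLocallyConstant φ ∧ HasCompactSupport φ}
  | real : IsSchwartzBruhatSpace ℝ {φ : ℝ → ℂ | ∃ f : 𝓢(ℝ, ℂ), φ = f}
  | complex : IsSchwartzBruhatSpace ℂ {φ : ℂ → ℂ | ∃ f : 𝓢(ℂ, ℂ), φ = f}

/-- The functions of `𝒮` which have compact support and vanish identically near the origin. -/
def puncturedTestFunctions {F : Type} [Field F] [TopologicalSpace F] (𝒮 : Set (F → ℂ)) :
    Set (F → ℂ) :=
  {φ | φ ∈ 𝒮 ∧ HasCompactSupport φ ∧ ∀ᶠ x in 𝓝 (0 : F), φ x = 0}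

section LocalField

variable {F : Type} [Field F] [TopologicalSpace F]

section Module

variable [IsTopologicalRing F] [LocallyCompactSpace F]

open Classical in
/-- The module `|x|` of `x`: the factor in `d(tx) = |t| dx` for every additive Haar measure `dx`,
and `|0| = 0`. It is the usual absolute value on `ℝ`, and `z * conj z` on `ℂ`. -/
def modulus (x : F) : ℝ :=
  if h : x = 0 then 0 else (distribHaarChar F (Units.mk0 x h) : ℝ)

open Classical in
/-- The function `x ↦ χ(x) |x|^s` on the nonzero elements (with value `0` at `0`). -/
def quasiChar (χ : Fˣ →ₜ* Circle) (s : ℂ) (x : F) : ℂ :=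
  if h : x = 0 then 0 else (χ (Units.mk0 x h) : ℂ) * (modulus x : ℂ) ^ s

/-- The dilation `φ ↦ |t|^{-1/2} φ(x/t)`. -/
def dilation (t : Fˣ) (φ : F → ℂ) (x : F) : ℂ :=
  ((Real.sqrt (modulus (t : F)))⁻¹ : ℂ) * φ (x / t)

/-- The inversion `φ ↦ |x|⁻¹ φ(1/x)`. -/
def inversion (φ : F → ℂ) (x : F) : ℂ :=
  ((modulus x)⁻¹ : ℂ) * φ x⁻¹

/-- The operator `A`: multiplication by `log |x|`. -/
def opA (φ : F → ℂ) (x : F) : ℂ := (Real.log (modulus x) : ℂ) * φ x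

end Module

variable [MeasurableSpace F] (ψ : AddChar F Circle) (μ : Measure F)

/-- The Fourier transform `y ↦ ∫ φ(x) ψ(-yx) dx`. -/
def fourier (φ : F → ℂ) : F → ℂ := Fourier.fourierIntegral ψ μ φ

/-- The inverse Fourier transform `x ↦ ∫ φ(y) ψ(yx) dy`. -/
def fourierInv (φ : F → ℂ) (x : F) : ℂ := Fourier.fourierIntegral ψ μ φ (-x)

/-- `μ` is the additive Haar measure that is self-dual for `ψ`: applying the Fourier transform
twice to a Schwartz-Bruhat function `φ` gives `x ↦ φ(-x)`. -/
def IsSelfDualMeasure (𝒮 : Set (F → ℂ)) : Prop :=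
  μ.IsAddHaarMeasure ∧ ∀ φ ∈ 𝒮, ∀ x, fourier ψ μ (fourier ψ μ φ) x = φ (-x)

variable [IsTopologicalRing F] [LocallyCompactSpace F]

/-- The operator `B = ℱ A ℱ⁻¹`. -/
def opB (φ : F → ℂ) : F → ℂ := fourier ψ μ (opA (fourierInv ψ μ φ))

/-- The commutator `K = i [B, A]` on functions. -/
def opK (φ : F → ℂ) (x : F) : ℂ :=
  Complex.I * (opB ψ μ (opA φ) x - opA (opB ψ μ φ) x)

/-- `T` is the commutator operator `K` as an operator in `L²(F, μ)`, with domain the (classes of)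
functions of `𝒮` with compact support which vanish near the origin. This determines `T`. -/
def IsCommutatorOperator (𝒮 : Set (F → ℂ)) (T : Lp ℂ 2 μ →ₗ.[ℂ] Lp ℂ 2 μ) : Prop :=
  (∀ f : Lp ℂ 2 μ, f ∈ T.domain ↔ ∃ φ ∈ puncturedTestFunctions 𝒮, f =ᵐ[μ] φ) ∧
  ∀ f : T.domain, ∀ φ ∈ puncturedTestFunctions 𝒮, (f : Lp ℂ 2 μ) =ᵐ[μ] φ → T f =ᵐ[μ] opK ψ μ φ

/-- The open critical strip. -/
def criticalStrip : Set ℂ := {s | 0 < s.re ∧ s.re < 1}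

/-- `Γ` is the Tate-Gel'fand-Graev Gamma function `s ↦ Γ(χ, s)` of the unitary character `χ` in
the critical strip: the Fourier transform of the distribution `χ(y)|y|^{s-1}` is
`Γ(χ, s) χ⁻¹(x)|x|^{-s}`. -/
def IsTateGamma (𝒮 : Set (F → ℂ)) (χ : Fˣ →ₜ* Circle) (Γ : ℂ → ℂ) : Prop :=
  ∀ s ∈ criticalStrip, ∀ α ∈ 𝒮,
    Integrable (fun y => fourier ψ μ α y * quasiChar χ (s - 1) y) μ ∧
    Integrable (fun x => α x * quasiChar χ⁻¹ (-s) x) μ ∧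
    ∫ y, fourier ψ μ α y * quasiChar χ (s - 1) y ∂μ =
      Γ s * ∫ x, α x * quasiChar χ⁻¹ (-s) x ∂μ

end LocalField

/-- `-i ∂²/∂s² log Γ(s)`, where `∂/∂s log Γ` is the logarithmic derivative `Γ'/Γ`. -/
def spectralFunction (Γ : ℂ → ℂ) (s : ℂ) : ℂ := -Complex.I * deriv (logDeriv Γ) s

/-- A (densely defined, closable) operator is essentially self-adjoint when its closure is
self-adjoint. -/
def IsEssentiallySelfAdjoint {H : Type*} [NormedAddCommGroup H] [InnerProductSpace ℂ H]
    [CompleteSpace H] (T : H →ₗ.[ℂ] H) : Prop :=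
  Dense (T.domain : Set H) ∧ T.IsClosable ∧ IsSelfAdjoint T.closure

end CommutatorOperator

end

/-! The operator `K` is a multiplicative convolution with an explicit integrable kernel. Since `B =
ℱAℱ⁻¹`, the value `Bθ(x)` is one fixed functional, `φ ↦ ∫ log|y| ℱφ(y) dy`, applied to the translate
`θ(· + x)` (`opB_eq_logFunctional`). On test functions vanishing at the origin this functional is `c
∫ φ(x)|x|⁻¹ dx` with `c` real (`exists_logFunctional`). The commutator evaluates it at `(log|u + x|
- log|x|) φ(u + x)`, which vanishes at `u = 0`, so only `c` matters. Substituting `y = x/t` gives `K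
= ∫ κ(t) U(t) dt/|t|` with `κ(t) = -i c log|t| |t|^{1/2} / |1 - t|` (`opK_eq_integral`), and `κ` is
integrable for `dt/|t|` because the logarithm tempers the pole at `t = 1` (`integrable_logKernel`).

The operator statements are read off from `κ`. Integrability gives boundedness; dilations commute
with each other, hence with `K`. Since `κ(1/t) = -κ(t)`, any unitary that turns `U(t)` into
`U(1/t)`, such as `ℱ` or the inversion, anticommutes with `K`. Being moreover purely imaginary, `κ`
satisfies `conj κ(1/t) = κ(t)`, so `K` is self-adjoint, and its restriction to a dense domain is
essentially self-adjoint.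

For the spectral function, Tate's exchange argument (`mellin_exchange`) gives the functional
equation and the factor `Γ`. Multiplication by `log|x|` is differentiation in `s` under the Mellin
transform, so differentiating the functional equation shows that `A + B` acts as `Γ'/Γ`
(`mellin_conductor`); differentiating again isolates `[B, A]`, which acts as `(Γ'/Γ)'`
(`mellin_commutator`). The uniform bound on the critical line comes from the L¹ norm of `κ`.

The properties of test functions that are used are collected in `SchwartzBruhatLike`, verified once
for ultrametric fields and once for `ℝ` and `ℂ`. Fourier inversion up to a positive constant is
derived from them. -/

set_option linter.unusedSectionVars false

noncomputable section

namespace CommutatorOperator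

/-! ### Algebra of the module. -/

section ModulusBasics

variable {F : Type} [NontriviallyNormedField F] [ProperSpace F]

@[simp] lemma modulus_zero : modulus (0 : F) = 0 := by simp [modulus]

lemma modulus_of_ne {x : F} (h : x ≠ 0) :
    modulus x = (distribHaarChar F (Units.mk0 x h) : ℝ) := by simp [modulus, h]

lemma modulus_pos {x : F} (h : x ≠ 0) : 0 < modulus x := by
  rw [modulus_of_ne h]; exact_mod_cast distribHaarChar_pos

lemma modulus_nonneg (x : F) : 0 ≤ modulus x := by
  rcases eq_or_ne x 0 with rfl | h
  · simp
  · exact (modulus_pos h).le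

lemma modulus_ne_zero {x : F} (h : x ≠ 0) : modulus x ≠ 0 := (modulus_pos h).ne'

@[simp] lemma modulus_one : modulus (1 : F) = 1 := by
  rw [modulus_of_ne one_ne_zero]; simp

@[simp] lemma modulus_mul (x y : F) : modulus (x * y) = modulus x * modulus y := by
  rcases eq_or_ne x 0 with rfl | hx
  · simp
  rcases eq_or_ne y 0 with rfl | hy
  · simp
  rw [modulus_of_ne hx, modulus_of_ne hy, modulus_of_ne (mul_ne_zero hx hy), ← NNReal.coe_mul,
    ← map_mul]
  congr 2
  ext; rfl

/-- The module as a multiplicative map. -/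
def modulusHom (F : Type) [NontriviallyNormedField F] [ProperSpace F] : F →*₀ ℝ where
  toFun := modulus
  map_zero' := modulus_zero
  map_one' := modulus_one
  map_mul' := modulus_mul

@[simp] lemma modulus_inv (x : F) : modulus x⁻¹ = (modulus x)⁻¹ := map_inv₀ (modulusHom F) x

@[simp] lemma modulus_div (x y : F) : modulus (x / y) = modulus x / modulus y :=
  map_div₀ (modulusHom F) x y

@[simp] lemma modulus_pow (x : F) (n : ℕ) : modulus (x ^ n) = modulus x ^ n :=
  map_pow (modulusHom F) x n

@[simp] lemma modulus_neg (x : F) : modulus (-x) = modulus x := by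
  have h1 : modulus (-1 : F) = 1 := by
    have h : modulus (-1 : F) * modulus (-1 : F) = 1 := by rw [← modulus_mul]; simp
    nlinarith [modulus_nonneg (-1 : F)]
  rw [← neg_one_mul, modulus_mul, h1, one_mul]

lemma modulus_sub_comm (x y : F) : modulus (x - y) = modulus (y - x) := by
  rw [← neg_sub, modulus_neg]

end ModulusBasics

/-! ### Scaling of additive Haar measure. -/

section MeasureScaling

variable {F : Type} [NontriviallyNormedField F] [ProperSpace F] [MeasurableSpace F] [BorelSpace F]
  (μ : Measure F) [μ.IsAddHaarMeasure]

lemma modulus_mul_measure {t : F} (ht : t ≠ 0) (s : Set F) :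
    μ ((fun x => t * x) '' s) = ENNReal.ofReal (modulus t) * μ s := by
  have := distribHaarChar_mul μ (Units.mk0 t ht) s
  rw [modulus_of_ne ht, ENNReal.ofReal_coe_nnreal, this]
  rfl

lemma map_mul_left_eq {t : F} (ht : t ≠ 0) :
    μ.map (fun x => t * x) = ENNReal.ofReal (modulus t)⁻¹ • μ := by
  ext s hs
  have he : MeasurableEmbedding (fun x => t * x) :=
    (Homeomorph.mulLeft₀ t ht).measurableEmbedding
  rw [he.map_apply, Measure.smul_apply, smul_eq_mul, ← modulus_inv,
    ← modulus_mul_measure μ (inv_ne_zero ht)]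
  congr 1
  exact ((Homeomorph.mulLeft₀ t ht).toEquiv.image_symm_eq_preimage s).symm

lemma lintegral_comp_mul_left {t : F} (ht : t ≠ 0) (f : F → ENNReal) :
    ∫⁻ x, f (t * x) ∂μ = ENNReal.ofReal (modulus t)⁻¹ * ∫⁻ x, f x ∂μ := by
  have he : MeasurableEmbedding (fun x => t * x) :=
    (Homeomorph.mulLeft₀ t ht).measurableEmbedding
  rw [← he.lintegral_map, map_mul_left_eq μ ht, lintegral_smul_measure, smul_eq_mul]

lemma integral_comp_mul_left {t : F} (ht : t ≠ 0) (f : F → ℂ) :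
    ∫ x, f (t * x) ∂μ = ((modulus t)⁻¹ : ℂ) * ∫ x, f x ∂μ := by
  have he : MeasurableEmbedding (fun x => t * x) :=
    (Homeomorph.mulLeft₀ t ht).measurableEmbedding
  rw [← he.integral_map, map_mul_left_eq μ ht, integral_smul_measure,
    ENNReal.toReal_ofReal (inv_nonneg.2 (modulus_nonneg t)), Complex.real_smul]
  push_cast; rfl

lemma integrable_comp_mul_left {t : F} (ht : t ≠ 0) {f : F → ℂ} :
    Integrable (fun x => f (t * x)) μ ↔ Integrable f μ := by
  have he : MeasurableEmbedding (fun x => t * x) :=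
    (Homeomorph.mulLeft₀ t ht).measurableEmbedding
  have := he.integrable_map_iff (g := f) (μ := μ)
  rw [Function.comp_def] at this
  rw [← this, map_mul_left_eq μ ht, integrable_smul_measure]
  · simpa using modulus_pos ht
  · simp

lemma measure_singleton_zero : μ {(0 : F)} = 0 := by
  have : (𝓝[≠] (0 : F)).NeBot := inferInstance
  exact measure_singleton 0

end MeasureScaling

/-! ### Continuity of the module and its comparison with the norm. -/

section ModulusTopology

variable {F : Type} [NontriviallyNormedField F] [ProperSpace F]

/-- Multiplication by `t` maps the closed unit ball, of finite positive measure, into itself. -/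
lemma modulus_le_one {t : F} (ht : ‖t‖ ≤ 1) : modulus t ≤ 1 := by
  rcases eq_or_ne t 0 with rfl | h0
  · simp
  let _ : MeasurableSpace F := borel F
  have : BorelSpace F := ⟨rfl⟩
  let μ : Measure F := Measure.addHaar
  have h := modulus_mul_measure μ h0 (Metric.closedBall 0 1)
  have hsub : (fun x => t * x) '' Metric.closedBall 0 1 ⊆ Metric.closedBall (0 : F) 1 := by
    rintro _ ⟨x, hx, rfl⟩
    simp only [mem_closedBall_zero_iff, norm_mul] at hx ⊢
    exact mul_le_one₀ ht (norm_nonneg _) hx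
  have h1 := measure_mono (μ := μ) hsub
  rw [h] at h1
  have hpos : μ (Metric.closedBall (0 : F) 1) ≠ 0 :=
    (Metric.measure_closedBall_pos μ 0 one_pos).ne'
  have hfin : μ (Metric.closedBall (0 : F) 1) ≠ ⊤ :=
    (isCompact_closedBall (0 : F) 1).measure_lt_top.ne
  have : ENNReal.ofReal (modulus t) ≤ 1 := by
    by_contra! hc
    exact absurd h1 (not_le.2 (by
      simpa using ENNReal.mul_lt_mul_left hpos hfin hc))
  simpa using this

/-- The norm need not be normalised, so it serves only as a gauge: estimates in the norm pass to the
module through this monotonicity. -/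
lemma modulus_le_of_norm_le {x y : F} (h : ‖x‖ ≤ ‖y‖) : modulus x ≤ modulus y := by
  rcases eq_or_ne y 0 with rfl | hy
  · simp at h; simp [h]
  have : modulus (x / y) ≤ 1 := modulus_le_one (by
    rw [norm_div]; exact div_le_one_of_le₀ h (norm_nonneg _))
  rw [modulus_div, div_le_one (modulus_pos hy)] at this
  exact this

/-- If the module were `1`, the balls of radius `‖t‖ ^ n` would all have at least the measure of the
unit ball, whereas they shrink to the null set `{0}`. -/
lemma modulus_lt_one {t : F} (ht : ‖t‖ < 1) : modulus t < 1 := by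
  rcases eq_or_ne t 0 with rfl | h0
  · simp
  let _ : MeasurableSpace F := borel F
  have : BorelSpace F := ⟨rfl⟩
  let μ : Measure F := Measure.addHaar
  refine lt_of_le_of_ne (modulus_le_one ht.le) fun h1 => ?_
  set s : ℕ → Set F := fun n => Metric.closedBall 0 (‖t‖ ^ n) with hs
  have hanti : Antitone s := fun m n hmn =>
    Metric.closedBall_subset_closedBall (pow_le_pow_of_le_one (norm_nonneg _) ht.le hmn)
  have hlim := tendsto_measure_iInter_atTop (μ := μ) (s := s)
    (fun n => Metric.isClosed_closedBall.measurableSet.nullMeasurableSet) hanti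
    ⟨0, (isCompact_closedBall (0 : F) _).measure_lt_top.ne⟩
  have hint : ⋂ n, s n = {0} := by
    ext x
    simp only [hs, Set.mem_iInter, mem_closedBall_zero_iff, Set.mem_singleton_iff]
    refine ⟨fun h => ?_, fun h n => by simp [h]⟩
    have := ge_of_tendsto' (tendsto_pow_atTop_nhds_zero_of_lt_one (norm_nonneg _) ht) h
    exact norm_le_zero_iff.1 this
  rw [hint, measure_singleton_zero μ] at hlim
  have hge : ∀ n, μ (Metric.closedBall (0 : F) 1) ≤ μ (s n) := by
    intro n
    have h := modulus_mul_measure μ (pow_ne_zero n h0) (Metric.closedBall 0 1)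
    rw [modulus_pow, h1, one_pow, ENNReal.ofReal_one, one_mul] at h
    rw [← h]
    apply measure_mono
    rintro _ ⟨x, hx, rfl⟩
    simp only [hs, mem_closedBall_zero_iff, norm_mul, norm_pow] at hx ⊢
    exact mul_le_of_le_one_right (by positivity) hx
  have := ge_of_tendsto' hlim hge
  exact (Metric.measure_closedBall_pos μ (0 : F) one_pos).not_ge this

/-- An element of the punctured open unit ball. -/
lemma exists_small (F : Type) [NontriviallyNormedField F] (r : ℝ) (hr : 0 < r) :
    ∃ t : F, t ≠ 0 ∧ ‖t‖ < r := by
  obtain ⟨t, h1, h2⟩ := NormedField.exists_norm_lt F hr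
  exact ⟨t, norm_pos_iff.1 h1, h2⟩

/-- For `y` near `1`, `y` times the unit ball lies in a slightly larger ball, whose measure is close
to that of the unit ball by continuity from above. Applied to `y` and `y⁻¹`, this yields continuity
at `1`, hence at every nonzero point by multiplicativity. -/
lemma eventually_modulus_lt {r : ℝ} (hr : 1 < r) : ∀ᶠ y in 𝓝 (1 : F), modulus y < r := by
  let _ : MeasurableSpace F := borel F
  have : BorelSpace F := ⟨rfl⟩
  let μ : Measure F := Measure.addHaar
  have hpos : μ (Metric.closedBall (0 : F) 1) ≠ 0 :=
    (Metric.measure_closedBall_pos μ 0 one_pos).ne'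
  have hfin : μ (Metric.closedBall (0 : F) 1) ≠ ⊤ :=
    (isCompact_closedBall (0 : F) 1).measure_lt_top.ne
  set s : ℕ → Set F := fun n => Metric.closedBall 0 (1 + 1 / ((n : ℝ) + 1)) with hs
  have hanti : Antitone s := fun m n hmn =>
    Metric.closedBall_subset_closedBall (by gcongr)
  have hlim := tendsto_measure_iInter_atTop (μ := μ) (s := s)
    (fun n => Metric.isClosed_closedBall.measurableSet.nullMeasurableSet) hanti
    ⟨0, (isCompact_closedBall (0 : F) _).measure_lt_top.ne⟩
  have hint : ⋂ n, s n = Metric.closedBall 0 1 := by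
    ext x
    simp only [hs, Set.mem_iInter, mem_closedBall_zero_iff]
    refine ⟨fun h => ?_, fun h n => h.trans (by simp; positivity)⟩
    have h2 := ge_of_tendsto' (tendsto_one_div_add_atTop_nhds_zero_nat.const_add (1 : ℝ)) h
    simpa using h2
  rw [hint] at hlim
  have hlt : μ (Metric.closedBall (0 : F) 1) < ENNReal.ofReal r * μ (Metric.closedBall 0 1) := by
    conv_lhs => rw [← one_mul (μ (Metric.closedBall (0 : F) 1))]
    rw [ENNReal.mul_lt_mul_iff_left hpos hfin]
    simpa using hr
  obtain ⟨n, hn⟩ := (hlim.eventually (gt_mem_nhds hlt)).exists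
  have hnear : ∀ᶠ y in 𝓝 (1 : F), ‖y‖ < 1 + 1 / ((n : ℝ) + 1) :=
    continuous_norm.continuousAt.eventually (gt_mem_nhds (by simp; positivity))
  filter_upwards [hnear, isOpen_ne.mem_nhds (one_ne_zero (α := F))] with y hy hy0
  have h := modulus_mul_measure μ hy0 (Metric.closedBall 0 1)
  have hsub : (fun x => y * x) '' Metric.closedBall 0 1 ⊆ s n := by
    rintro _ ⟨x, hx, rfl⟩
    simp only [hs, mem_closedBall_zero_iff, norm_mul] at hx ⊢
    exact (mul_le_of_le_one_right (norm_nonneg _) hx).trans hy.le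
  have h1 := (measure_mono (μ := μ) hsub).trans_lt hn
  rw [h, ENNReal.mul_lt_mul_iff_left hpos hfin] at h1
  exact (ENNReal.ofReal_lt_ofReal_iff (by linarith)).1 h1

lemma continuous_modulus : Continuous (modulus : F → ℝ) := by
  have hzero : ContinuousAt (modulus : F → ℝ) 0 := by
    obtain ⟨t, ht0, ht1⟩ := exists_small F 1 one_pos
    rw [Metric.continuousAt_iff]
    intro ε hε
    obtain ⟨n, hn⟩ := exists_pow_lt_of_lt_one hε (modulus_lt_one ht1)
    refine ⟨‖t‖ ^ n, by positivity, fun {x} hx => ?_⟩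
    rw [modulus_zero, Real.dist_eq, sub_zero, abs_of_nonneg (modulus_nonneg x)]
    rw [dist_zero_right] at hx
    refine lt_of_le_of_lt ?_ hn
    rw [← modulus_pow]
    exact modulus_le_of_norm_le (by simpa using hx.le)
  have hone : ContinuousAt (modulus : F → ℝ) 1 := by
    rw [Metric.continuousAt_iff']
    intro ε hε
    rw [modulus_one]
    have h1 : ∀ᶠ y in 𝓝 (1 : F), modulus y < 1 + ε :=
      eventually_modulus_lt (by linarith)
    have h2 : ∀ᶠ y in 𝓝 (1 : F), modulus y⁻¹ < 1 + ε := by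
      have : Filter.Tendsto (fun y : F => y⁻¹) (𝓝 1) (𝓝 1) := by
        simpa using (continuousAt_inv₀ (one_ne_zero (α := F))).tendsto
      exact this.eventually (eventually_modulus_lt (by linarith))
    filter_upwards [h1, h2, isOpen_ne.mem_nhds (one_ne_zero (α := F))] with y hy1 hy2 hy0
    have hp := modulus_pos hy0
    rw [modulus_inv, inv_lt_iff_one_lt_mul₀ hp] at hy2
    rw [Real.dist_eq, abs_lt]
    constructor <;> nlinarith
  rw [continuous_iff_continuousAt]
  intro x
  rcases eq_or_ne x 0 with rfl | hx
  · exact hzero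
  have : (modulus : F → ℝ) = fun y => modulus x * modulus (x⁻¹ * y) := by
    ext y; rw [← modulus_mul, mul_inv_cancel_left₀ hx]
  rw [this]
  have h1 : ContinuousAt (modulus : F → ℝ) (x⁻¹ * x) := by rwa [inv_mul_cancel₀ hx]
  have h2 : ContinuousAt (fun y => modulus (x⁻¹ * y)) x :=
    h1.comp (f := fun y => x⁻¹ * y) (continuous_const_mul x⁻¹).continuousAt
  exact continuousAt_const.mul h2

end ModulusTopology

/-! ### The multiplicative measure and the weights integrable for it. -/

section MultHaar

variable {F : Type} [NontriviallyNormedField F] [ProperSpace F] [MeasurableSpace F] [BorelSpace F]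
  (μ : Measure F)

lemma measurable_modulus : Measurable (modulus : F → ℝ) := continuous_modulus.measurable

/-- The measure `|x|⁻¹ dx`, invariant under multiplication and inversion. -/
def multHaar : Measure F := μ.withDensity fun x => ENNReal.ofReal (modulus x)⁻¹

lemma lintegral_multHaar {f : F → ENNReal} (hf : Measurable f) :
    ∫⁻ x, f x ∂(multHaar μ) = ∫⁻ x, ENNReal.ofReal (modulus x)⁻¹ * f x ∂μ := by
  rw [multHaar, lintegral_withDensity_eq_lintegral_mul _ (by
    exact (measurable_modulus.inv).ennreal_ofReal) hf]
  rfl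

lemma integrable_multHaar {E : Type*} [NormedAddCommGroup E] [NormedSpace ℝ E] {f : F → E} :
    Integrable f (multHaar μ) ↔ Integrable (fun x => (modulus x)⁻¹ • f x) μ := by
  have hm : Measurable fun x : F => ENNReal.ofReal (modulus x)⁻¹ :=
    (measurable_modulus.inv).ennreal_ofReal
  rw [multHaar, integrable_withDensity_iff_integrable_smul' hm (by simp)]
  simp_rw [ENNReal.toReal_ofReal (inv_nonneg.2 (modulus_nonneg _))]

lemma integral_multHaar {E : Type*} [NormedAddCommGroup E] [NormedSpace ℝ E] (f : F → E) :
    ∫ x, f x ∂(multHaar μ) = ∫ x, (modulus x)⁻¹ • f x ∂μ := by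
  have := integral_withDensity_eq_integral_smul (μ := μ)
    (f := fun x : F => (modulus x)⁻¹.toNNReal) (measurable_modulus.inv).real_toNNReal f
  simp only [NNReal.smul_def, Real.coe_toNNReal _ (inv_nonneg.2 (modulus_nonneg _))] at this
  exact this

instance [SigmaFinite μ] : SigmaFinite (multHaar μ) := by
  unfold multHaar; infer_instance

lemma multHaar_absolutelyContinuous : multHaar μ ≪ μ := withDensity_absolutelyContinuous _ _

variable [μ.IsAddHaarMeasure]

lemma ae_ne_zero : ∀ᵐ x ∂μ, x ≠ (0 : F) := by
  rw [ae_iff]; simp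

lemma multHaar_ae_ne_zero : ∀ᵐ x ∂(multHaar μ), x ≠ (0 : F) :=
  (multHaar_absolutelyContinuous μ).ae_le (ae_ne_zero μ)

lemma lintegral_multHaar_mul_left {t : F} (ht : t ≠ 0) {f : F → ENNReal} (hf : Measurable f) :
    ∫⁻ x, f (t * x) ∂(multHaar μ) = ∫⁻ x, f x ∂(multHaar μ) := by
  rw [lintegral_multHaar μ hf,
    lintegral_multHaar μ (f := fun x => f (t * x)) (hf.comp (measurable_const_mul t))]
  have h := lintegral_comp_mul_left μ ht (fun x => ENNReal.ofReal (modulus x)⁻¹ * f x)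
  have e : ∀ x, ENNReal.ofReal (modulus x)⁻¹ * f (t * x) =
      ENNReal.ofReal (modulus t) * (ENNReal.ofReal (modulus (t * x))⁻¹ * f (t * x)) := by
    intro x
    rw [← mul_assoc, ← ENNReal.ofReal_mul (modulus_nonneg t), modulus_mul, mul_inv,
      mul_inv_cancel_left₀ (modulus_ne_zero ht)]
  simp_rw [e]
  rw [lintegral_const_mul' _ _ ENNReal.ofReal_ne_top, h, ← mul_assoc,
    ← ENNReal.ofReal_mul (modulus_nonneg t), mul_inv_cancel₀ (modulus_ne_zero ht)]
  simp

lemma measurePreserving_mul_left {t : F} (ht : t ≠ 0) :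
    MeasurePreserving (fun x => t * x) (multHaar μ) (multHaar μ) := by
  refine ⟨measurable_const_mul t, ?_⟩
  ext s hs
  rw [Measure.map_apply (measurable_const_mul t) hs, ← lintegral_indicator_one hs,
    ← lintegral_indicator_one (measurable_const_mul t hs),
    ← lintegral_multHaar_mul_left μ ht (measurable_one.indicator hs)]
  rfl

lemma absolutelyContinuous_multHaar : μ ≪ multHaar μ := by
  refine withDensity_absolutelyContinuous' (measurable_modulus.inv).ennreal_ofReal.aemeasurable ?_
  filter_upwards [ae_ne_zero μ] with x hx
  simpa using modulus_pos hx

lemma multHaar_lt_top {s : Set F} {r : ℝ} (hr : 0 < r) (hs : ∀ x ∈ s, r ≤ ‖x‖) (hμ : μ s ≠ ⊤)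
    (hm : MeasurableSet s) : multHaar μ s < ⊤ := by
  obtain ⟨t, ht0, ht⟩ := exists_small F r hr
  rw [multHaar, withDensity_apply _ hm]
  refine (setLIntegral_mono' (g := fun _ => ENNReal.ofReal (modulus t)⁻¹) hm
    fun x hx => ?_).trans_lt ?_
  · exact ENNReal.ofReal_le_ofReal (inv_anti₀ (modulus_pos ht0)
      (modulus_le_of_norm_le (ht.le.trans (hs x hx))))
  · rw [setLIntegral_const]
    exact ENNReal.mul_lt_top ENNReal.ofReal_lt_top hμ.lt_top

/-- A set of finite positive measure for the multiplicative measure. -/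
lemma exists_multHaar_pos_lt_top :
    ∃ s : Set F, MeasurableSet s ∧ multHaar μ s ≠ 0 ∧ multHaar μ s ≠ ⊤ := by
  refine ⟨Metric.ball 1 (1 / 2), measurableSet_ball, fun h => ?_, ?_⟩
  · exact (Metric.measure_ball_pos μ (1 : F) (by norm_num : (0 : ℝ) < 1 / 2)).ne'
      (absolutelyContinuous_multHaar μ h)
  · refine (multHaar_lt_top μ (r := 1 / 2) (by norm_num) (fun x hx => ?_)
      measure_ball_lt_top.ne measurableSet_ball).ne
    rw [mem_ball_iff_norm'] at hx
    have := norm_sub_norm_le (1 : F) x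
    rw [norm_one] at this
    linarith

/-- The classical uniqueness trick for Haar measure: multiply by the integral of a function `g` of
finite positive mass, spread it as `f(x⁻¹) g(xy)`, and apply Tonelli and invariance in each
variable. -/
lemma lintegral_multHaar_inv {f : F → ENNReal} (hf : Measurable f) :
    ∫⁻ x, f x⁻¹ ∂(multHaar μ) = ∫⁻ x, f x ∂(multHaar μ) := by
  obtain ⟨s, hs, h0, htop⟩ := exists_multHaar_pos_lt_top μ
  set ν := multHaar μ
  set g : F → ENNReal := s.indicator 1
  have hg : Measurable g := measurable_one.indicator hs
  have hgi : ∫⁻ y, g y ∂ν = ν s := lintegral_indicator_one hs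
  have key : (∫⁻ x, f x⁻¹ ∂ν) * ν s = (∫⁻ x, f x ∂ν) * ν s := by
    calc (∫⁻ x, f x⁻¹ ∂ν) * ν s = ∫⁻ x, f x⁻¹ * ∫⁻ y, g y ∂ν ∂ν := by
          rw [lintegral_mul_const' _ _ (by rwa [hgi]), hgi]
      _ = ∫⁻ x, ∫⁻ y, f x⁻¹ * g (x * y) ∂ν ∂ν := by
          refine lintegral_congr_ae ?_
          filter_upwards [multHaar_ae_ne_zero μ] with x hx
          rw [← lintegral_multHaar_mul_left μ hx hg, lintegral_const_mul]
          exact hg.comp (measurable_const_mul x)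
      _ = ∫⁻ y, ∫⁻ x, f x⁻¹ * g (x * y) ∂ν ∂ν := by
          apply lintegral_lintegral_swap
          apply Measurable.aemeasurable
          exact (hf.comp (measurable_fst.inv)).mul
            (hg.comp (measurable_fst.mul measurable_snd))
      _ = ∫⁻ y, ∫⁻ x, f (y * x⁻¹) * g x ∂ν ∂ν := by
          refine lintegral_congr_ae ?_
          filter_upwards [multHaar_ae_ne_zero μ] with y hy
          have hm : Measurable fun x => f (y * x⁻¹) * g x :=
            (hf.comp (measurable_inv.const_mul y)).mul hg
          rw [← lintegral_multHaar_mul_left μ hy hm]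
          refine lintegral_congr fun x => ?_
          rw [mul_inv, mul_inv_cancel_left₀ hy, mul_comm x y]
      _ = ∫⁻ x, ∫⁻ y, f (y * x⁻¹) * g x ∂ν ∂ν := by
          apply lintegral_lintegral_swap
          apply Measurable.aemeasurable
          exact (hf.comp (measurable_fst.mul measurable_snd.inv)).mul (hg.comp measurable_snd)
      _ = ∫⁻ x, (∫⁻ y, f y ∂ν) * g x ∂ν := by
          refine lintegral_congr_ae ?_
          filter_upwards [multHaar_ae_ne_zero μ] with x hx
          rw [← lintegral_multHaar_mul_left μ (inv_ne_zero hx) hf, ← lintegral_mul_const]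
          · simp_rw [mul_comm x⁻¹]
            rfl
          · exact hf.comp (measurable_const_mul _)
      _ = (∫⁻ x, f x ∂ν) * ν s := by
          rw [lintegral_const_mul _ hg, hgi]
  exact (ENNReal.mul_left_inj h0 htop).1 key

lemma measurePreserving_inv :
    MeasurePreserving (fun x => x⁻¹) (multHaar μ) (multHaar μ) := by
  refine ⟨measurable_inv, ?_⟩
  ext s hs
  rw [Measure.map_apply measurable_inv hs, ← lintegral_indicator_one hs,
    ← lintegral_indicator_one (measurable_inv hs),
    ← lintegral_multHaar_inv μ (measurable_one.indicator hs)]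
  rfl

lemma measurableEmbedding_mul_left {t : F} (ht : t ≠ 0) :
    MeasurableEmbedding (fun x => t * x) :=
  (Homeomorph.mulLeft₀ t ht).measurableEmbedding

lemma measurableEmbedding_inv : MeasurableEmbedding (fun x : F => x⁻¹) :=
  (MeasurableEquiv.ofInvolutive (fun x : F => x⁻¹) inv_involutive
    measurable_inv).measurableEmbedding

lemma measurableEmbedding_div {a : F} (ha : a ≠ 0) :
    MeasurableEmbedding (fun x => a / x) := by
  have := (measurableEmbedding_mul_left ha).comp measurableEmbedding_inv
  simpa [Function.comp_def, div_eq_mul_inv] using this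

lemma measurePreserving_div {a : F} (ha : a ≠ 0) :
    MeasurePreserving (fun x => a / x) (multHaar μ) (multHaar μ) := by
  have := (measurePreserving_mul_left μ ha).comp (measurePreserving_inv μ)
  simpa [Function.comp_def, div_eq_mul_inv] using this

/-- Inversion preserves the measure and carries the outside of the unit ball into it, so behaviour
at infinity reduces to behaviour at the origin. -/
lemma integrable_of_near_zero {E : Type*} [NormedAddCommGroup E] {f : F → E}
    (h0 : IntegrableOn f (Metric.closedBall 0 1) (multHaar μ))
    (h1 : IntegrableOn (fun x => f x⁻¹) (Metric.closedBall 0 1) (multHaar μ)) :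
    Integrable f (multHaar μ) := by
  have h2 : IntegrableOn f ((fun x => x⁻¹) ⁻¹' (Metric.closedBall 0 1)) (multHaar μ) := by
    rw [← (measurePreserving_inv μ).integrableOn_comp_preimage measurableEmbedding_inv]
    simpa [Function.comp_def, ← Set.preimage_comp] using h1
  have h3 := h0.union h2
  rw [← integrableOn_univ]
  refine h3.mono_set fun x _ => ?_
  simp only [Set.mem_union, Set.mem_preimage, mem_closedBall_zero_iff, norm_inv]
  rcases le_total ‖x‖ 1 with h | h
  · exact Or.inl h
  · exact Or.inr (inv_le_one_of_one_le₀ h)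

/-- The punctured unit ball is covered by the shells `t ^ n A`, all of the same multiplicative
measure, on which the integrand is at most `(|t| ^ σ) ^ n`: the integral is dominated by a
convergent geometric series. -/
lemma integrableOn_rpow {σ : ℝ} (hσ : 0 < σ) :
    IntegrableOn (fun x : F => modulus x ^ σ) (Metric.closedBall 0 1) (multHaar μ) := by
  obtain ⟨t, ht0, ht1⟩ := exists_small F 1 one_pos
  have htp : 0 < ‖t‖ := norm_pos_iff.2 ht0
  set A : Set F := {x | ‖t‖ < ‖x‖ ∧ ‖x‖ ≤ 1} with hA
  have hAm : MeasurableSet A :=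
    (measurableSet_lt measurable_const measurable_norm).inter
      (measurableSet_le measurable_norm measurable_const)
  have hAsub : A ⊆ Metric.closedBall 0 1 := fun x hx => by simpa using hx.2
  have hAfin : multHaar μ A < ⊤ := multHaar_lt_top μ htp (fun x hx => hx.1.le)
    ((measure_mono hAsub).trans_lt (isCompact_closedBall (0 : F) 1).measure_lt_top).ne hAm
  set q := modulus t with hq
  have hq0 : 0 < q := modulus_pos ht0
  have hq1 : q ^ σ < 1 := Real.rpow_lt_one hq0.le (modulus_lt_one ht1) hσ
  set S : ℕ → Set F := fun n => (fun x => (t ^ n)⁻¹ * x) ⁻¹' A with hS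
  have hSm : ∀ n, MeasurableSet (S n) := fun n => measurable_const_mul _ hAm
  have hcover : (Metric.closedBall 0 1 : Set F) ⊆ {0} ∪ ⋃ n, S n := by
    intro x hx
    rcases eq_or_ne x 0 with rfl | hx0
    · simp
    right
    rw [mem_closedBall_zero_iff] at hx
    obtain ⟨n, hn1, hn2⟩ := exists_nat_pow_near_of_lt_one (norm_pos_iff.2 hx0) hx htp ht1
    refine Set.mem_iUnion.2 ⟨n, ?_⟩
    simp only [hS, hA, Set.mem_preimage, Set.mem_ofPred_eq, norm_mul, norm_inv, norm_pow]
    have hp : 0 < ‖t‖ ^ n := by positivity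
    constructor
    · rw [inv_mul_eq_div, lt_div_iff₀ hp]; rwa [pow_succ, mul_comm] at hn1
    · rw [inv_mul_eq_div, div_le_one hp]; exact hn2
  refine ⟨(measurable_modulus.pow_const σ).aestronglyMeasurable, ?_⟩
  rw [hasFiniteIntegral_iff_enorm]
  have hae : multHaar μ {(0 : F)} = 0 :=
    multHaar_absolutelyContinuous μ (measure_singleton_zero μ)
  calc ∫⁻ x in Metric.closedBall 0 1, ‖modulus x ^ σ‖ₑ ∂(multHaar μ)
      ≤ ∫⁻ x in {0} ∪ ⋃ n, S n, ‖modulus x ^ σ‖ₑ ∂(multHaar μ) := lintegral_mono_set hcover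
    _ ≤ ∫⁻ x in {0}, ‖modulus x ^ σ‖ₑ ∂(multHaar μ) +
          ∫⁻ x in ⋃ n, S n, ‖modulus x ^ σ‖ₑ ∂(multHaar μ) := lintegral_union_le _ _ _
    _ = ∫⁻ x in ⋃ n, S n, ‖modulus x ^ σ‖ₑ ∂(multHaar μ) := by
        rw [setLIntegral_measure_zero _ _ hae, zero_add]
    _ ≤ ∑' n, ∫⁻ x in S n, ‖modulus x ^ σ‖ₑ ∂(multHaar μ) := lintegral_iUnion_le _ _
    _ ≤ ∑' n : ℕ, ENNReal.ofReal (q ^ σ) ^ n * multHaar μ A := by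
        refine ENNReal.tsum_le_tsum fun n => ?_
        have hb : ∀ x ∈ S n, ‖modulus x ^ σ‖ₑ ≤ ENNReal.ofReal (q ^ σ) ^ n := by
          intro x hx
          rw [Real.enorm_of_nonneg (Real.rpow_nonneg (modulus_nonneg x) _),
            ← ENNReal.ofReal_pow (Real.rpow_nonneg hq0.le _)]
          refine ENNReal.ofReal_le_ofReal ?_
          rw [← Real.rpow_natCast, ← Real.rpow_mul hq0.le, mul_comm, Real.rpow_mul hq0.le,
            Real.rpow_natCast, hq, ← modulus_pow]
          refine Real.rpow_le_rpow (modulus_nonneg x) (modulus_le_of_norm_le ?_) hσ.le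
          have := hx.2
          rw [norm_mul, norm_inv, inv_mul_eq_div,
            div_le_one (norm_pos_iff.2 (pow_ne_zero n ht0))] at this
          exact this
        refine (setLIntegral_mono' (hSm n) hb).trans ?_
        rw [setLIntegral_const]
        refine mul_le_mul_right (le_of_eq ?_) _
        exact (measurePreserving_mul_left μ (inv_ne_zero (pow_ne_zero n ht0))).measure_preimage
          hAm.nullMeasurableSet
    _ < ⊤ := by
        rw [ENNReal.tsum_mul_right]
        refine ENNReal.mul_lt_top ?_ hAfin
        rw [ENNReal.tsum_geometric, ENNReal.inv_lt_top]
        simpa using hq1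

lemma abs_log_mul_rpow_le {u σ : ℝ} (hσ : 0 < σ) (h0 : 0 ≤ u) (h1 : u ≤ 1) :
    |Real.log u| * u ^ σ ≤ 2 / σ * u ^ (σ / 2) := by
  rcases h0.eq_or_lt with rfl | hu
  · simp [Real.zero_rpow (by positivity : σ / 2 ≠ 0)]
  have h := (Real.abs_log_mul_self_rpow_lt u (σ / 2) hu h1 (by positivity)).le
  rw [abs_mul, abs_of_nonneg (Real.rpow_nonneg h0 _)] at h
  have e : u ^ σ = u ^ (σ / 2) * u ^ (σ / 2) := by rw [← Real.rpow_add hu]; ring_nf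
  rw [e, ← mul_assoc]
  have : (1 : ℝ) / (σ / 2) = 2 / σ := by field_simp
  rw [this] at h
  gcongr

/-- The weight that dominates all the Mellin integrals. -/
def mellinWeight (σ : ℝ) (x : F) : ℝ :=
  (1 + |Real.log (modulus x)|) * modulus x ^ σ / (1 + modulus x)

lemma mellinWeight_nonneg (σ : ℝ) (x : F) : 0 ≤ mellinWeight σ x := by
  have := modulus_nonneg x
  unfold mellinWeight; positivity

lemma measurable_mellinWeight (σ : ℝ) : Measurable (mellinWeight σ : F → ℝ) := by
  unfold mellinWeight
  have := measurable_modulus (F := F)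
  have h := Real.measurable_log.comp this
  exact ((measurable_const.add (continuous_abs.measurable.comp h)).mul (this.pow_const σ)).div
    (measurable_const.add this)

lemma integrableOn_mellinWeight {σ : ℝ} (hσ : 0 < σ) :
    IntegrableOn (mellinWeight σ : F → ℝ) (Metric.closedBall 0 1) (multHaar μ) := by
  have h := ((integrableOn_rpow μ hσ).add
    ((integrableOn_rpow μ (half_pos hσ)).const_mul (2 / σ)))
  refine Integrable.mono' h (measurable_mellinWeight σ).aestronglyMeasurable ?_
  filter_upwards [ae_restrict_mem measurableSet_closedBall] with x hx
  rw [mem_closedBall_zero_iff] at hx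
  have h1 := modulus_le_one hx
  have h0 := modulus_nonneg x
  rw [Real.norm_of_nonneg (mellinWeight_nonneg σ x), mellinWeight]
  have h2 := abs_log_mul_rpow_le hσ h0 h1
  have h3 : (0 : ℝ) ≤ (1 + |Real.log (modulus x)|) * modulus x ^ σ := by positivity
  refine (div_le_self h3 (by linarith)).trans ?_
  simp only [Pi.add_apply]
  linarith

/-- The denominator `1 + |x|` makes the weight symmetric under `σ ↦ 1 - σ`, so integrability for `0
< σ < 1` needs only the estimate near the origin. -/
lemma mellinWeight_inv (σ : ℝ) {x : F} (hx : x ≠ 0) :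
    mellinWeight σ x⁻¹ = mellinWeight (1 - σ) x := by
  have h := modulus_pos hx
  unfold mellinWeight
  rw [modulus_inv, Real.log_inv, abs_neg, Real.inv_rpow h.le, Real.rpow_sub h, Real.rpow_one]
  have := Real.rpow_pos_of_pos h σ
  field_simp
  ring

lemma integrable_mellinWeight {σ : ℝ} (h0 : 0 < σ) (h1 : σ < 1) :
    Integrable (mellinWeight σ : F → ℝ) (multHaar μ) := by
  refine integrable_of_near_zero μ (integrableOn_mellinWeight μ h0) ?_
  refine (integrableOn_mellinWeight μ (sub_pos.2 h1)).congr ?_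
  filter_upwards [ae_restrict_of_ae (multHaar_ae_ne_zero μ)] with x hx
  exact (mellinWeight_inv σ hx).symm

end MultHaar

/-! ### The Fourier transform on integrable functions and a multiplicative Fubini theorem. -/

section FourierBasics

variable {F : Type} [NontriviallyNormedField F] [ProperSpace F] [MeasurableSpace F] [BorelSpace F]

lemma mul_modulus_multHaar (μ : Measure F) [μ.IsAddHaarMeasure] (f : F → ℂ) :
    ∫ x, f x * modulus x ∂(multHaar μ) = ∫ x, f x ∂μ := by
  rw [integral_multHaar]
  refine integral_congr_ae ?_
  filter_upwards [ae_ne_zero μ] with x hx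
  rw [Complex.real_smul]
  have : (modulus x : ℂ) ≠ 0 := by exact_mod_cast modulus_ne_zero hx
  push_cast
  field_simp

lemma integrable_mul_modulus (μ : Measure F) [μ.IsAddHaarMeasure] {f : F → ℝ} :
    Integrable (fun x => f x * modulus x) (multHaar μ) ↔ Integrable f μ := by
  rw [integrable_multHaar]
  refine integrable_congr ?_
  filter_upwards [ae_ne_zero μ] with x hx
  have := modulus_ne_zero hx
  simp only [smul_eq_mul]
  field_simp

/-- Fubini's theorem for multiplicative convolutions. -/
lemma mellin_fubini (μ : Measure F) [μ.IsAddHaarMeasure] {h G w : F → ℂ} {a b : F → ℝ}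
    (hh : Measurable h) (hG : Measurable G) (hw : Measurable w)
    (hwb : ∀ t x : F, t ≠ 0 → x ≠ 0 → ‖w (x / t)‖ ≤ a t * b x)
    (ha : Integrable (fun t => ‖h t‖ * a t) (multHaar μ))
    (hb : Integrable (fun x => ‖G x‖ * b x) μ) :
    ∫ t, h t * ∫ x, w (x / t) * G x ∂μ ∂(multHaar μ) =
      ∫ x, w x * ∫ t, h t * G (t * x) ∂μ ∂μ := by
  set ν := multHaar μ
  set Φ : F × F → ℂ := fun p => h p.1 * (w (p.2 / p.1) * G p.2) * modulus p.2 with hΦ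
  have hΦm : Measurable Φ :=
    ((hh.comp measurable_fst).mul ((hw.comp (measurable_snd.div measurable_fst)).mul
      (hG.comp measurable_snd))).mul
      (Complex.measurable_ofReal.comp (measurable_modulus.comp measurable_snd))
  have hne1 : ∀ᵐ p ∂(ν.prod ν), p.1 ≠ (0 : F) :=
    Measure.quasiMeasurePreserving_fst.ae (multHaar_ae_ne_zero μ)
  have hne2 : ∀ᵐ p ∂(ν.prod ν), p.2 ≠ (0 : F) :=
    Measure.quasiMeasurePreserving_snd.ae (multHaar_ae_ne_zero μ)
  have hΦi : Integrable Φ (ν.prod ν) := by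
    refine Integrable.mono' (ha.mul_prod ((integrable_mul_modulus μ).2 hb))
      hΦm.aestronglyMeasurable ?_
    filter_upwards [hne1, hne2] with p hp1 hp2
    have h1 := hwb p.1 p.2 hp1 hp2
    simp only [hΦ, norm_mul, Complex.norm_real, Real.norm_of_nonneg (modulus_nonneg p.2)]
    calc ‖h p.1‖ * (‖w (p.2 / p.1)‖ * ‖G p.2‖) * modulus p.2
        ≤ ‖h p.1‖ * ((a p.1 * b p.2) * ‖G p.2‖) * modulus p.2 := by
          have := modulus_nonneg p.2
          gcongr
      _ = _ := by ring
  -- The substitution `x ↦ tx` is made on the product space, as a measure-preserving shear;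
  -- integrability after the substitution is then automatic.
  have hS : MeasurePreserving (fun p : F × F => (p.1, p.1 * p.2)) (ν.prod ν) (ν.prod ν) :=
    (MeasurePreserving.id ν).skew_product (g := fun t x => t * x)
      (measurable_fst.mul measurable_snd)
      (by filter_upwards [multHaar_ae_ne_zero μ] with t ht using (measurePreserving_mul_left μ ht).map_eq)
  have hΦS : Integrable (fun p : F × F => Φ (p.1, p.1 * p.2)) (ν.prod ν) :=
    hS.integrable_comp_of_integrable hΦi
  calc ∫ t, h t * ∫ x, w (x / t) * G x ∂μ ∂ν
      = ∫ t, ∫ x, Φ (t, x) ∂ν ∂ν := by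
        congr 1 with t
        rw [← mul_modulus_multHaar, ← integral_const_mul]
        simp only [hΦ, mul_assoc]; rfl
    _ = ∫ p, Φ p ∂(ν.prod ν) := (integral_prod _ hΦi).symm
    _ = ∫ p, Φ (p.1, p.1 * p.2) ∂(ν.prod ν) := by
        have := integral_map (μ := ν.prod ν) hS.measurable.aemeasurable
          (hΦm.aestronglyMeasurable (μ := (ν.prod ν).map fun p : F × F => (p.1, p.1 * p.2)))
        rw [hS.map_eq] at this
        exact this
    _ = ∫ x, ∫ t, Φ (t, t * x) ∂ν ∂ν := integral_prod_symm _ hΦS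
    _ = ∫ x, (w x * ∫ t, h t * G (t * x) ∂μ) * modulus x ∂ν := by
        congr 1 with x
        rw [← mul_modulus_multHaar μ (fun t => h t * G (t * x)), mul_assoc, mul_comm (∫ _, _ ∂_),
          ← mul_assoc, ← integral_const_mul]
        refine integral_congr_ae ?_
        filter_upwards [multHaar_ae_ne_zero μ] with t ht
        simp only [hΦ, mul_div_cancel_left₀ _ ht, modulus_mul]
        push_cast; ring
    _ = _ := mul_modulus_multHaar μ _

variable {ψ : AddChar F Circle} {μ : Measure F}

lemma fourier_apply (φ : F → ℂ) (y : F) :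
    fourier ψ μ φ y = ∫ x, (ψ (-(x * y)) : ℂ) * φ x ∂μ := by
  simp only [fourier, Fourier.fourierIntegral_def, Circle.smul_def, smul_eq_mul]

lemma fourierInv_apply (φ : F → ℂ) (x : F) :
    fourierInv ψ μ φ x = fourier ψ μ φ (-x) := rfl

lemma norm_fourier_le (φ : F → ℂ) (y : F) : ‖fourier ψ μ φ y‖ ≤ ∫ x, ‖φ x‖ ∂μ :=
  Fourier.norm_fourierIntegral_le_integral_norm ψ μ φ y

variable [μ.IsAddHaarMeasure]

lemma continuous_fourier (hψ : Continuous ψ) {φ : F → ℂ} (hφ : Integrable φ μ) :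
    Continuous (fourier ψ μ φ) :=
  VectorFourier.fourierIntegral_continuous hψ (by simpa using continuous_mul) hφ

lemma integral_fourier_mul (hψ : Continuous ψ) {f g : F → ℂ} (hf : Integrable f μ)
    (hg : Integrable g μ) :
    ∫ x, fourier ψ μ f x * g x ∂μ = ∫ x, f x * fourier ψ μ g x ∂μ := by
  have h := VectorFourier.integral_fourierIntegral_smul_eq_flip (L := LinearMap.mul F F)
    hψ (by simpa using continuous_mul) hf hg
  simp only [smul_eq_mul] at h
  have hflip : (LinearMap.mul F F).flip = LinearMap.mul F F := by
    ext; simp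
  rw [hflip] at h
  exact h

lemma integrable_char_mul (hψ : Continuous ψ) {f : F → ℂ} (hf : Integrable f μ) (y : F) :
    Integrable (fun x => (ψ (-(x * y)) : ℂ) * f x) μ := by
  refine (hf.bdd_mul (c := 1) ?_ ?_)
  · have : Continuous fun x : F => (ψ (-(x * y)) : ℂ) := by fun_prop
    exact this.aestronglyMeasurable
  · exact Filter.Eventually.of_forall fun x => (Circle.norm_coe _).le

lemma fourier_add (hψ : Continuous ψ) {f g : F → ℂ} (hf : Integrable f μ) (hg : Integrable g μ)
    (y : F) : fourier ψ μ (fun x => f x + g x) y = fourier ψ μ f y + fourier ψ μ g y := by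
  simp only [fourier_apply, mul_add]
  exact integral_add (integrable_char_mul hψ hf y) (integrable_char_mul hψ hg y)

lemma fourier_smul (c : ℂ) (f : F → ℂ) (y : F) :
    fourier ψ μ (fun x => c * f x) y = c * fourier ψ μ f y := by
  simp only [fourier_apply, ← integral_const_mul]
  congr 1 with x
  ring

lemma fourier_comp_add (a : F) (f : F → ℂ) (y : F) :
    fourier ψ μ (fun x => f (x + a)) y = ψ (a * y) * fourier ψ μ f y := by
  simp only [fourier_apply, ← integral_const_mul]
  rw [← integral_add_right_eq_self (fun x => (ψ (a * y) : ℂ) * ((ψ (-(x * y)) : ℂ) * f x)) a]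
  congr 1 with x
  rw [← mul_assoc, ← Circle.coe_mul, ← AddChar.map_add_eq_mul]
  ring_nf

lemma fourier_char_mul (a : F) (f : F → ℂ) (y : F) :
    fourier ψ μ (fun x => ψ (x * a) * f x) y = fourier ψ μ f (y - a) := by
  simp only [fourier_apply]
  congr 1 with x
  rw [← mul_assoc, ← Circle.coe_mul, ← AddChar.map_add_eq_mul]
  ring_nf

lemma fourier_comp_mul {t : F} (ht : t ≠ 0) (f : F → ℂ) (y : F) :
    fourier ψ μ (fun x => f (t * x)) y = ((modulus t)⁻¹ : ℂ) * fourier ψ μ f (y / t) := by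
  simp only [fourier_apply]
  rw [← integral_comp_mul_left μ ht]
  congr 1 with x
  congr 4
  field_simp

lemma conj_fourier (f : F → ℂ) (y : F) :
    conj (fourier ψ μ f y) = fourier ψ μ (fun x => conj (f x)) (-y) := by
  simp only [fourier_apply, ← integral_conj]
  congr 1 with x
  rw [map_mul, ← Circle.coe_inv_eq_conj, ← AddChar.map_neg_eq_inv]
  ring_nf

/-- The Fourier transform is symmetric, with a dilation. -/
lemma integral_mul_fourier_dilate (hψ : Continuous ψ) {f g : F → ℂ} (hf : Integrable f μ)
    (hg : Integrable g μ) {x : F} (hx : x ≠ 0) :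
    ∫ t, g t * fourier ψ μ f (t * x) ∂μ = ∫ t, f t * fourier ψ μ g (t * x) ∂μ := by
  have h := integral_fourier_mul hψ (f := fun t => f (x⁻¹ * t)) (g := g)
    ((integrable_comp_mul_left μ (inv_ne_zero hx)).2 hf) hg
  simp only [fourier_comp_mul (inv_ne_zero hx)] at h
  have h2 := integral_comp_mul_left μ (inv_ne_zero hx) (fun t => f t * fourier ψ μ g (t * x))
  rw [modulus_inv, Complex.ofReal_inv, inv_inv] at h h2
  have e : ∀ t, x⁻¹ * t * x = t := fun t => by field_simp
  simp only [e] at h2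
  rw [h2] at h
  have h3 : (modulus x : ℂ) ≠ 0 := by exact_mod_cast modulus_ne_zero hx
  refine mul_left_cancel₀ h3 ?_
  rw [← h, ← integral_const_mul]
  congr 1 with t
  rw [div_inv_eq_mul]; ring

end FourierBasics

/-- The properties of Schwartz-Bruhat spaces on which the theory of the commutator operator
rests. -/
structure SchwartzBruhatLike {F : Type} [NontriviallyNormedField F] [ProperSpace F]
    [MeasurableSpace F] [BorelSpace F] (ψ : AddChar F Circle) (𝒮 : Set (F → ℂ)) : Prop where
  add_mem : ∀ φ ∈ 𝒮, ∀ η ∈ 𝒮, (fun x => φ x + η x) ∈ 𝒮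
  smul_mem : ∀ c : ℂ, ∀ φ ∈ 𝒮, (fun x => c * φ x) ∈ 𝒮
  translate_mem : ∀ a : F, ∀ φ ∈ 𝒮, (fun x => φ (x + a)) ∈ 𝒮
  dilate_mem : ∀ t : F, t ≠ 0 → ∀ φ ∈ 𝒮, (fun x => φ (t * x)) ∈ 𝒮
  conj_mem : ∀ φ ∈ 𝒮, (fun x => conj (φ x)) ∈ 𝒮
  continuous : ∀ φ ∈ 𝒮, Continuous φ
  decay : ∀ φ ∈ 𝒮, ∃ C : ℝ, ∀ x, ‖φ x‖ * (1 + modulus x) ^ 2 ≤ C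
  -- The exponent `1/2` is dictated by `ℂ`, where the module is the square of the absolute value and
  -- a Lipschitz estimate becomes one of order `1/2`.
  holder : ∀ φ ∈ 𝒮, ∃ C : ℝ, ∀ x, ‖φ x - φ 0‖ ≤ C * modulus x ^ (1 / 2 : ℝ)
  fourier_mem : ∀ (μ : Measure F) [μ.IsAddHaarMeasure], ∀ φ ∈ 𝒮, fourier ψ μ φ ∈ 𝒮
  opA_mem : ∀ φ ∈ puncturedTestFunctions 𝒮, opA φ ∈ 𝒮
  bump : ∀ V ∈ 𝓝 (1 : F), ∃ r : F → ℝ, (fun x => (r x : ℂ)) ∈ puncturedTestFunctions 𝒮 ∧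
    (∀ x, 0 ≤ r x) ∧ r 1 ≠ 0 ∧ ∀ x, x ∉ V → r x = 0
  ae_eq_zero : ∀ (μ : Measure F) [μ.IsAddHaarMeasure] (f : F → ℂ), MemLp f 2 μ →
    (∀ φ ∈ puncturedTestFunctions 𝒮, ∫ x, φ x * f x ∂μ = 0) → f =ᵐ[μ] 0

/-! ### Integrability of test functions for both measures. -/

section TestFunctions

variable {F : Type} [NontriviallyNormedField F] [ProperSpace F] [MeasurableSpace F] [BorelSpace F]
  {ψ : AddChar F Circle} {𝒮 : Set (F → ℂ)} {μ : Measure F} [μ.IsAddHaarMeasure]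

lemma measurable_log_modulus : Measurable fun x : F => Real.log (modulus x) :=
  Real.measurable_log.comp measurable_modulus

/-- The standard domination in the additive measure. -/
lemma integrable_log_weight {σ : ℝ} (h0 : 0 < σ) (h1 : σ < 1) :
    Integrable (fun x : F => (1 + |Real.log (modulus x)|) * modulus x ^ (-σ) / (1 + modulus x)) μ := by
  rw [← integrable_mul_modulus]
  refine (integrable_mellinWeight μ (sub_pos.2 h1) (by linarith : 1 - σ < 1)).congr ?_
  filter_upwards [multHaar_ae_ne_zero μ] with x hx
  have h := modulus_pos hx
  unfold mellinWeight
  rw [Real.rpow_sub h, Real.rpow_one, Real.rpow_neg h.le]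
  ring

lemma rpow_half_le {u : ℝ} (hu : 0 ≤ u) : u ^ (1 / 2 : ℝ) ≤ 1 + u := by
  rw [← Real.sqrt_eq_rpow]
  nlinarith [Real.sq_sqrt hu, Real.sqrt_nonneg u, sq_nonneg (Real.sqrt u - 1)]

lemma one_le_mul_rpow {u : ℝ} (hu : 0 < u) : 1 ≤ (1 + u) * u ^ (-(1 / 2) : ℝ) := by
  rw [Real.rpow_neg hu.le, ← div_eq_mul_inv, one_le_div (Real.rpow_pos_of_pos hu _)]
  exact rpow_half_le hu.le

lemma integrable_log_mul_of_decay {f : F → ℂ} (hf : Measurable f) {C : ℝ}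
    (h : ∀ x, ‖f x‖ * (1 + modulus x) ^ 2 ≤ C) :
    Integrable (fun x => ‖f x‖ * (1 + |Real.log (modulus x)|)) μ := by
  have hm : Measurable (fun x => ‖f x‖ * (1 + |Real.log (modulus x)|)) :=
    hf.norm.mul (measurable_const.add (continuous_abs.measurable.comp measurable_log_modulus))
  refine ((integrable_log_weight (μ := μ) (σ := 1 / 2) (by norm_num) (by norm_num)).const_mul
    C).mono' hm.aestronglyMeasurable ?_
  filter_upwards [ae_ne_zero μ] with x hx
  have hp := modulus_pos hx
  rw [Real.norm_of_nonneg (by positivity)]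
  -- One of the two factors `1 + |x|` of the decay pays for inserting `|x| ^ (-1/2)`, which puts the
  -- integrand under the standard weight with `σ = 1/2`.
  have h1 := one_le_mul_rpow hp
  have hC : ‖f x‖ ≤ C / (1 + modulus x) ^ 2 := by
    rw [le_div_iff₀ (by positivity)]; exact h x
  have hC0 : 0 ≤ C := le_trans (by positivity) (h x)
  calc ‖f x‖ * (1 + |Real.log (modulus x)|)
      ≤ C / (1 + modulus x) ^ 2 * (1 + |Real.log (modulus x)|) * 1 := by rw [mul_one]; gcongr
    _ ≤ C / (1 + modulus x) ^ 2 * (1 + |Real.log (modulus x)|) *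
        ((1 + modulus x) * modulus x ^ (-(1 / 2) : ℝ)) := by gcongr
    _ = _ := by field_simp

lemma integrable_of_decay {f : F → ℂ} (hf : Measurable f) {C : ℝ}
    (h : ∀ x, ‖f x‖ * (1 + modulus x) ^ 2 ≤ C) : Integrable f μ := by
  refine (integrable_log_mul_of_decay hf h).mono' hf.aestronglyMeasurable
    (Filter.Eventually.of_forall fun x => ?_)
  nlinarith [norm_nonneg (f x), abs_nonneg (Real.log (modulus x))]

namespace SchwartzBruhatLike

variable (H : SchwartzBruhatLike ψ 𝒮) {φ η : F → ℂ}
include H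

lemma measurable (hφ : φ ∈ 𝒮) : Measurable φ := (H.continuous φ hφ).measurable

lemma integrable (hφ : φ ∈ 𝒮) : Integrable φ μ := by
  obtain ⟨C, hC⟩ := H.decay φ hφ
  exact integrable_of_decay (H.measurable hφ) hC

lemma integrable_log (hφ : φ ∈ 𝒮) :
    Integrable (fun x => ‖φ x‖ * (1 + |Real.log (modulus x)|)) μ := by
  obtain ⟨C, hC⟩ := H.decay φ hφ
  exact integrable_log_mul_of_decay (H.measurable hφ) hC

lemma memLp (hφ : φ ∈ 𝒮) : MemLp φ 2 μ := by
  obtain ⟨C, hC⟩ := H.decay φ hφ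
  rw [memLp_two_iff_integrable_sq_norm (H.measurable hφ).aestronglyMeasurable]
  refine ((H.integrable (μ := μ) hφ).norm.const_mul C).mono'
    ((H.measurable hφ).norm.pow_const 2).aestronglyMeasurable
    (Filter.Eventually.of_forall fun x => ?_)
  have h0 := modulus_nonneg x
  rw [Real.norm_of_nonneg (by positivity), sq]
  refine mul_le_mul_of_nonneg_right (le_trans ?_ (hC x)) (norm_nonneg _)
  exact le_mul_of_one_le_right (norm_nonneg _) (by nlinarith)

/-- Near the origin the Hölder bound supplies `|x| ^ (1/2)` against the singularity of `dx/|x|`; the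
decay of `φ` takes over where `|x| ≥ 1`. -/
lemma integrable_log_multHaar (hφ : φ ∈ 𝒮) (h0 : φ 0 = 0) :
    Integrable (fun x => ‖φ x‖ * (1 + |Real.log (modulus x)|)) (multHaar μ) := by
  obtain ⟨C, hC⟩ := H.decay φ hφ
  obtain ⟨D, hD⟩ := H.holder φ hφ
  have hm : Measurable (fun x => ‖φ x‖ * (1 + |Real.log (modulus x)|)) :=
    (H.measurable hφ).norm.mul
      (measurable_const.add (continuous_abs.measurable.comp measurable_log_modulus))
  refine ((integrable_mellinWeight μ (σ := 1 / 2) (by norm_num) (by norm_num)).const_mul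
    (2 * |D| + |C|)).mono' hm.aestronglyMeasurable ?_
  filter_upwards [multHaar_ae_ne_zero μ] with x hx
  have hp := modulus_pos hx
  have hr := Real.rpow_pos_of_pos hp (1 / 2)
  rw [Real.norm_of_nonneg (by positivity), mellinWeight]
  have key : ‖φ x‖ * (1 + modulus x) ≤ (2 * |D| + |C|) * modulus x ^ (1 / 2 : ℝ) := by
    rcases le_total (modulus x) 1 with h1 | h1
    · have h2 := hD x
      rw [h0, sub_zero] at h2
      have h3 : ‖φ x‖ ≤ |D| * modulus x ^ (1 / 2 : ℝ) :=
        h2.trans (by gcongr; exact le_abs_self D)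
      have h4 : 0 ≤ |C| * modulus x ^ (1 / 2 : ℝ) := by positivity
      nlinarith [norm_nonneg (φ x)]
    · have h2 := (hC x).trans (le_abs_self C)
      have h3 : 1 ≤ modulus x ^ (1 / 2 : ℝ) := Real.one_le_rpow h1 (by norm_num)
      have h4 : ‖φ x‖ * (1 + modulus x) ≤ |C| := by
        refine le_trans ?_ h2
        rw [sq, ← mul_assoc]
        exact le_mul_of_one_le_right (by positivity) (by linarith)
      nlinarith [abs_nonneg C, abs_nonneg D, mul_nonneg (abs_nonneg D) hr.le]
  have e : ‖φ x‖ * (1 + |Real.log (modulus x)|) =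
      ‖φ x‖ * (1 + modulus x) * ((1 + |Real.log (modulus x)|) / (1 + modulus x)) := by
    field_simp
  rw [e]
  calc _ ≤ (2 * |D| + |C|) * modulus x ^ (1 / 2 : ℝ) *
        ((1 + |Real.log (modulus x)|) / (1 + modulus x)) := by gcongr
    _ = _ := by ring

lemma integrable_multHaar_of_zero (hφ : φ ∈ 𝒮) (h0 : φ 0 = 0) : Integrable φ (multHaar μ) := by
  refine (H.integrable_log_multHaar (μ := μ) hφ h0).mono' (H.measurable hφ).aestronglyMeasurable
    (Filter.Eventually.of_forall fun x => ?_)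
  nlinarith [norm_nonneg (φ x), abs_nonneg (Real.log (modulus x))]

/-- A test function of integral one for the multiplicative measure. -/
lemma exists_bump_integral {V : Set F} (hV : V ∈ 𝓝 (1 : F)) :
    ∃ r : F → ℝ, (fun x => (r x : ℂ)) ∈ puncturedTestFunctions 𝒮 ∧ (∀ x, 0 ≤ r x) ∧
      (∀ x, x ∉ V → r x = 0) ∧ 0 < ∫ x, r x ∂μ ∧ 0 < ∫ x, r x ∂(multHaar μ) := by
  obtain ⟨r, hr, h0, h1, h2⟩ := H.bump V hV
  have hc : Continuous r := by
    have := Complex.continuous_re.comp (H.continuous _ hr.1)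
    exact this
  have hz : r 0 = 0 := by simpa using hr.2.2.self_of_nhds
  have hpos : ∃ᶠ x in ae μ, 0 < r x := by
    intro hne
    have hopen : IsOpen {x | 0 < r x} := isOpen_lt continuous_const hc
    have h3 := hopen.measure_pos μ ⟨1, lt_of_le_of_ne (h0 1) (Ne.symm h1)⟩
    have h4 : μ {x | 0 < r x} = 0 := by
      rw [ae_iff] at hne; simpa using hne
    exact h3.ne' h4
  have hi : Integrable r μ := by
    simpa using (H.integrable (μ := μ) hr.1).re
  have hi2 : Integrable r (multHaar μ) := by
    simpa using (H.integrable_multHaar_of_zero (μ := μ) hr.1 (by simp [hz])).re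
  refine ⟨r, hr, h0, h2, ?_, ?_⟩
  · refine lt_of_le_of_ne (integral_nonneg h0) fun h => ?_
    have := (integral_eq_zero_iff_of_nonneg h0 hi).1 h.symm
    exact hpos (this.mono fun x hx => by simp [hx])
  · refine lt_of_le_of_ne (integral_nonneg h0) fun h => ?_
    have := (integral_eq_zero_iff_of_nonneg h0 hi2).1 h.symm
    have h5 : ∀ᵐ x ∂μ, r x = 0 := (absolutelyContinuous_multHaar μ).ae_le this
    exact hpos (h5.mono fun x hx => by simp [hx])

end SchwartzBruhatLike

end TestFunctions

/-! ### Fourier inversion up to a constant, and the self-dual measure. -/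

section SelfDual

variable {F : Type} [NontriviallyNormedField F] [ProperSpace F] [MeasurableSpace F] [BorelSpace F]
  {ψ : AddChar F Circle} {𝒮 : Set (F → ℂ)} {μ : Measure F} [μ.IsAddHaarMeasure]

/-- Both sides are the double integral of `g(t) ℱf(tx)`, whose inner integral over `t` is symmetric
in `f` and `g`. Membership in `𝒮` is not asked for, so that the lemma applies to a test function
multiplied by a character. -/
lemma integral_fourier_mul_symm (hψ : Continuous ψ) {f g : F → ℂ} (hfm : Measurable f)
    (hgm : Measurable g) (hf : Integrable f μ) (hg : Integrable g μ)
    (hf' : Integrable f (multHaar μ)) (hg' : Integrable g (multHaar μ))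
    (hff : Integrable (fourier ψ μ f) μ) (hgf : Integrable (fourier ψ μ g) μ) :
    (∫ x, g x ∂(multHaar μ)) * ∫ x, fourier ψ μ f x ∂μ =
      (∫ x, f x ∂(multHaar μ)) * ∫ x, fourier ψ μ g x ∂μ := by
  have h1 := mellin_fubini μ (h := g) (G := fourier ψ μ f) (w := fun _ => 1) (a := fun _ => 1)
    (b := fun _ => 1) hgm (continuous_fourier hψ hf).measurable measurable_const (by simp)
    (by simpa using hg'.norm) (by simpa using hff.norm)
  have h2 := mellin_fubini μ (h := f) (G := fourier ψ μ g) (w := fun _ => 1) (a := fun _ => 1)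
    (b := fun _ => 1) hfm (continuous_fourier hψ hg).measurable measurable_const (by simp)
    (by simpa using hf'.norm) (by simpa using hgf.norm)
  simp only [one_mul, integral_mul_const] at h1 h2
  rw [h1, h2]
  refine integral_congr_ae ?_
  filter_upwards [ae_ne_zero μ] with x hx
  exact integral_mul_fourier_dilate hψ hf hg hx

namespace SchwartzBruhatLike

variable (H : SchwartzBruhatLike ψ 𝒮) {φ η : F → ℂ}
include H

lemma integrable_fourier (hφ : φ ∈ 𝒮) : Integrable (fourier ψ μ φ) μ :=
  H.integrable (H.fourier_mem μ φ hφ)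

lemma sub_mem (hφ : φ ∈ 𝒮) (hη : η ∈ 𝒮) : (fun x => φ x - η x) ∈ 𝒮 := by
  have := H.add_mem _ hφ _ (H.smul_mem (-1) _ hη)
  simpa [sub_eq_add_neg] using this

lemma neg_mem (hφ : φ ∈ 𝒮) : (fun x => φ (-x)) ∈ 𝒮 := by
  have := H.dilate_mem (-1) (by simp) _ hφ
  simpa using this

/-- The Fourier transform of a test function which vanishes at the origin has integral zero. -/
lemma integral_fourier_eq_zero (hψ : Continuous ψ) (hψ1 : ψ ≠ 1) (hφ : φ ∈ 𝒮) (h0 : φ 0 = 0) :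
    ∫ x, fourier ψ μ φ x ∂μ = 0 := by
  obtain ⟨a, ha⟩ : ∃ a, ψ a ≠ 1 := by
    by_contra! h
    exact hψ1 (DFunLike.ext _ _ (by simpa using h))
  have hre : (ψ a : ℂ).re < 1 := by
    refine lt_of_le_of_ne ((Complex.re_le_norm _).trans (Circle.norm_coe _).le) fun h => ha ?_
    have hn := Circle.norm_coe (ψ a)
    have h2 : (ψ a : ℂ).im = 0 := by
      have := Complex.sq_norm (ψ a : ℂ)
      rw [hn, Complex.normSq_apply, h] at this
      nlinarith
    ext
    exact Complex.ext (by simpa using h) (by simpa using h2)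
  -- Halfway between `Re ψ(a)` and `1`: then `Re ψ(xa)` stays below `c < 1` on a neighbourhood of `x
  -- = 1`, where the bump is supported.
  set c : ℝ := (1 + (ψ a : ℂ).re) / 2 with hc
  have hc1 : c < 1 := by rw [hc]; linarith
  have hcont : Continuous fun x : F => (ψ (x * a) : ℂ).re := by fun_prop
  have hV : {x : F | (ψ (x * a) : ℂ).re < c} ∈ 𝓝 (1 : F) :=
    (isOpen_lt hcont continuous_const).mem_nhds (by
      simp only [Set.mem_ofPred_eq, one_mul, hc]; linarith)
  obtain ⟨r, hr, hr0, hrV, -, hrpos⟩ := H.exists_bump_integral (μ := μ) hV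
  have hz : r 0 = 0 := by simpa using hr.2.2.self_of_nhds
  set ρ : F → ℂ := fun x => r x with hρ
  have hρi : Integrable ρ μ := H.integrable hr.1
  have hρν : Integrable ρ (multHaar μ) := H.integrable_multHaar_of_zero hr.1 (by simp [hρ, hz])
  have hrν : Integrable r (multHaar μ) := by simpa [hρ] using hρν.re
  have hρm : Measurable ρ := H.measurable hr.1
  -- Modulating by a character translates the transform, so `ℱτ` and `ℱρ` have the same integral;
  -- but `τ` and `ρ` have different integrals for `dx/|x|`. The symmetry relation between them then
  -- forces the integral of `ℱρ` to vanish, and the relation between `ρ` and `φ` transfers this to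
  -- `φ`.
  set τ : F → ℂ := fun x => ψ (x * a) * ρ x with hτ
  have hψm : Continuous fun x : F => (ψ (x * a) : ℂ) := by fun_prop
  have hτm : Measurable τ := hψm.measurable.mul hρm
  have hb : ∀ x, ‖(ψ (x * a) : ℂ)‖ ≤ 1 := fun x => (Circle.norm_coe _).le
  have hτi : Integrable τ μ := hρi.bdd_mul hψm.aestronglyMeasurable (Filter.Eventually.of_forall hb)
  have hτν : Integrable τ (multHaar μ) :=
    hρν.bdd_mul hψm.aestronglyMeasurable (Filter.Eventually.of_forall hb)
  have hτf : fourier ψ μ τ = fun y => fourier ψ μ ρ (y - a) := by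
    ext y; exact fourier_char_mul a ρ y
  have hρf : Integrable (fourier ψ μ ρ) μ := H.integrable_fourier hr.1
  have hτfi : Integrable (fourier ψ μ τ) μ := by rw [hτf]; exact hρf.comp_sub_right a
  have hτint : ∫ x, fourier ψ μ τ x ∂μ = ∫ x, fourier ψ μ ρ x ∂μ := by
    rw [hτf]; exact integral_sub_right_eq_self (fourier ψ μ ρ) a
  have h1 := integral_fourier_mul_symm hψ hρm hτm hρi hτi hρν hτν hρf hτfi
  rw [hτint] at h1
  have hne : ∫ x, τ x ∂(multHaar μ) ≠ ∫ x, ρ x ∂(multHaar μ) := by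
    intro h
    have h2 := congrArg Complex.re h
    have e1 : (∫ x, ρ x ∂(multHaar μ)).re = ∫ x, r x ∂(multHaar μ) := by
      rw [hρ, integral_complex_ofReal, Complex.ofReal_re]
    have e2 : (∫ x, τ x ∂(multHaar μ)).re = ∫ x, (τ x).re ∂(multHaar μ) :=
      (integral_re hτν).symm
    rw [e1, e2] at h2
    have h3 : ∫ x, (τ x).re ∂(multHaar μ) ≤ ∫ x, c * r x ∂(multHaar μ) := by
      refine integral_mono hτν.re (hrν.const_mul c) fun x => ?_
      simp only [hτ, hρ, Complex.re_mul_ofReal]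
      by_cases hx : x ∈ {x : F | (ψ (x * a) : ℂ).re < c}
      · exact mul_le_mul_of_nonneg_right (le_of_lt hx) (hr0 x)
      · simp [hrV x hx]
    rw [h2, integral_const_mul] at h3
    nlinarith
  have hρ0 : ∫ x, fourier ψ μ ρ x ∂μ = 0 := by
    by_contra hne'
    exact hne (mul_right_cancel₀ hne' h1)
  have h2 := integral_fourier_mul_symm hψ hρm (H.measurable hφ) hρi (H.integrable hφ) hρν
    (H.integrable_multHaar_of_zero hφ h0) hρf (H.integrable_fourier hφ)
  rw [hρ0, mul_zero] at h2
  have h3 : ∫ x, ρ x ∂(multHaar μ) ≠ 0 := by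
    rw [hρ, integral_complex_ofReal]
    exact_mod_cast hrpos.ne'
  exact (mul_eq_zero.1 h2.symm).resolve_left h3

/-- With `ρ(0) = 1`, the function `φ - φ(0)ρ` vanishes at the origin, so the integral of `ℱφ` is
`φ(0)` times that of `ℱρ`. Translation gives the other points. -/
lemma exists_fourier_fourier (hψ : Continuous ψ) (hψ1 : ψ ≠ 1) :
    ∃ c : ℂ, ∀ φ ∈ 𝒮, ∀ x, fourier ψ μ (fourier ψ μ φ) x = c * φ (-x) := by
  obtain ⟨r, hr, -, hr1, -⟩ := H.bump Set.univ Filter.univ_mem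
  set ρ : F → ℂ := fun x => (r 1 : ℂ)⁻¹ * r (x + 1) with hρdef
  have hρ : ρ ∈ 𝒮 := H.smul_mem _ _ (H.translate_mem 1 _ hr.1)
  have hρ0 : ρ 0 = 1 := by
    have : (r 1 : ℂ) ≠ 0 := by exact_mod_cast hr1
    simp [hρdef, this]
  have key : ∀ φ ∈ 𝒮, ∫ y, fourier ψ μ φ y ∂μ = (∫ y, fourier ψ μ ρ y ∂μ) * φ 0 := by
    intro φ hφ
    have h1 := H.smul_mem (φ 0) _ hρ
    have h2 := H.integral_fourier_eq_zero (μ := μ) hψ hψ1 (H.sub_mem hφ h1) (by simp [hρ0])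
    have h3 : ∀ y, fourier ψ μ (fun x => φ x - φ 0 * ρ x) y =
        fourier ψ μ φ y + (-φ 0) * fourier ψ μ ρ y := by
      intro y
      rw [← fourier_smul, ← fourier_add hψ (H.integrable hφ)
        (H.integrable (H.smul_mem (-φ 0) _ hρ))]
      congr 1; ext x; ring
    simp only [h3] at h2
    rw [integral_add (H.integrable_fourier hφ) ((H.integrable_fourier hρ).const_mul _),
      integral_const_mul] at h2
    linear_combination h2
  refine ⟨∫ y, fourier ψ μ ρ y ∂μ, fun φ hφ x => ?_⟩
  have h := key _ (H.translate_mem (-x) _ hφ)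
  rw [zero_add] at h
  rw [← h, fourier_apply]
  congr 1 with y
  rw [fourier_comp_add]
  ring_nf

/-- Kept for an arbitrary constant: it is used before normalisation to see that `c` is positive, and
after it with `c = 1` to get the isometry on `L²`. -/
lemma plancherel_const (hψ : Continuous ψ) {c : ℂ}
    (hc : ∀ φ ∈ 𝒮, ∀ x, fourier ψ μ (fourier ψ μ φ) x = c * φ (-x)) (hφ : φ ∈ 𝒮) (hη : η ∈ 𝒮) :
    ∫ y, fourier ψ μ φ y * conj (fourier ψ μ η y) ∂μ = c * ∫ x, φ x * conj (η x) ∂μ := by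
  have hη' := H.conj_mem _ hη
  have h1 : (fun y => conj (fourier ψ μ η y)) =
      fun y => fourier ψ μ (fun x => conj (η x)) ((-1) * y) := by
    ext y; rw [conj_fourier, neg_one_mul]
  have h2 := integral_fourier_mul hψ (H.integrable (μ := μ) hφ)
    (H.integrable (μ := μ) (H.conj_mem _ (H.fourier_mem μ _ hη)))
  rw [h2, ← integral_const_mul]
  congr 1 with x
  rw [h1, fourier_comp_mul (by simp), hc _ hη']
  simp
  ring_nf

/-- Plancherel for one nonzero test function exhibits the constant as a ratio of two squared norms.
-/
lemma fourier_fourier_pos (hψ : Continuous ψ) (hψ1 : ψ ≠ 1) :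
    ∃ c : ℝ, 0 < c ∧ ∀ φ ∈ 𝒮, ∀ x, fourier ψ μ (fourier ψ μ φ) x = c * φ (-x) := by
  obtain ⟨c, hc⟩ := H.exists_fourier_fourier (μ := μ) hψ hψ1
  obtain ⟨r, hr, hr0, -, hrpos, -⟩ := H.exists_bump_integral (μ := μ) Filter.univ_mem
  set ρ : F → ℂ := fun x => r x with hρ
  have hpos : ∀ φ ∈ 𝒮, ∀ x, φ x ≠ 0 → 0 < ∫ x, ‖φ x‖ ^ 2 ∂μ := by
    intro φ hφ x hx
    have hcont : Continuous fun x => ‖φ x‖ ^ 2 := (H.continuous _ hφ).norm.pow 2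
    have hi : Integrable (fun x => ‖φ x‖ ^ 2) μ :=
      (memLp_two_iff_integrable_sq_norm (H.measurable hφ).aestronglyMeasurable).1 (H.memLp hφ)
    rw [integral_pos_iff_support_of_nonneg (fun x => by positivity) hi]
    exact (hcont.isOpen_support).measure_pos μ ⟨x, by simpa using hx⟩
  have h1 := H.plancherel_const (μ := μ) hψ hc hr.1 hr.1
  simp only [Complex.mul_conj'] at h1
  have hint : fourier ψ μ ρ 0 ≠ 0 := by
    rw [fourier_apply]
    simp only [mul_zero, neg_zero, AddChar.map_zero_eq_one, Circle.coe_one, one_mul, hρ]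
    rw [integral_complex_ofReal]
    exact_mod_cast hrpos.ne'
  have hA := hpos _ (H.fourier_mem μ _ hr.1) 0 hint
  obtain ⟨x, hx⟩ : ∃ x, ρ x ≠ 0 := by
    by_contra! h
    apply hint
    rw [fourier_apply]
    simp [h]
  have hB := hpos _ hr.1 x hx
  norm_cast at h1
  refine ⟨(∫ x, ‖fourier ψ μ ρ x‖ ^ 2 ∂μ) / ∫ x, ‖ρ x‖ ^ 2 ∂μ, div_pos hA hB, fun φ hφ x => ?_⟩
  rw [hc φ hφ]
  congr 1
  push_cast
  rw [eq_div_iff (by exact_mod_cast hB.ne')]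
  exact h1.symm

end SchwartzBruhatLike

lemma fourier_smul_measure (k : NNReal) (φ : F → ℂ) (y : F) :
    fourier ψ (k • μ) φ y = (k : ℂ) * fourier ψ μ φ y := by
  simp only [fourier_apply]
  rw [integral_smul_nnreal_measure]
  simp [NNReal.smul_def]

lemma SchwartzBruhatLike.existsUnique_selfDual (H : SchwartzBruhatLike ψ 𝒮) (hψ : Continuous ψ)
    (hψ1 : ψ ≠ 1) : ∃! μ : Measure F, IsSelfDualMeasure ψ μ 𝒮 := by
  have hscale : ∀ (ν : Measure F) [ν.IsAddHaarMeasure] (k : NNReal) (φ : F → ℂ) (x : F),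
      fourier ψ (k • ν) (fourier ψ (k • ν) φ) x =
        (k : ℂ) ^ 2 * fourier ψ ν (fourier ψ ν φ) x := by
    intro ν _ k φ x
    have e : fourier ψ (k • ν) φ = fun y => (k : ℂ) * fourier ψ ν φ y := by
      ext y; exact fourier_smul_measure k φ y
    rw [fourier_smul_measure, e, fourier_smul]
    ring
  obtain ⟨c, hc, hcF⟩ := H.fourier_fourier_pos (μ := Measure.addHaar) hψ hψ1
  -- Multiplying the measure by `k` multiplies the double transform by `k²`; hence `k² c = 1`, which
  -- also fixes the nonnegative factor `k` uniquely.
  set k : NNReal := ⟨(Real.sqrt c)⁻¹, by positivity⟩ with hk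
  have hk0 : k ≠ 0 := by
    intro h
    have : ((k : NNReal) : ℝ) = 0 := by rw [h]; rfl
    have h2 : ((k : NNReal) : ℝ) = (Real.sqrt c)⁻¹ := rfl
    rw [h2] at this
    exact (inv_pos.2 (Real.sqrt_pos.2 hc)).ne' this
  have hk2 : ((k : ℝ) : ℂ) ^ 2 * c = 1 := by
    have h2 : ((k : NNReal) : ℝ) = (Real.sqrt c)⁻¹ := rfl
    rw [h2, ← Complex.ofReal_pow, inv_pow, Real.sq_sqrt hc.le, ← Complex.ofReal_mul,
      inv_mul_cancel₀ hc.ne', Complex.ofReal_one]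
  refine ⟨k • Measure.addHaar, ⟨?_, fun φ hφ x => ?_⟩, ?_⟩
  · exact Measure.IsAddHaarMeasure.nnreal_smul _ hk0
  · rw [hscale, hcF φ hφ, ← mul_assoc]
    have := hk2
    rw [show ((k : ℂ)) = ((k : ℝ) : ℂ) from rfl, this, one_mul]
  · rintro ν ⟨hν, hνF⟩
    have h1 := Measure.isAddLeftInvariant_eq_smul ν (Measure.addHaar : Measure F)
    set j := ν.addHaarScalarFactor (Measure.addHaar : Measure F)
    rw [h1]
    congr 1
    obtain ⟨r, hr, -, hr1, -⟩ := H.bump Set.univ Filter.univ_mem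
    have h2 := hνF _ hr.1 (-1)
    rw [h1, hscale, hcF _ hr.1, neg_neg, ← mul_assoc] at h2
    have hr1' : (r 1 : ℂ) ≠ 0 := by exact_mod_cast hr1
    have h3 : ((j : ℝ) : ℂ) ^ 2 * c = 1 := mul_right_cancel₀ hr1' (by rw [one_mul]; exact h2)
    have h4 : (j : ℝ) ^ 2 * c = (k : ℝ) ^ 2 * c := by
      have := h3.trans hk2.symm
      exact_mod_cast this
    have h5 := mul_right_cancel₀ hc.ne' h4
    have h6 : (j : ℝ) = k := by
      exact (sq_eq_sq₀ (NNReal.coe_nonneg j) (NNReal.coe_nonneg k)).1 h5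
    exact_mod_cast h6

end SelfDual

/-! ### The Fourier transform of `log|x|` away from the origin. -/

section LogFunctional

variable {F : Type} [NontriviallyNormedField F] [ProperSpace F] [MeasurableSpace F] [BorelSpace F]
  {ψ : AddChar F Circle} {𝒮 : Set (F → ℂ)} {μ : Measure F} [μ.IsAddHaarMeasure]

/-- The value `∫ log |x| ℱφ(x) dx`. -/
def logFunctional (ψ : AddChar F Circle) (μ : Measure F) (φ : F → ℂ) : ℂ :=
  ∫ x, (Real.log (modulus x) : ℂ) * fourier ψ μ φ x ∂μ

lemma integrable_log_fourier (H : SchwartzBruhatLike ψ 𝒮) {φ : F → ℂ} (hφ : φ ∈ 𝒮) :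
    Integrable (fun x => (Real.log (modulus x) : ℂ) * φ x) μ := by
  refine (H.integrable_log (μ := μ) hφ).mono'
    ((Complex.measurable_ofReal.comp measurable_log_modulus).mul
      (H.measurable hφ)).aestronglyMeasurable (Filter.Eventually.of_forall fun x => ?_)
  rw [norm_mul, Complex.norm_real, Real.norm_eq_abs]
  nlinarith [norm_nonneg (φ x), abs_nonneg (Real.log (modulus x))]

/-- The exchange argument again, with the weight `log|x|`. Dilating the weight adds `-log|t|` times
the integral of `ℱf`, which is zero because `f` vanishes at the origin. Thus the functional and
integration against `dx/|x|` are proportional on such functions. -/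
lemma logFunctional_symm (H : SchwartzBruhatLike ψ 𝒮) (hψ : Continuous ψ) (hψ1 : ψ ≠ 1)
    {f g : F → ℂ} (hf : f ∈ 𝒮) (hg : g ∈ 𝒮) (hf0 : f 0 = 0) (hg0 : g 0 = 0) :
    (∫ x, g x ∂(multHaar μ)) * logFunctional ψ μ f =
      (∫ x, f x ∂(multHaar μ)) * logFunctional ψ μ g := by
  have hw : Measurable fun x : F => (Real.log (modulus x) : ℂ) :=
    Complex.measurable_ofReal.comp measurable_log_modulus
  have hwb : ∀ t x : F, t ≠ 0 → x ≠ 0 → ‖(Real.log (modulus (x / t)) : ℂ)‖ ≤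
      (1 + |Real.log (modulus t)|) * (1 + |Real.log (modulus x)|) := by
    intro t x ht hx
    rw [Complex.norm_real, Real.norm_eq_abs, modulus_div,
      Real.log_div (modulus_ne_zero hx) (modulus_ne_zero ht)]
    have := abs_sub (Real.log (modulus x)) (Real.log (modulus t))
    nlinarith [abs_nonneg (Real.log (modulus x)), abs_nonneg (Real.log (modulus t)),
      mul_nonneg (abs_nonneg (Real.log (modulus x))) (abs_nonneg (Real.log (modulus t)))]
  have key : ∀ f ∈ 𝒮, ∀ g ∈ 𝒮, f 0 = 0 → g 0 = 0 →
      (∫ x, g x ∂(multHaar μ)) * logFunctional ψ μ f =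
        ∫ x, (Real.log (modulus x) : ℂ) * ∫ t, g t * fourier ψ μ f (t * x) ∂μ ∂μ := by
    intro f hf g hg hf0 hg0
    have hff := H.fourier_mem μ _ hf
    rw [← mellin_fubini μ (H.measurable hg) (H.measurable hff) hw hwb
      (H.integrable_log_multHaar hg hg0) (H.integrable_log hff), ← integral_mul_const]
    refine integral_congr_ae ?_
    filter_upwards [multHaar_ae_ne_zero μ] with t ht
    congr 1
    have h1 : ∀ᵐ x ∂μ, (Real.log (modulus (x / t)) : ℂ) * fourier ψ μ f x =
        (Real.log (modulus x) : ℂ) * fourier ψ μ f x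
          - (Real.log (modulus t) : ℂ) * fourier ψ μ f x := by
      filter_upwards [ae_ne_zero μ] with x hx
      rw [modulus_div, Real.log_div (modulus_ne_zero hx) (modulus_ne_zero ht)]
      push_cast; ring
    rw [integral_congr_ae h1, integral_sub (integrable_log_fourier H hff)
      ((H.integrable hff).const_mul _), integral_const_mul,
      H.integral_fourier_eq_zero hψ hψ1 hf hf0]
    simp [logFunctional]
  rw [key f hf g hg hf0 hg0, key g hg f hf hg0 hf0]
  refine integral_congr_ae ?_
  filter_upwards [ae_ne_zero μ] with x hx
  rw [integral_mul_fourier_dilate hψ (H.integrable hf) (H.integrable hg) hx]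

/-- Away from the origin, the Fourier transform of `log |x|` is a multiple of `|x|⁻¹`. -/
lemma exists_logFunctional (H : SchwartzBruhatLike ψ 𝒮) (hψ : Continuous ψ) (hψ1 : ψ ≠ 1) :
    ∃ c : ℝ, ∀ φ ∈ 𝒮, φ 0 = 0 → logFunctional ψ μ φ = c * ∫ x, φ x ∂(multHaar μ) := by
  obtain ⟨r, hr, -, -, -, hpos⟩ := H.exists_bump_integral (μ := μ) Filter.univ_mem
  have hz : r 0 = 0 := by simpa using hr.2.2.self_of_nhds
  set ρ : F → ℂ := fun x => r x with hρ
  -- The logarithm is real and even and `ρ` is real, so the constant is real; the self-adjointness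
  -- of `K` depends on this.
  have hreal : conj (logFunctional ψ μ ρ) = logFunctional ψ μ ρ := by
    rw [logFunctional, ← integral_conj, ← integral_neg_eq_self]
    congr 1 with x
    rw [map_mul, Complex.conj_ofReal, conj_fourier, modulus_neg, neg_neg]
    simp only [hρ, Complex.conj_ofReal]
  obtain ⟨l, hl⟩ := Complex.conj_eq_iff_real.1 hreal
  refine ⟨l / ∫ x, r x ∂(multHaar μ), fun φ hφ h0 => ?_⟩
  have h := logFunctional_symm (μ := μ) H hψ hψ1 hφ hr.1 h0 (by simp [hρ, hz])
  change _ = _ * logFunctional ψ μ ρ at h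
  rw [integral_complex_ofReal, hl] at h
  have hne : ((∫ x, r x ∂(multHaar μ) : ℝ) : ℂ) ≠ 0 := by exact_mod_cast hpos.ne'
  push_cast
  field_simp
  linear_combination h

end LogFunctional

/-! ### Weak integrals of operators, and closures of restrictions of bounded operators. -/

section AbstractOperators

/-- A weak integral of contractions against an integrable kernel. -/
lemma exists_weak_integral {H : Type*} [NormedAddCommGroup H] [InnerProductSpace ℂ H]
    [CompleteSpace H] {T : Type*} [MeasurableSpace T] {ν : Measure T} {κ : T → ℂ}
    (hκ : Integrable κ ν) (V : T → H →L[ℂ] H) (hV : ∀ t f, ‖V t f‖ ≤ ‖f‖)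
    (hm : ∀ f g, AEStronglyMeasurable (fun t => inner ℂ f (V t g)) ν) :
    ∃ K : H →L[ℂ] H, ∀ f g, inner ℂ f (K g) = ∫ t, κ t * inner ℂ f (V t g) ∂ν := by
  have hb : ∀ f g t, ‖inner ℂ f (V t g)‖ ≤ ‖f‖ * ‖g‖ := fun f g t =>
    (norm_inner_le_norm _ _).trans (by gcongr; exact hV t g)
  have hi : ∀ f g, Integrable (fun t => κ t * inner ℂ f (V t g)) ν := fun f g =>
    hκ.mul_bdd (c := ‖f‖ * ‖g‖) (hm f g) (Filter.Eventually.of_forall (hb f g))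
  let B₀ : H →ₗ⋆[ℂ] H →ₗ[ℂ] ℂ := LinearMap.mk₂'ₛₗ (starRingEnd ℂ) (RingHom.id ℂ)
    (fun f g => ∫ t, κ t * inner ℂ f (V t g) ∂ν)
    (fun f f' g => by
      rw [← integral_add (hi f g) (hi f' g)]
      congr 1 with t
      rw [inner_add_left, mul_add])
    (fun c f g => by
      rw [smul_eq_mul, ← integral_const_mul]
      congr 1 with t
      rw [inner_smul_left]; ring)
    (fun f g g' => by
      rw [← integral_add (hi f g) (hi f g')]
      congr 1 with t
      rw [map_add, inner_add_right, mul_add])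
    (fun c f g => by
      rw [RingHom.id_apply, smul_eq_mul, ← integral_const_mul]
      congr 1 with t
      rw [map_smul, inner_smul_right]; ring)
  let B : H →L⋆[ℂ] H →L[ℂ] ℂ := B₀.mkContinuous₂ (∫ t, ‖κ t‖ ∂ν) (fun f g => by
    calc ‖∫ t, κ t * inner ℂ f (V t g) ∂ν‖ ≤ ∫ t, ‖κ t‖ * (‖f‖ * ‖g‖) ∂ν := by
          refine norm_integral_le_of_norm_le (hκ.norm.mul_const _)
            (Filter.Eventually.of_forall fun t => ?_)
          rw [norm_mul]
          gcongr
          exact hb f g t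
      _ = _ := by rw [integral_mul_const, mul_assoc])
  -- The operator attached to `B` acts on the left argument of the inner product; its adjoint moves
  -- it to the right one.
  refine ⟨ContinuousLinearMap.adjoint (InnerProductSpace.continuousLinearMapOfBilin B),
    fun f g => ?_⟩
  rw [ContinuousLinearMap.adjoint_inner_right,
    InnerProductSpace.continuousLinearMapOfBilin_apply]
  rfl

/-- The restriction of a bounded self-adjoint operator to a dense subspace is essentially
self-adjoint, and its closure is the operator. -/
lemma closure_toPMap_of_dense {H : Type*} [NormedAddCommGroup H] [InnerProductSpace ℂ H]
    [CompleteSpace H] (K : H →L[ℂ] H) {p : Submodule ℂ H} (hp : Dense (p : Set H)) :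
    ((K : H →ₗ[ℂ] H).toPMap p).IsClosable ∧
      ((K : H →ₗ[ℂ] H).toPMap p).closure = (K : H →ₗ[ℂ] H).toPMap ⊤ := by
  -- The full graph is closed, and the continuous map `y ↦ (y, Ky)` carries the density of `p` to
  -- density of the restricted graph in it.
  have hgraph : ((K : H →ₗ[ℂ] H).toPMap p).graph.topologicalClosure =
      ((K : H →ₗ[ℂ] H).toPMap ⊤).graph := by
    ext x
    rw [← SetLike.mem_coe, Submodule.topologicalClosure_coe]
    have hmem : ∀ q : Submodule ℂ H, ∀ y : H × H, y ∈ ((K : H →ₗ[ℂ] H).toPMap q).graph ↔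
        y.1 ∈ q ∧ K y.1 = y.2 := by
      intro q y
      rw [LinearPMap.mem_graph_iff]
      constructor
      · rintro ⟨z, h1, h2⟩
        exact ⟨h1 ▸ z.2, by rw [← h1, ← h2]; rfl⟩
      · rintro ⟨h1, h2⟩
        exact ⟨⟨y.1, h1⟩, rfl, h2⟩
    rw [hmem]
    constructor
    · intro hx
      have hcl : IsClosed {y : H × H | K y.1 = y.2} :=
        isClosed_eq (K.continuous.comp continuous_fst) continuous_snd
      have := hcl.closure_subset_iff.2 (fun y hy => ((hmem p y).1 hy).2) hx
      exact ⟨trivial, this⟩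
    · rintro ⟨-, hx⟩
      have h1 : x.1 ∈ closure (p : Set H) := hp x.1
      have h2 : (fun y : H => (y, K y)) x.1 ∈ _ := image_closure_subset_closure_image
        (f := fun y : H => (y, K y)) (s := (p : Set H)) (by fun_prop)
        (Set.mem_image_of_mem _ h1)
      have h3 : (fun y : H => (y, K y)) x.1 = x := Prod.ext rfl hx
      rw [h3] at h2
      refine closure_mono ?_ h2
      rintro _ ⟨y, hy, rfl⟩
      exact (hmem p _).2 ⟨hy, rfl⟩
  have hc : ((K : H →ₗ[ℂ] H).toPMap p).IsClosable := ⟨_, hgraph⟩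
  refine ⟨hc, LinearPMap.eq_of_eq_graph ?_⟩
  rw [← hc.graph_closure_eq_closure_graph, hgraph]

lemma isEssentiallySelfAdjoint_toPMap {H : Type*} [NormedAddCommGroup H] [InnerProductSpace ℂ H]
    [CompleteSpace H] (K : H →L[ℂ] H) (hK : ContinuousLinearMap.adjoint K = K)
    {p : Submodule ℂ H} (hp : Dense (p : Set H)) :
    IsEssentiallySelfAdjoint ((K : H →ₗ[ℂ] H).toPMap p) := by
  obtain ⟨h1, h2⟩ := closure_toPMap_of_dense K hp
  refine ⟨hp, h1, ?_⟩
  rw [h2, LinearPMap.isSelfAdjoint_def,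
    ContinuousLinearMap.toPMap_adjoint_eq_adjoint_toPMap_of_dense K (by simp), hK]

end AbstractOperators

/-! ### Unitary operators of the form `f ↦ w · (f ∘ g)`. -/

section WeightedComposition

variable {F : Type} [MeasurableSpace F] {μ : Measure F}

/-- Elements of `L²` are known only almost everywhere, so composing them with `g` requires preimages
of null sets to be null; the change of variables formula for the indicator of a null set provides
this. -/
lemma quasiMeasurePreserving_of_weight {w : F → ℂ} {g : F → F} (hw : Measurable w)
    (hg : Measurable g) (hw0 : ∀ᵐ x ∂μ, w x ≠ 0)
    (h : ∀ u : F → ENNReal, Measurable u → ∫⁻ x, ‖w x‖ₑ ^ 2 * u (g x) ∂μ = ∫⁻ x, u x ∂μ) :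
    Measure.QuasiMeasurePreserving g μ μ := by
  refine ⟨hg, Measure.AbsolutelyContinuous.mk fun s hs hs0 => ?_⟩
  rw [Measure.map_apply hg hs]
  have h1 := h (s.indicator 1) (measurable_one.indicator hs)
  have hm : Measurable fun x => ‖w x‖ₑ ^ 2 * s.indicator (1 : F → ENNReal) (g x) :=
    (hw.enorm.pow_const 2).mul ((measurable_one.indicator hs).comp hg)
  rw [lintegral_indicator_one hs, hs0, lintegral_eq_zero_iff hm] at h1
  rw [measure_eq_zero_iff_ae_notMem]
  filter_upwards [h1, hw0] with x hx hx0 hxs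
  have hxs' : g x ∈ s := hxs
  simp [hxs', hx0] at hx

lemma exists_weighted_isometry {w : F → ℂ} {g : F → F} (hw : Measurable w)
    (hg : Measurable g) (hw0 : ∀ᵐ x ∂μ, w x ≠ 0)
    (h : ∀ u : F → ENNReal, Measurable u → ∫⁻ x, ‖w x‖ₑ ^ 2 * u (g x) ∂μ = ∫⁻ x, u x ∂μ) :
    ∃ U : Lp ℂ 2 μ →ₗᵢ[ℂ] Lp ℂ 2 μ, ∀ f, U f =ᵐ[μ] fun x => w x * f (g x) := by
  have hq := quasiMeasurePreserving_of_weight hw hg hw0 h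
  have hnorm : ∀ f : Lp ℂ 2 μ, eLpNorm (fun x => w x * f (g x)) 2 μ = eLpNorm f 2 μ := by
    intro f
    rw [eLpNorm_eq_lintegral_rpow_enorm_toReal (by simp) (by simp),
      eLpNorm_eq_lintegral_rpow_enorm_toReal (by simp) (by simp)]
    congr 1
    rw [← h (fun x => ‖f x‖ₑ ^ (2 : ENNReal).toReal)
      ((Lp.stronglyMeasurable f).measurable.enorm.pow_const _)]
    refine lintegral_congr fun x => ?_
    simp [enorm_mul, mul_pow]
  have hmem : ∀ f : Lp ℂ 2 μ, MemLp (fun x => w x * f (g x)) 2 μ := fun f =>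
    ⟨(hw.mul ((Lp.stronglyMeasurable f).measurable.comp hg)).aestronglyMeasurable, by
      rw [hnorm]; exact (Lp.memLp f).2⟩
  refine ⟨⟨⟨⟨fun f => (hmem f).toLp, fun f f' => ?_⟩, fun c f => ?_⟩, fun f => ?_⟩, fun f =>
    (hmem f).coeFn_toLp⟩
  · rw [← MemLp.toLp_add]
    refine MemLp.toLp_congr _ _ ?_
    filter_upwards [hq.ae (Lp.coeFn_add f f')] with x hx
    simp only [hx, Pi.add_apply, mul_add]
  · simp only [RingHom.id_apply]
    rw [← MemLp.toLp_const_smul]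
    refine MemLp.toLp_congr _ _ ?_
    filter_upwards [hq.ae (Lp.coeFn_smul c f)] with x hx
    simp only [hx, Pi.smul_apply, smul_eq_mul]
    ring
  · change ‖(hmem f).toLp‖ = ‖f‖
    rw [Lp.norm_toLp, hnorm, Lp.norm_def]

lemma exists_weighted_isometryEquiv {w w' : F → ℂ} {g g' : F → F} (hw : Measurable w)
    (hg : Measurable g) (hw0 : ∀ᵐ x ∂μ, w x ≠ 0)
    (h : ∀ u : F → ENNReal, Measurable u → ∫⁻ x, ‖w x‖ₑ ^ 2 * u (g x) ∂μ = ∫⁻ x, u x ∂μ)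
    (hw' : Measurable w') (hg' : Measurable g') (hw0' : ∀ᵐ x ∂μ, w' x ≠ 0)
    (h' : ∀ u : F → ENNReal, Measurable u → ∫⁻ x, ‖w' x‖ₑ ^ 2 * u (g' x) ∂μ = ∫⁻ x, u x ∂μ)
    (hinv : ∀ᵐ x ∂μ, w x * w' (g x) = 1 ∧ g' (g x) = x) :
    ∃ U : Lp ℂ 2 μ ≃ₗᵢ[ℂ] Lp ℂ 2 μ, ∀ f, U f =ᵐ[μ] fun x => w x * f (g x) := by
  obtain ⟨U, hU⟩ := exists_weighted_isometry hw hg hw0 h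
  obtain ⟨U', hU'⟩ := exists_weighted_isometry hw' hg' hw0' h'
  have hq := quasiMeasurePreserving_of_weight hw hg hw0 h
  refine ⟨LinearIsometryEquiv.ofSurjective U fun f => ⟨U' f, ?_⟩, hU⟩
  refine Lp.ext ?_
  filter_upwards [hU (U' f), hq.ae (hU' f), hinv] with x h1 h2 h3
  rw [h1, h2, h3.2, ← mul_assoc, h3.1, one_mul]

end WeightedComposition

/-! ### Unitarity of the dilations and of the inversion. -/

section DilationInversion

variable {F : Type} [NontriviallyNormedField F] [ProperSpace F] [MeasurableSpace F] [BorelSpace F]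
  (μ : Measure F) [μ.IsAddHaarMeasure]

lemma lintegral_dilation {t : F} (ht : t ≠ 0) (u : F → ENNReal) :
    ∫⁻ x, ‖((Real.sqrt (modulus t))⁻¹ : ℂ)‖ₑ ^ 2 * u (x / t) ∂μ = ∫⁻ x, u x ∂μ := by
  have hp := modulus_pos ht
  have e : ‖((Real.sqrt (modulus t))⁻¹ : ℂ)‖ₑ ^ 2 = ENNReal.ofReal (modulus t)⁻¹ := by
    rw [← ofReal_norm, ← ENNReal.ofReal_pow (norm_nonneg _), norm_inv,
      Complex.norm_real, Real.norm_of_nonneg (Real.sqrt_nonneg _), inv_pow, Real.sq_sqrt hp.le]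
  rw [e, lintegral_const_mul' _ _ ENNReal.ofReal_ne_top]
  simp_rw [div_eq_inv_mul]
  rw [lintegral_comp_mul_left μ (inv_ne_zero ht), ← mul_assoc,
    ← ENNReal.ofReal_mul (inv_nonneg.2 hp.le), modulus_inv, inv_inv, inv_mul_cancel₀ hp.ne']
  simp

lemma exists_dilation (t : Fˣ) :
    ∃ U : Lp ℂ 2 μ ≃ₗᵢ[ℂ] Lp ℂ 2 μ, ∀ f : Lp ℂ 2 μ, U f =ᵐ[μ] dilation t f := by
  have ht : (t : F) ≠ 0 := t.ne_zero
  have hp := modulus_pos ht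
  have hs : (Real.sqrt (modulus (t : F)) : ℂ) ≠ 0 := by
    exact_mod_cast (Real.sqrt_pos.2 hp).ne'
  have h := exists_weighted_isometryEquiv (μ := μ)
    (w := fun _ => ((Real.sqrt (modulus (t : F)))⁻¹ : ℂ)) (g := fun x => x / t)
    (w' := fun _ => ((Real.sqrt (modulus (t : F)⁻¹))⁻¹ : ℂ)) (g' := fun x => x / (t : F)⁻¹)
    measurable_const (measurable_id.div_const _) (by simp [hs])
    (fun u _ => lintegral_dilation μ ht u) measurable_const (measurable_id.div_const _)
    (by simp [hs]) (fun u _ => lintegral_dilation μ (inv_ne_zero ht) u)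
    (Filter.Eventually.of_forall fun x => ⟨by simp [hs], by field_simp⟩)
  exact h

lemma lintegral_inversion {u : F → ENNReal} (hu : Measurable u) :
    ∫⁻ x, ‖((modulus x)⁻¹ : ℂ)‖ₑ ^ 2 * u x⁻¹ ∂μ = ∫⁻ x, u x ∂μ := by
  have h := lintegral_multHaar_inv μ (f := fun x => ENNReal.ofReal (modulus x) * u x)
    (measurable_modulus.ennreal_ofReal.mul hu)
  rw [lintegral_multHaar μ (f := fun x => ENNReal.ofReal (modulus x) * u x)
      (measurable_modulus.ennreal_ofReal.mul hu),
    lintegral_multHaar μ (f := fun x => ENNReal.ofReal (modulus x⁻¹) * u x⁻¹)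
      ((measurable_modulus.comp measurable_inv).ennreal_ofReal.mul (hu.comp measurable_inv))] at h
  have e1 : ∫⁻ x, ENNReal.ofReal (modulus x)⁻¹ * (ENNReal.ofReal (modulus x) * u x) ∂μ =
      ∫⁻ x, u x ∂μ := by
    refine lintegral_congr_ae ?_
    filter_upwards [ae_ne_zero μ] with x hx
    have hp := modulus_pos hx
    rw [← mul_assoc, ← ENNReal.ofReal_mul (inv_nonneg.2 hp.le), inv_mul_cancel₀ hp.ne']
    simp
  rw [e1] at h
  rw [← h]
  refine lintegral_congr fun x => ?_
  have h0 := modulus_nonneg x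
  rw [← mul_assoc, modulus_inv, ← ENNReal.ofReal_mul (inv_nonneg.2 h0), ← ofReal_norm,
    ← ENNReal.ofReal_pow (norm_nonneg _), norm_inv, Complex.norm_real, Real.norm_of_nonneg h0, sq]

lemma exists_inversion :
    ∃ U : Lp ℂ 2 μ ≃ₗᵢ[ℂ] Lp ℂ 2 μ, ∀ f : Lp ℂ 2 μ, U f =ᵐ[μ] inversion f := by
  have hw : Measurable fun x : F => ((modulus x)⁻¹ : ℂ) :=
    (Complex.measurable_ofReal.comp measurable_modulus).inv
  have h0 : ∀ᵐ x ∂μ, ((modulus x)⁻¹ : ℂ) ≠ 0 := by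
    filter_upwards [ae_ne_zero μ] with x hx
    simpa using modulus_ne_zero hx
  refine exists_weighted_isometryEquiv (μ := μ) (g := fun x => x⁻¹) (g' := fun x => x⁻¹)
    hw measurable_inv h0 (fun u hu => lintegral_inversion μ hu) hw measurable_inv h0
    (fun u hu => lintegral_inversion μ hu) ?_
  filter_upwards [ae_ne_zero μ] with x hx
  have : (modulus x : ℂ) ≠ 0 := by exact_mod_cast modulus_ne_zero hx
  exact ⟨by simp [this], inv_inv x⟩

end DilationInversion

/-! ### The convolution kernel and its integrability. -/

section Kernel

variable {F : Type} [NontriviallyNormedField F] [ProperSpace F] [MeasurableSpace F] [BorelSpace F]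
  {ψ : AddChar F Circle} {𝒮 : Set (F → ℂ)} {μ : Measure F} [μ.IsAddHaarMeasure]

/-- The multiplicative convolution kernel `log |t| |t|^{1/2} / |1 - t|`. -/
def logKernel (t : F) : ℝ :=
  Real.log (modulus t) * modulus t ^ (1 / 2 : ℝ) / modulus (1 - t)

lemma measurable_logKernel : Measurable (logKernel : F → ℝ) :=
  (measurable_log_modulus.mul (measurable_modulus.pow_const _)).div
    (measurable_modulus.comp (measurable_const.sub measurable_id))

/-- The factor `|t| ^ (1/2) / |1 - t|` is invariant under inversion and the logarithm changes sign.
This oddness is the source of both anticommutation relations and enters the self-adjointness. -/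
lemma logKernel_inv {t : F} (ht : t ≠ 0) : logKernel t⁻¹ = -logKernel t := by
  have hp := modulus_pos ht
  have e : (1 : F) - t⁻¹ = -((1 - t) / t) := by field_simp; ring
  unfold logKernel
  rw [e, modulus_neg, modulus_div, modulus_inv, Real.log_inv, Real.inv_rpow hp.le]
  have h1 : modulus t = modulus t ^ (1 / 2 : ℝ) * modulus t ^ (1 / 2 : ℝ) := by
    rw [← Real.rpow_add hp]; norm_num
  have h2 := (Real.rpow_pos_of_pos hp (1 / 2)).ne'
  rcases eq_or_ne (modulus (1 - t)) 0 with h0 | h0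
  · simp [h0]
  · set q := modulus t ^ (1 / 2 : ℝ)
    generalize Real.log (modulus t) = l
    rw [h1]
    field_simp

/-- Regularity of `log|t|` at `1` is extracted from the axioms: for a bump `r` at `1`, the product
`r(t) log|t|` is a test function vanishing at `1`, hence Hölder there, and `r` exceeds half its
value at `1` nearby. -/
lemma exists_log_holder (H : SchwartzBruhatLike ψ 𝒮) :
    ∃ ε > 0, ε ≤ 1 / 2 ∧ ∃ C : ℝ, 0 ≤ C ∧ ∀ t : F, ‖1 - t‖ < ε →
      |Real.log (modulus t)| ≤ C * modulus (1 - t) ^ (1 / 2 : ℝ) := by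
  obtain ⟨r, hr, h0, h1, -⟩ := H.bump Set.univ Filter.univ_mem
  have hc : Continuous r := Complex.continuous_re.comp (H.continuous _ hr.1)
  have hr1 : 0 < r 1 := lt_of_le_of_ne (h0 1) (Ne.symm h1)
  obtain ⟨C, hC⟩ := H.holder _ (H.translate_mem 1 _ (H.opA_mem _ hr))
  obtain ⟨ε, hε, hball⟩ := Metric.isOpen_iff.1 (isOpen_lt (continuous_const (y := r 1 / 2)) hc) 1
    (by simp only [Set.mem_ofPred_eq]; linarith)
  refine ⟨min ε (1 / 2), by positivity, min_le_right _ _, |C| * (2 / r 1), by positivity,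
    fun t ht => ?_⟩
  have hrt : r 1 / 2 < r t := hball (by
    rw [mem_ball_iff_norm']; exact ht.trans_le (min_le_left _ _))
  have h := hC (t - 1)
  have h2 : modulus (t - 1) = modulus (1 - t) := modulus_sub_comm _ _
  simp only [opA, sub_add_cancel, zero_add, modulus_one, Real.log_one, Complex.ofReal_zero,
    zero_mul, sub_zero, norm_mul, Complex.norm_real, Real.norm_eq_abs, h2] at h
  rw [abs_of_nonneg (h0 t)] at h
  have h3 : |Real.log (modulus t)| * (r 1 / 2) ≤ |C| * modulus (1 - t) ^ (1 / 2 : ℝ) := by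
    refine le_trans ?_ (h.trans ?_)
    · gcongr
    · have := modulus_nonneg (1 - t)
      gcongr
      exact le_abs_self C
  rw [← le_div_iff₀ (by positivity)] at h3
  refine h3.trans (le_of_eq ?_)
  field_simp

/-- Near `t = 1` the Hölder bound on the logarithm reduces the pole to `|1 - t| ^ (-1/2)`, which is
integrable for the additive measure. On the rest of the unit ball `|1 - t|` is bounded below and the
Mellin weight with exponent `1/2` dominates. Outside the ball, oddness under inversion applies. -/
lemma integrable_logKernel (H : SchwartzBruhatLike ψ 𝒮) :
    Integrable (logKernel : F → ℝ) (multHaar μ) := by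
  have hkey : IntegrableOn (logKernel : F → ℝ) (Metric.closedBall 0 1) (multHaar μ) := by
    obtain ⟨ε, hε, hε2, C, hC0, hC⟩ := exists_log_holder H
    obtain ⟨t₁, ht₁, ht₁ε⟩ := exists_small F ε hε
    have hm1 := modulus_pos ht₁
    set W : F → ℝ := fun x =>
      (1 + |Real.log (modulus x)|) * modulus x ^ (-(1 / 2) : ℝ) / (1 + modulus x) with hW
    have hWi : Integrable W μ := integrable_log_weight (by norm_num) (by norm_num)
    have h1 : Integrable (fun t => W (1 - t) * modulus t) (multHaar μ) :=
      (integrable_mul_modulus μ).2 (hWi.comp_sub_left 1)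
    have h2 : Integrable (mellinWeight (1 / 2) : F → ℝ) (multHaar μ) :=
      integrable_mellinWeight μ (by norm_num) (by norm_num)
    have hWnn : ∀ x, 0 ≤ W x := fun x => by
      have := modulus_nonneg x
      simp only [hW]; positivity
    refine Integrable.mono' ((h1.const_mul (2 * C * modulus t₁ ^ (-(1 / 2) : ℝ))).add
      (h2.const_mul (2 * (modulus t₁)⁻¹))).integrableOn measurable_logKernel.aestronglyMeasurable ?_
    filter_upwards [ae_restrict_mem measurableSet_closedBall,
      ae_restrict_of_ae (multHaar_ae_ne_zero μ)] with t ht ht0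
    rw [mem_closedBall_zero_iff] at ht
    have hp := modulus_pos ht0
    have hle := modulus_le_one ht
    simp only [Pi.add_apply]
    have hA : 0 ≤ 2 * C * modulus t₁ ^ (-(1 / 2) : ℝ) * (W (1 - t) * modulus t) := by
      have := hWnn (1 - t)
      positivity
    have hB : 0 ≤ 2 * (modulus t₁)⁻¹ * mellinWeight (1 / 2) t := by
      have := mellinWeight_nonneg (1 / 2) t
      positivity
    have hnorm : ‖logKernel t‖ =
        |Real.log (modulus t)| * modulus t ^ (1 / 2 : ℝ) / modulus (1 - t) := by
      unfold logKernel
      rw [norm_div, norm_mul, Real.norm_eq_abs, Real.norm_of_nonneg (by positivity),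
        Real.norm_of_nonneg (modulus_nonneg _)]
    rw [hnorm]
    rcases eq_or_ne (1 - t) 0 with h10 | h10
    · rw [h10, modulus_zero, div_zero]
      rw [h10] at hA
      positivity
    have hq := modulus_pos h10
    by_cases hV : ‖1 - t‖ < ε
    · refine le_trans ?_ (le_add_of_nonneg_right hB)
      have hlog := hC t hV
      have hq1 : modulus (1 - t) ≤ 1 := modulus_le_one (by linarith)
      have ht1t : modulus t₁ ≤ modulus t := by
        apply modulus_le_of_norm_le
        have := norm_sub_norm_le (1 : F) (1 - t)
        rw [norm_one, sub_sub_cancel] at this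
        linarith
      have e1 : modulus t ^ (1 / 2 : ℝ) ≤ modulus t₁ ^ (-(1 / 2) : ℝ) * modulus t := by
        have : modulus t ^ (1 / 2 : ℝ) = modulus t ^ (-(1 / 2) : ℝ) * modulus t := by
          conv_rhs => rw [← Real.rpow_one (modulus t), ← Real.rpow_mul hp.le, ← Real.rpow_add hp]
          norm_num
        rw [this]
        gcongr ?_ * _
        exact Real.rpow_le_rpow_of_nonpos hm1 ht1t (by norm_num)
      have e2 : modulus (1 - t) ^ (1 / 2 : ℝ) / modulus (1 - t) ≤ 2 * W (1 - t) := by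
        have e3 : modulus (1 - t) ^ (1 / 2 : ℝ) / modulus (1 - t) =
            modulus (1 - t) ^ (-(1 / 2) : ℝ) := by
          rw [← Real.rpow_sub_one hq.ne']; norm_num
        rw [e3]
        simp only [hW]
        rw [← mul_div_assoc, le_div_iff₀ (by linarith)]
        have hr := Real.rpow_pos_of_pos hq (-(1 / 2))
        have hr2 := mul_nonneg (abs_nonneg (Real.log (modulus (1 - t)))) hr.le
        nlinarith
      calc |Real.log (modulus t)| * modulus t ^ (1 / 2 : ℝ) / modulus (1 - t)
          ≤ (C * modulus (1 - t) ^ (1 / 2 : ℝ)) * (modulus t₁ ^ (-(1 / 2) : ℝ) * modulus t)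
              / modulus (1 - t) := by gcongr
        _ = C * modulus t₁ ^ (-(1 / 2) : ℝ) * modulus t *
              (modulus (1 - t) ^ (1 / 2 : ℝ) / modulus (1 - t)) := by ring
        _ ≤ C * modulus t₁ ^ (-(1 / 2) : ℝ) * modulus t * (2 * W (1 - t)) := by gcongr
        _ = _ := by ring
    · refine le_trans ?_ (le_add_of_nonneg_left hA)
      have h3 : modulus t₁ ≤ modulus (1 - t) := modulus_le_of_norm_le (by linarith [not_lt.1 hV])
      have h4 : |Real.log (modulus t)| * modulus t ^ (1 / 2 : ℝ) ≤ 2 * mellinWeight (1 / 2) t := by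
        unfold mellinWeight
        rw [← mul_div_assoc, le_div_iff₀ (by linarith)]
        have hr := Real.rpow_pos_of_pos hp (1 / 2)
        have hr2 := mul_nonneg (abs_nonneg (Real.log (modulus t))) hr.le
        nlinarith
      have h5 := mellinWeight_nonneg (1 / 2) t
      calc _ ≤ 2 * mellinWeight (1 / 2) t / modulus t₁ := by gcongr
        _ = _ := by ring
  refine integrable_of_near_zero μ hkey (hkey.neg.congr ?_)
  filter_upwards [ae_restrict_of_ae (multHaar_ae_ne_zero μ)] with t ht
  simp [logKernel_inv ht]

end Kernel

/-! ### The commutator on test functions, and the decay of `Bφ`. -/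

section Commutator

variable {F : Type} [NontriviallyNormedField F] [ProperSpace F] [MeasurableSpace F] [BorelSpace F]
  {ψ : AddChar F Circle} {𝒮 : Set (F → ℂ)} {μ : Measure F} [μ.IsAddHaarMeasure]

/-- The character that evaluates the outer Fourier transform at `x` is absorbed by the inner one as
a translation of `θ`. -/
lemma opB_eq_logFunctional (θ : F → ℂ) (x : F) :
    opB ψ μ θ x = logFunctional ψ μ fun u => θ (u + x) := by
  rw [opB, fourier_apply, logFunctional, ← integral_neg_eq_self]
  congr 1 with y
  rw [opA, fourierInv_apply, fourier_comp_add, modulus_neg, neg_neg, neg_mul, neg_neg, mul_comm y x]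
  ring

lemma opA_mem_punctured (H : SchwartzBruhatLike ψ 𝒮) {φ : F → ℂ}
    (hφ : φ ∈ puncturedTestFunctions 𝒮) : opA φ ∈ puncturedTestFunctions 𝒮 :=
  ⟨H.opA_mem _ hφ, hφ.2.1.mul_left, by
    filter_upwards [hφ.2.2] with x hx
    simp [opA, hx]⟩

lemma logFunctional_add (H : SchwartzBruhatLike ψ 𝒮) (hψ : Continuous ψ) {f g : F → ℂ}
    (hf : f ∈ 𝒮) (hg : g ∈ 𝒮) :
    logFunctional ψ μ (fun x => f x + g x) = logFunctional ψ μ f + logFunctional ψ μ g := by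
  unfold logFunctional
  rw [← integral_add (integrable_log_fourier H (H.fourier_mem μ _ hf))
    (integrable_log_fourier H (H.fourier_mem μ _ hg))]
  congr 1 with x
  rw [fourier_add hψ (H.integrable hf) (H.integrable hg)]
  ring

lemma logFunctional_smul (c : ℂ) (f : F → ℂ) :
    logFunctional ψ μ (fun x => c * f x) = c * logFunctional ψ μ f := by
  unfold logFunctional
  rw [← integral_const_mul]
  congr 1 with x
  rw [fourier_smul]
  ring

/-- The commutator is a multiplicative convolution operator. -/
lemma opK_eq_integral (H : SchwartzBruhatLike ψ 𝒮) (hψ : Continuous ψ) {c : ℝ}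
    (hc : ∀ φ ∈ 𝒮, φ 0 = 0 → logFunctional ψ μ φ = c * ∫ x, φ x ∂(multHaar μ))
    {φ : F → ℂ} (hφ : φ ∈ puncturedTestFunctions 𝒮) {x : F} (hx : x ≠ 0) :
    opK ψ μ φ x = ∫ t, (-Complex.I * c * logKernel t) *
      (((Real.sqrt (modulus t))⁻¹ : ℂ) * φ (x / t)) ∂(multHaar μ) := by
  have hAφ := H.opA_mem _ hφ
  have h1 := H.translate_mem x _ hAφ
  have h2 := H.smul_mem (-(Real.log (modulus x) : ℂ)) _ (H.translate_mem x _ hφ.1)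
  -- For fixed `x` the outer factor `log|x|` is a scalar, so both terms of the commutator merge into
  -- one argument of the functional. It vanishes at `u = 0`, which is exactly when the functional is
  -- known.
  have h3 : opK ψ μ φ x = Complex.I * logFunctional ψ μ (fun u => opA φ (u + x) +
      -(Real.log (modulus x) : ℂ) * φ (u + x)) := by
    rw [logFunctional_add H hψ h1 h2, logFunctional_smul, ← opB_eq_logFunctional,
      ← opB_eq_logFunctional, opK]
    congr 1
    rw [opA]
    ring
  rw [h3, hc _ (H.add_mem _ h1 _ h2) (by simp [opA]), integral_multHaar]
  set f : F → ℂ := fun y =>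
    ((modulus (y - x))⁻¹ : ℂ) * ((Real.log (modulus y) - Real.log (modulus x)) * φ y) with hf
  have h4 : ∫ u, (modulus u)⁻¹ • (opA φ (u + x) + -(Real.log (modulus x) : ℂ) * φ (u + x)) ∂μ =
      ∫ y, f y ∂μ := by
    rw [← integral_add_right_eq_self f x]
    congr 1 with u
    simp only [hf, add_sub_cancel_right, Complex.real_smul, opA, Complex.ofReal_inv]
    ring
  rw [h4, ← mul_modulus_multHaar μ f,
    ← (measurePreserving_div μ hx).integral_comp (measurableEmbedding_div hx), ← mul_assoc,
    ← integral_const_mul]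
  refine integral_congr_ae ?_
  filter_upwards [multHaar_ae_ne_zero μ] with t ht
  have hp := modulus_pos ht
  have hpx := modulus_pos hx
  have e : x / t - x = x * (1 - t) / t := by field_simp
  have hs : modulus t ^ (1 / 2 : ℝ) = Real.sqrt (modulus t) := (Real.sqrt_eq_rpow _).symm
  have hsq : (Real.sqrt (modulus t) : ℂ) ≠ 0 := by exact_mod_cast (Real.sqrt_pos.2 hp).ne'
  simp only [hf, e, modulus_div, modulus_mul, Real.log_div hpx.ne' hp.ne', logKernel, hs]
  have hpC : (modulus t : ℂ) ≠ 0 := by exact_mod_cast hp.ne'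
  have hpxC : (modulus x : ℂ) ≠ 0 := by exact_mod_cast hpx.ne'
  push_cast
  -- At `t = 1` both sides are `0`, since division by zero returns zero.
  rcases eq_or_ne (modulus (1 - t) : ℂ) 0 with h0 | h0
  · simp [h0]
  · field_simp
    ring

lemma exists_support_bound {φ : F → ℂ} (hφ : HasCompactSupport φ) :
    ∃ R > 0, ∀ x, R ≤ ‖x‖ → φ x = 0 := by
  obtain ⟨R, hR⟩ := hφ.isCompact.isBounded.exists_norm_le
  refine ⟨max R 0 + 1, by positivity, fun x hx => ?_⟩
  by_contra h
  have := hR x (subset_tsupport _ h)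
  linarith [le_max_left R 0]

/-- `Bφ` is bounded, as the Fourier transform of an integrable function. Beyond the support of `φ`
the translate vanishes at the origin, so `Bφ(x) = c ∫ φ(y)/|y - x| dy`, which is `O(1/|x|)`. -/
lemma opB_decay (H : SchwartzBruhatLike ψ 𝒮) (hψ : Continuous ψ) (hψ1 : ψ ≠ 1)
    {φ : F → ℂ} (hφ : φ ∈ puncturedTestFunctions 𝒮) :
    ∃ C, ∀ x, ‖opB ψ μ φ x‖ * (1 + modulus x) ≤ C := by
  obtain ⟨c, hc⟩ := exists_logFunctional (μ := μ) H hψ hψ1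
  obtain ⟨R, hR, hsupp⟩ := exists_support_bound hφ.2.1
  obtain ⟨z, hz⟩ := NormedField.exists_lt_norm F (2 * R)
  -- For `‖y‖ ≤ R ≤ ‖x‖ / 2` one has `‖tx‖ ≤ ‖x‖ / 2 ≤ ‖y - x‖`: the scalar `t` converts the factor
  -- `1/2` into a bound on modules.
  obtain ⟨t, ht0, ht⟩ := exists_small F (1 / 2) (by norm_num)
  have htp := modulus_pos ht0
  set D := ∫ x, ‖opA (fourierInv ψ μ φ) x‖ ∂μ
  have hD0 : 0 ≤ D := integral_nonneg fun x => norm_nonneg _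
  have hD : ∀ x, ‖opB ψ μ φ x‖ ≤ D := fun x => norm_fourier_le _ x
  set E := |c| * ((modulus t)⁻¹ * ∫ y, ‖φ y‖ ∂μ)
  have hE0 : 0 ≤ E := by positivity
  refine ⟨D * (1 + modulus z) + E, fun x => ?_⟩
  rcases le_total ‖x‖ (2 * R) with hx | hx
  · have : modulus x ≤ modulus z := modulus_le_of_norm_le (by linarith)
    have h1 := modulus_nonneg x
    calc ‖opB ψ μ φ x‖ * (1 + modulus x) ≤ D * (1 + modulus z) := by gcongr; exact hD x
      _ ≤ _ := by linarith
  · have hx0 : x ≠ 0 := norm_pos_iff.1 (by linarith)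
    have hxp := modulus_pos hx0
    have h1 : opB ψ μ φ x = c * ∫ y, ((modulus (y - x))⁻¹ : ℂ) * φ y ∂μ := by
      rw [opB_eq_logFunctional, hc _ (H.translate_mem x _ hφ.1)
        (by rw [zero_add]; exact hsupp x (by linarith)), integral_multHaar,
        ← integral_add_right_eq_self (fun y => ((modulus (y - x))⁻¹ : ℂ) * φ y) x]
      simp
    have h2 : ‖∫ y, ((modulus (y - x))⁻¹ : ℂ) * φ y ∂μ‖ ≤
        (modulus t * modulus x)⁻¹ * ∫ y, ‖φ y‖ ∂μ := by
      rw [← integral_const_mul]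
      refine norm_integral_le_of_norm_le ((H.integrable hφ.1).norm.const_mul _)
        (Filter.Eventually.of_forall fun y => ?_)
      rcases le_total R ‖y‖ with hy | hy
      · simp [hsupp y hy]
      · rw [norm_mul, norm_inv, Complex.norm_real, Real.norm_of_nonneg (modulus_nonneg _)]
        gcongr
        rw [← modulus_mul]
        apply modulus_le_of_norm_le
        rw [norm_mul]
        have := norm_sub_norm_le x y
        rw [norm_sub_rev] at this
        nlinarith [norm_nonneg x]
    have h3 : ‖opB ψ μ φ x‖ * modulus x ≤ E := by
      rw [h1, norm_mul, Complex.norm_real, Real.norm_eq_abs]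
      calc _ ≤ |c| * ((modulus t * modulus x)⁻¹ * ∫ y, ‖φ y‖ ∂μ) * modulus x := by gcongr
        _ = E := by simp only [E]; field_simp
    have h4 := hD x
    have h5 := modulus_nonneg z
    nlinarith [mul_nonneg hD0 h5]

end Commutator

/-! ### The group of dilations on `L²` and its relation to inversion. -/

section DilationAlgebra

variable {F : Type} [NontriviallyNormedField F] [ProperSpace F] [MeasurableSpace F] [BorelSpace F]
  (μ : Measure F) [μ.IsAddHaarMeasure]

/-- The unitary dilation on `L²`. -/
def dilationL2 (t : Fˣ) : Lp ℂ 2 μ ≃ₗᵢ[ℂ] Lp ℂ 2 μ := (exists_dilation μ t).choose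

lemma dilationL2_coe (t : Fˣ) (f : Lp ℂ 2 μ) : dilationL2 μ t f =ᵐ[μ] dilation t f :=
  (exists_dilation μ t).choose_spec f

/-- The unitary inversion on `L²`. -/
def inversionL2 : Lp ℂ 2 μ ≃ₗᵢ[ℂ] Lp ℂ 2 μ := (exists_inversion μ).choose

lemma inversionL2_coe (f : Lp ℂ 2 μ) : inversionL2 μ f =ᵐ[μ] inversion f :=
  (exists_inversion μ).choose_spec f

lemma quasiMeasurePreserving_div_const {t : F} (ht : t ≠ 0) :
    Measure.QuasiMeasurePreserving (fun x => x / t) μ μ := by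
  have hs : (Real.sqrt (modulus t) : ℂ) ≠ 0 := by
    exact_mod_cast (Real.sqrt_pos.2 (modulus_pos ht)).ne'
  exact quasiMeasurePreserving_of_weight (w := fun _ => ((Real.sqrt (modulus t))⁻¹ : ℂ))
    measurable_const (measurable_id.div_const _) (by simp [hs])
    (fun u _ => lintegral_dilation μ ht u)

lemma quasiMeasurePreserving_inv :
    Measure.QuasiMeasurePreserving (fun x : F => x⁻¹) μ μ :=
  quasiMeasurePreserving_of_weight (w := fun x => ((modulus x)⁻¹ : ℂ))
    (Complex.measurable_ofReal.comp measurable_modulus).inv measurable_inv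
    (by
      filter_upwards [ae_ne_zero μ] with x hx
      simpa using modulus_ne_zero hx)
    (fun u hu => lintegral_inversion μ hu)

lemma dilationL2_mul (s t : Fˣ) (f : Lp ℂ 2 μ) :
    dilationL2 μ s (dilationL2 μ t f) = dilationL2 μ (s * t) f := by
  refine Lp.ext ?_
  filter_upwards [dilationL2_coe μ s (dilationL2 μ t f), dilationL2_coe μ (s * t) f,
    (quasiMeasurePreserving_div_const μ s.ne_zero).ae (dilationL2_coe μ t f)] with x h1 h2 h3
  rw [h1, h2, dilation, h3, dilation, dilation, Units.val_mul, modulus_mul,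
    Real.sqrt_mul (modulus_nonneg _), ← mul_assoc, div_div]
  push_cast
  rw [mul_inv]

lemma dilationL2_one (f : Lp ℂ 2 μ) : dilationL2 μ 1 f = f := by
  refine Lp.ext ?_
  filter_upwards [dilationL2_coe μ 1 f] with x h1
  simp [h1, dilation]

lemma dilationL2_comm (s t : Fˣ) (f : Lp ℂ 2 μ) :
    dilationL2 μ s (dilationL2 μ t f) = dilationL2 μ t (dilationL2 μ s f) := by
  rw [dilationL2_mul, dilationL2_mul, mul_comm]

lemma inner_dilationL2_left (t : Fˣ) (f g : Lp ℂ 2 μ) :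
    inner ℂ (dilationL2 μ t f) g = inner ℂ f (dilationL2 μ t⁻¹ g) := by
  rw [← (dilationL2 μ t).inner_map_map f, dilationL2_mul, mul_inv_cancel, dilationL2_one]

lemma dilationL2_inversionL2 (t : Fˣ) (f : Lp ℂ 2 μ) :
    dilationL2 μ t (inversionL2 μ f) = inversionL2 μ (dilationL2 μ t⁻¹ f) := by
  refine Lp.ext ?_
  filter_upwards [dilationL2_coe μ t (inversionL2 μ f), inversionL2_coe μ (dilationL2 μ t⁻¹ f),
    (quasiMeasurePreserving_div_const μ t.ne_zero).ae (inversionL2_coe μ f),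
    (quasiMeasurePreserving_inv μ).ae (dilationL2_coe μ t⁻¹ f)] with x h1 h2 h3 h4
  have hp := modulus_pos t.ne_zero
  have hs : (Real.sqrt (modulus (t : F)) : ℂ) ≠ 0 := by
    exact_mod_cast (Real.sqrt_pos.2 hp).ne'
  have hs2 : (modulus (t : F) : ℂ) =
      (Real.sqrt (modulus (t : F)) : ℂ) * (Real.sqrt (modulus (t : F)) : ℂ) := by
    exact_mod_cast (Real.mul_self_sqrt hp.le).symm
  rw [h1, h2, dilation, h3, inversion, inversion, h4, dilation, modulus_div, Units.val_inv_eq_inv_val,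
    modulus_inv, Real.sqrt_inv]
  have e : (x : F)⁻¹ / (t : F)⁻¹ = (x / t)⁻¹ := by
    rw [inv_div, div_inv_eq_mul]; field_simp
  rw [e]
  push_cast
  rw [inv_inv, inv_div, ← mul_assoc, ← mul_assoc]
  congr 1
  rw [div_eq_mul_inv, hs2]
  field_simp

open Classical in
/-- The dilations indexed by the field, extended by zero. -/
def dilationExt (t : F) : Lp ℂ 2 μ →L[ℂ] Lp ℂ 2 μ :=
  if h : t = 0 then 0 else (dilationL2 μ (Units.mk0 t h)).toContinuousLinearEquiv

lemma dilationExt_apply {t : F} (ht : t ≠ 0) (f : Lp ℂ 2 μ) :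
    dilationExt μ t f = dilationL2 μ (Units.mk0 t ht) f := by
  simp [dilationExt, ht]

lemma dilationExt_coe {t : F} (ht : t ≠ 0) (f : Lp ℂ 2 μ) :
    dilationExt μ t f =ᵐ[μ] fun x => ((Real.sqrt (modulus t))⁻¹ : ℂ) * f (x / t) := by
  rw [dilationExt_apply μ ht]
  exact dilationL2_coe μ (Units.mk0 t ht) f

lemma norm_dilationExt_le (t : F) (f : Lp ℂ 2 μ) : ‖dilationExt μ t f‖ ≤ ‖f‖ := by
  rcases eq_or_ne t 0 with rfl | ht
  · simp [dilationExt]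
  · rw [dilationExt_apply μ ht, LinearIsometryEquiv.norm_map]

lemma measurable_dilation_joint (f : Lp ℂ 2 μ) :
    Measurable fun p : F × F => ((Real.sqrt (modulus p.1))⁻¹ : ℂ) * f (p.2 / p.1) := by
  have h1 : Measurable fun t : F => ((Real.sqrt (modulus t))⁻¹ : ℂ) :=
    (Complex.measurable_ofReal.comp (Real.continuous_sqrt.measurable.comp measurable_modulus)).inv
  exact (h1.comp measurable_fst).mul
    ((Lp.stronglyMeasurable f).measurable.comp (measurable_snd.div measurable_fst))

lemma inner_dilationExt {t : F} (ht : t ≠ 0) (f g : Lp ℂ 2 μ) :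
    inner ℂ f (dilationExt μ t g) =
      ∫ x, conj (f x) * (((Real.sqrt (modulus t))⁻¹ : ℂ) * g (x / t)) ∂μ := by
  rw [L2.inner_def]
  refine integral_congr_ae ?_
  filter_upwards [dilationExt_coe μ ht g] with x hx
  rw [hx, RCLike.inner_apply']

lemma aestronglyMeasurable_inner_dilationExt (f g : Lp ℂ 2 μ) :
    AEStronglyMeasurable (fun t => inner ℂ f (dilationExt μ t g)) (multHaar μ) := by
  have hm : Measurable fun p : F × F =>
      conj (f p.2) * (((Real.sqrt (modulus p.1))⁻¹ : ℂ) * g (p.2 / p.1)) :=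
    ((Complex.continuous_conj.measurable.comp (Lp.stronglyMeasurable f).measurable).comp
      measurable_snd).mul (measurable_dilation_joint μ g)
  have h := hm.stronglyMeasurable.integral_prod_right' (ν := μ)
  refine h.aestronglyMeasurable.congr ?_
  filter_upwards [multHaar_ae_ne_zero μ] with t ht
  exact (inner_dilationExt μ ht f g).symm

end DilationAlgebra

/-! ### Operators `∫ κ(t) U(t) dt/|t|` and their symmetries. -/

section ConvolutionOperator

variable {F : Type} [NontriviallyNormedField F] [ProperSpace F] [MeasurableSpace F] [BorelSpace F]
  {μ : Measure F} [μ.IsAddHaarMeasure]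

/-- `K` is the multiplicative convolution operator with kernel `κ`. -/
def IsConvolution (μ : Measure F) [μ.IsAddHaarMeasure] (κ : F → ℂ)
    (K : Lp ℂ 2 μ →L[ℂ] Lp ℂ 2 μ) : Prop :=
  ∀ f g, inner ℂ f (K g) = ∫ t, κ t * inner ℂ f (dilationExt μ t g) ∂(multHaar μ)

lemma exists_convolution {κ : F → ℂ} (hκ : Integrable κ (multHaar μ)) :
    ∃ K, IsConvolution μ κ K :=
  exists_weak_integral hκ _ (norm_dilationExt_le μ) (aestronglyMeasurable_inner_dilationExt μ)

variable {κ : F → ℂ} {K : Lp ℂ 2 μ →L[ℂ] Lp ℂ 2 μ}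

lemma IsConvolution.commute (hK : IsConvolution μ κ K) (V : Lp ℂ 2 μ ≃ₗᵢ[ℂ] Lp ℂ 2 μ)
    (hV : ∀ t f, dilationL2 μ t (V f) = V (dilationL2 μ t f)) (f : Lp ℂ 2 μ) :
    K (V f) = V (K f) := by
  refine ext_inner_left ℂ fun g => ?_
  obtain ⟨g, rfl⟩ := V.surjective g
  rw [V.inner_map_map, hK, hK]
  refine integral_congr_ae ?_
  filter_upwards [multHaar_ae_ne_zero μ] with t ht
  rw [dilationExt_apply μ ht, dilationExt_apply μ ht, hV, V.inner_map_map]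

/-- The substitution `t ↦ t⁻¹` preserves `dt/|t|` and moves the inversion of the dilation onto the
kernel, which is odd. The Fourier transform and the inversion are both covered. -/
lemma IsConvolution.anticommute (hK : IsConvolution μ κ K)
    (hκ : ∀ t, t ≠ 0 → κ t⁻¹ = -κ t) (V : Lp ℂ 2 μ ≃ₗᵢ[ℂ] Lp ℂ 2 μ)
    (hV : ∀ t f, dilationL2 μ t (V f) = V (dilationL2 μ t⁻¹ f)) (f : Lp ℂ 2 μ) :
    K (V f) = -V (K f) := by
  refine ext_inner_left ℂ fun g => ?_
  obtain ⟨g, rfl⟩ := V.surjective g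
  rw [inner_neg_right, V.inner_map_map, hK, hK, ← integral_neg,
    ← (measurePreserving_inv μ).integral_comp measurableEmbedding_inv]
  refine integral_congr_ae ?_
  filter_upwards [multHaar_ae_ne_zero μ] with t ht
  have e : (Units.mk0 t⁻¹ (inv_ne_zero ht)) = (Units.mk0 t ht)⁻¹ := by ext; rfl
  rw [dilationExt_apply μ ht, dilationExt_apply μ (inv_ne_zero ht), e, hV, V.inner_map_map, inv_inv,
    hκ t ht, neg_mul]

/-- The adjoint of the dilation by `t` is the dilation by `t⁻¹`, so taking adjoints replaces the
kernel by `conj κ(t⁻¹)`. -/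
lemma IsConvolution.adjoint_eq (hK : IsConvolution μ κ K)
    (hκ : ∀ t, t ≠ 0 → conj (κ t⁻¹) = κ t) : ContinuousLinearMap.adjoint K = K := by
  refine ContinuousLinearMap.ext fun g => ext_inner_left ℂ fun f => ?_
  rw [ContinuousLinearMap.adjoint_inner_right, ← inner_conj_symm, hK, hK, ← integral_conj,
    ← (measurePreserving_inv μ).integral_comp measurableEmbedding_inv]
  refine integral_congr_ae ?_
  filter_upwards [multHaar_ae_ne_zero μ] with t ht
  have e : (Units.mk0 t⁻¹ (inv_ne_zero ht)) = (Units.mk0 t ht)⁻¹ := by ext; rfl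
  rw [dilationExt_apply μ ht, dilationExt_apply μ (inv_ne_zero ht), e, map_mul, inner_conj_symm,
    inner_dilationL2_left, inv_inv, hκ t ht]

/-- The convolution operator is given by the pointwise convolution integral. -/
lemma IsConvolution.coe_ae (hK : IsConvolution μ κ K) (hκ : Integrable κ (multHaar μ))
    (hκm : Measurable κ) (g : Lp ℂ 2 μ) :
    K g =ᵐ[μ] fun x => ∫ t, κ t * (((Real.sqrt (modulus t))⁻¹ : ℂ) * g (x / t)) ∂(multHaar μ) := by
  set J : F → ℂ := fun x =>
    ∫ t, κ t * (((Real.sqrt (modulus t))⁻¹ : ℂ) * g (x / t)) ∂(multHaar μ) with hJ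
  have key : ∀ f : Lp ℂ 2 μ, Integrable (fun x => conj (f x) * J x) μ ∧
      inner ℂ f (K g) = ∫ x, conj (f x) * J x ∂μ := by
    intro f
    set Φ : F × F → ℂ := fun p =>
      κ p.1 * (conj (f p.2) * (((Real.sqrt (modulus p.1))⁻¹ : ℂ) * g (p.2 / p.1))) with hΦ
    have hΦm : Measurable Φ := (hκm.comp measurable_fst).mul
      (((Complex.continuous_conj.measurable.comp (Lp.stronglyMeasurable f).measurable).comp
        measurable_snd).mul (measurable_dilation_joint μ g))
    have hsq : ∀ h : Lp ℂ 2 μ, Integrable (fun x => ‖h x‖ ^ 2) μ := fun h =>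
      (memLp_two_iff_integrable_sq_norm (Lp.aestronglyMeasurable h)).1 (Lp.memLp h)
    have hnorm : ∀ h : Lp ℂ 2 μ, ∫ x, ‖h x‖ ^ 2 ∂μ = ‖h‖ ^ 2 := by
      intro h
      have h1 := inner_self_eq_norm_sq_to_K (𝕜 := ℂ) h
      rw [L2.inner_def] at h1
      simp only [inner_self_eq_norm_sq_to_K] at h1
      have h2 : ∫ x, ((‖h x‖ ^ 2 : ℝ) : ℂ) ∂μ = ((‖h‖ ^ 2 : ℝ) : ℂ) := by
        push_cast; exact h1
      rw [integral_complex_ofReal] at h2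
      exact_mod_cast h2
    -- Fubini rests on the pointwise bound by `|f|² + |U(t)g|²`, whose integral does not exceed
    -- `‖f‖² + ‖g‖²` uniformly in `t`.
    have hΦi : Integrable Φ ((multHaar μ).prod μ) := by
      rw [integrable_prod_iff hΦm.aestronglyMeasurable]
      have hbase : ∀ t : F, t ≠ 0 →
          Integrable (fun x => conj (f x) * (((Real.sqrt (modulus t))⁻¹ : ℂ) * g (x / t))) μ ∧
          ∫ x, ‖conj (f x) * (((Real.sqrt (modulus t))⁻¹ : ℂ) * g (x / t))‖ ∂μ ≤
            ‖f‖ ^ 2 + ‖g‖ ^ 2 := by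
        intro t ht
        have h1 := dilationExt_coe μ ht g
        have hle : ∀ᵐ x ∂μ, ‖conj (f x) * (((Real.sqrt (modulus t))⁻¹ : ℂ) * g (x / t))‖ ≤
            ‖f x‖ ^ 2 + ‖dilationExt μ t g x‖ ^ 2 := by
          filter_upwards [h1] with x hx
          rw [← hx, norm_mul, RCLike.norm_conj]
          nlinarith [sq_nonneg (‖f x‖ - ‖dilationExt μ t g x‖), norm_nonneg (f x),
            norm_nonneg (dilationExt μ t g x)]
        have hi := (hsq f).add (hsq (dilationExt μ t g))
        have hm : Measurable fun x =>
            conj (f x) * (((Real.sqrt (modulus t))⁻¹ : ℂ) * g (x / t)) :=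
          (Complex.continuous_conj.measurable.comp (Lp.stronglyMeasurable f).measurable).mul
            (measurable_const.mul ((Lp.stronglyMeasurable g).measurable.comp
              (measurable_id.div_const t)))
        have hint := hi.mono' hm.aestronglyMeasurable hle
        refine ⟨hint, (integral_mono_ae hint.norm hi hle).trans ?_⟩
        simp only [Pi.add_apply]
        rw [integral_add (hsq f) (hsq _), hnorm, hnorm]
        gcongr
        exact norm_dilationExt_le μ t g
      constructor
      · filter_upwards [multHaar_ae_ne_zero μ] with t ht
        exact (hbase t ht).1.const_mul (κ t)
      · refine (hκ.norm.mul_const (‖f‖ ^ 2 + ‖g‖ ^ 2)).mono'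
          hΦm.norm.stronglyMeasurable.integral_prod_right'.aestronglyMeasurable ?_
        filter_upwards [multHaar_ae_ne_zero μ] with t ht
        rw [Real.norm_of_nonneg (integral_nonneg fun x => norm_nonneg _)]
        simp only [hΦ, norm_mul (κ t)]
        rw [integral_const_mul]
        gcongr
        exact (hbase t ht).2
    have hJe : ∀ x, ∫ t, Φ (t, x) ∂(multHaar μ) = conj (f x) * J x := by
      intro x
      rw [hJ, ← integral_const_mul]
      congr 1 with t
      simp only [hΦ]
      ring
    refine ⟨by simpa only [hJe] using hΦi.integral_prod_right, ?_⟩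
    rw [hK]
    calc ∫ t, κ t * inner ℂ f (dilationExt μ t g) ∂(multHaar μ)
        = ∫ t, ∫ x, Φ (t, x) ∂μ ∂(multHaar μ) := by
          refine integral_congr_ae ?_
          filter_upwards [multHaar_ae_ne_zero μ] with t ht
          rw [inner_dilationExt μ ht, ← integral_const_mul]
      _ = ∫ x, ∫ t, Φ (t, x) ∂(multHaar μ) ∂μ := integral_integral_swap hΦi
      _ = _ := by simp only [hJe]
  -- Taking for `f` the indicators of sets of finite measure turns the weak identity into equality
  -- of set integrals, hence almost everywhere.
  have hind : ∀ (s : Set F) (hs : MeasurableSet s) (hμs : μ s ≠ ⊤) (u : F → ℂ),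
      (fun x => conj (indicatorConstLp 2 hs hμs (1 : ℂ) x) * u x) =ᵐ[μ] s.indicator u := by
    intro s hs hμs u
    filter_upwards [indicatorConstLp_coeFn (p := 2) (hs := hs) (hμs := hμs) (c := (1 : ℂ))]
      with x hx
    rw [hx]
    by_cases hxs : x ∈ s <;> simp [hxs]
  refine ae_eq_of_forall_setIntegral_eq_of_sigmaFinite (fun s hs hμs => ?_) (fun s hs hμs => ?_)
    (fun s hs hμs => ?_)
  · exact integrableOn_Lp_of_measure_ne_top (K g) one_le_two hμs.ne
  · rw [← integrable_indicator_iff hs]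
    exact (key (indicatorConstLp 2 hs hμs.ne 1)).1.congr (hind s hs hμs.ne J)
  · have h1 := (key (indicatorConstLp 2 hs hμs.ne 1)).2
    rw [integral_congr_ae (hind s hs hμs.ne J), integral_indicator hs,
      L2.inner_indicatorConstLp_one] at h1
    exact h1

end ConvolutionOperator

/-! ### Density of test functions and the Fourier transform on `L²`. -/

section FourierL2

variable {F : Type} [NontriviallyNormedField F] [ProperSpace F] [MeasurableSpace F] [BorelSpace F]
  {ψ : AddChar F Circle} {𝒮 : Set (F → ℂ)} {μ : Measure F} [μ.IsAddHaarMeasure]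

namespace SchwartzBruhatLike

variable (H : SchwartzBruhatLike ψ 𝒮)
include H

lemma zero_mem_punctured : (fun _ => (0 : ℂ)) ∈ puncturedTestFunctions 𝒮 := by
  obtain ⟨r, hr, -⟩ := H.bump Set.univ Filter.univ_mem
  refine ⟨by simpa using H.smul_mem 0 _ hr.1, HasCompactSupport.zero, by simp⟩

lemma add_mem_punctured {φ η : F → ℂ} (hφ : φ ∈ puncturedTestFunctions 𝒮)
    (hη : η ∈ puncturedTestFunctions 𝒮) :
    (fun x => φ x + η x) ∈ puncturedTestFunctions 𝒮 :=
  ⟨H.add_mem _ hφ.1 _ hη.1, hφ.2.1.add hη.2.1, by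
    filter_upwards [hφ.2.2, hη.2.2] with x h1 h2
    simp [h1, h2]⟩

lemma smul_mem_punctured (c : ℂ) {φ : F → ℂ} (hφ : φ ∈ puncturedTestFunctions 𝒮) :
    (fun x => c * φ x) ∈ puncturedTestFunctions 𝒮 :=
  ⟨H.smul_mem c _ hφ.1, hφ.2.1.mul_left, by
    filter_upwards [hφ.2.2] with x h1
    simp [h1]⟩

lemma conj_mem_punctured {φ : F → ℂ} (hφ : φ ∈ puncturedTestFunctions 𝒮) :
    (fun x => conj (φ x)) ∈ puncturedTestFunctions 𝒮 :=
  ⟨H.conj_mem _ hφ.1, hφ.2.1.comp_left (g := fun z : ℂ => conj z) (by simp), by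
    filter_upwards [hφ.2.2] with x h1
    simp [h1]⟩

/-- The test functions as a space of functions. -/
def testSpace : Submodule ℂ (F → ℂ) where
  carrier := 𝒮
  add_mem' {a b} ha hb := H.add_mem a ha b hb
  zero_mem' := H.zero_mem_punctured.1
  smul_mem' c f hf := H.smul_mem c f hf

/-- The classes of the test functions of the initial domain of the commutator. -/
def initialDomain (μ : Measure F) [μ.IsAddHaarMeasure] : Submodule ℂ (Lp ℂ 2 μ) where
  carrier := {f | ∃ φ ∈ puncturedTestFunctions 𝒮, f =ᵐ[μ] φ}
  add_mem' := by
    rintro f g ⟨φ, hφ, h1⟩ ⟨η, hη, h2⟩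
    refine ⟨_, H.add_mem_punctured hφ hη, ?_⟩
    filter_upwards [Lp.coeFn_add f g, h1, h2] with x h3 h4 h5
    exact h3.trans (by rw [Pi.add_apply, h4, h5])
  zero_mem' := ⟨_, H.zero_mem_punctured, Lp.coeFn_zero _ _ _⟩
  smul_mem' := by
    rintro c f ⟨φ, hφ, h1⟩
    refine ⟨_, H.smul_mem_punctured c hφ, ?_⟩
    filter_upwards [Lp.coeFn_smul c f, h1] with x h3 h4
    exact h3.trans (by rw [Pi.smul_apply, h4, smul_eq_mul])

/-- A vector orthogonal to the initial domain is annihilated by all punctured test functions, these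
being stable under conjugation, and so vanishes by `ae_eq_zero`. -/
lemma dense_initialDomain : Dense (H.initialDomain μ : Set (Lp ℂ 2 μ)) := by
  rw [Submodule.dense_iff_topologicalClosure_eq_top, Submodule.topologicalClosure_eq_top_iff,
    Submodule.eq_bot_iff]
  intro f hf
  have h1 : f =ᵐ[μ] 0 := by
    refine H.ae_eq_zero μ f (Lp.memLp f) fun φ hφ => ?_
    have hφ' := H.conj_mem_punctured hφ
    have hm := H.memLp (μ := μ) hφ'.1
    have h2 := Submodule.inner_right_of_mem_orthogonal (K := H.initialDomain μ) (u := hm.toLp)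
      ⟨_, hφ', hm.coeFn_toLp⟩ hf
    rw [L2.inner_def] at h2
    rw [← h2]
    refine integral_congr_ae ?_
    filter_upwards [hm.coeFn_toLp] with x hx
    rw [hx, RCLike.inner_apply', RCLike.conj_conj]
  exact Lp.ext (h1.trans (Lp.coeFn_zero _ _ _).symm)

/-- The class map of test functions. -/
def toL2 (μ : Measure F) [μ.IsAddHaarMeasure] : H.testSpace →ₗ[ℂ] Lp ℂ 2 μ where
  toFun φ := (H.memLp φ.2).toLp
  map_add' _ _ := rfl
  map_smul' _ _ := rfl

lemma toL2_coe (φ : H.testSpace) : H.toL2 μ φ =ᵐ[μ] (φ : F → ℂ) := (H.memLp φ.2).coeFn_toLp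

lemma denseRange_toL2 : DenseRange (H.toL2 μ) := by
  refine H.dense_initialDomain.mono ?_
  rintro f ⟨φ, hφ, hf⟩
  exact ⟨⟨φ, hφ.1⟩, Lp.ext ((H.toL2_coe _).trans hf.symm)⟩

end SchwartzBruhatLike

lemma integral_sq_norm_Lp (h : Lp ℂ 2 μ) : ∫ x, ‖h x‖ ^ 2 ∂μ = ‖h‖ ^ 2 := by
  have h1 := inner_self_eq_norm_sq_to_K (𝕜 := ℂ) h
  rw [L2.inner_def] at h1
  simp only [inner_self_eq_norm_sq_to_K] at h1
  have h2 : ∫ x, ((‖h x‖ ^ 2 : ℝ) : ℂ) ∂μ = ((‖h‖ ^ 2 : ℝ) : ℂ) := by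
    push_cast; exact h1
  rw [integral_complex_ofReal] at h2
  exact_mod_cast h2

namespace SchwartzBruhatLike

variable (H : SchwartzBruhatLike ψ 𝒮)

/-- The Fourier transform of test functions as a linear equivalence. -/
def fourierEquiv (hψ : Continuous ψ) (hμ : IsSelfDualMeasure ψ μ 𝒮) :
    H.testSpace ≃ₗ[ℂ] H.testSpace where
  toFun φ := ⟨fourier ψ μ φ, H.fourier_mem μ _ φ.2⟩
  invFun φ := ⟨fun x => fourier ψ μ φ (-x), H.neg_mem (H.fourier_mem μ _ φ.2)⟩
  map_add' φ η := by
    ext y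
    exact fourier_add hψ (H.integrable φ.2) (H.integrable η.2) y
  map_smul' c φ := by
    ext y
    exact fourier_smul c _ y
  left_inv φ := by
    ext y
    simp [hμ.2 _ φ.2]
  right_inv φ := by
    ext y
    have h := fourier_comp_mul (ψ := ψ) (μ := μ) (t := -1) (by simp) (fourier ψ μ φ) y
    simp only [neg_one_mul, modulus_neg, modulus_one, hμ.2 _ φ.2] at h
    simp [h, div_neg]

lemma norm_toL2_fourierEquiv (hψ : Continuous ψ) (hμ : IsSelfDualMeasure ψ μ 𝒮)
    (φ : H.testSpace) : ‖H.toL2 μ (H.fourierEquiv hψ hμ φ)‖ = ‖H.toL2 μ φ‖ := by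
  have hsq : ∀ η : H.testSpace, ∫ x, ‖(η : F → ℂ) x‖ ^ 2 ∂μ = ‖H.toL2 μ η‖ ^ 2 := by
    intro η
    rw [← integral_sq_norm_Lp]
    refine integral_congr_ae ?_
    filter_upwards [H.toL2_coe (μ := μ) η] with x hx
    rw [hx]
  have h1 := H.plancherel_const (μ := μ) hψ (c := 1) (by simpa using hμ.2) φ.2 φ.2
  simp only [Complex.mul_conj', one_mul] at h1
  norm_cast at h1
  have h2 := hsq (H.fourierEquiv hψ hμ φ)
  have h3 : ∫ x, ‖(H.fourierEquiv hψ hμ φ : F → ℂ) x‖ ^ 2 ∂μ = ∫ x, ‖(φ : F → ℂ) x‖ ^ 2 ∂μ := h1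
  rw [h3, hsq] at h2
  exact ((sq_eq_sq₀ (norm_nonneg _) (norm_nonneg _)).1 h2).symm

/-- The Fourier transform of `L²`. -/
def fourierL2 (hψ : Continuous ψ) (hμ : IsSelfDualMeasure ψ μ 𝒮) : Lp ℂ 2 μ ≃ₗᵢ[ℂ] Lp ℂ 2 μ :=
  (H.fourierEquiv hψ hμ).extendOfIsometry (H.toL2 μ) (H.toL2 μ) H.denseRange_toL2
    H.denseRange_toL2 (H.norm_toL2_fourierEquiv hψ hμ)

lemma fourierL2_toL2 (hψ : Continuous ψ) (hμ : IsSelfDualMeasure ψ μ 𝒮) (φ : H.testSpace) :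
    H.fourierL2 hψ hμ (H.toL2 μ φ) = H.toL2 μ (H.fourierEquiv hψ hμ φ) :=
  LinearEquiv.extendOfIsometry_eq _ _ _ _ _ _ _

lemma fourierL2_coe (hψ : Continuous ψ) (hμ : IsSelfDualMeasure ψ μ 𝒮) {φ : F → ℂ} (hφ : φ ∈ 𝒮)
    {f : Lp ℂ 2 μ} (hf : f =ᵐ[μ] φ) : H.fourierL2 hψ hμ f =ᵐ[μ] fourier ψ μ φ := by
  have h1 : f = H.toL2 μ ⟨φ, hφ⟩ := Lp.ext (hf.trans (H.toL2_coe (μ := μ) ⟨φ, hφ⟩).symm)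
  rw [h1, fourierL2_toL2]
  exact H.toL2_coe _

/-- Both sides are continuous, so the scaling rule of the Fourier integral need only be checked on
test functions. -/
lemma dilationL2_fourierL2 (hψ : Continuous ψ) (hμ : IsSelfDualMeasure ψ μ 𝒮) (t : Fˣ)
    (f : Lp ℂ 2 μ) :
    dilationL2 μ t (H.fourierL2 hψ hμ f) = H.fourierL2 hψ hμ (dilationL2 μ t⁻¹ f) := by
  refine congrFun (H.denseRange_toL2.equalizer (g := fun f => dilationL2 μ t (H.fourierL2 hψ hμ f))
    (h := fun f => H.fourierL2 hψ hμ (dilationL2 μ t⁻¹ f)) ?_ ?_ ?_) f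
  · exact (dilationL2 μ t).continuous.comp (H.fourierL2 hψ hμ).continuous
  · exact (H.fourierL2 hψ hμ).continuous.comp (dilationL2 μ t⁻¹).continuous
  ext φ : 1
  have ht := t.ne_zero
  have hp := modulus_pos ht
  have hs : (Real.sqrt (modulus (t : F)) : ℂ) ≠ 0 := by
    exact_mod_cast (Real.sqrt_pos.2 hp).ne'
  have hs2 : (modulus (t : F) : ℂ) =
      (Real.sqrt (modulus (t : F)) : ℂ) * (Real.sqrt (modulus (t : F)) : ℂ) := by
    exact_mod_cast (Real.mul_self_sqrt hp.le).symm
  have h1 : dilationL2 μ t⁻¹ (H.toL2 μ φ) =ᵐ[μ]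
      fun x => (Real.sqrt (modulus (t : F)) : ℂ) * (φ : F → ℂ) (t * x) := by
    filter_upwards [dilationL2_coe μ t⁻¹ (H.toL2 μ φ),
      (quasiMeasurePreserving_div_const μ (t⁻¹).ne_zero).ae (H.toL2_coe (μ := μ) φ)] with x h1 h2
    rw [h1, dilation, h2, Units.val_inv_eq_inv_val, modulus_inv, Real.sqrt_inv, div_inv_eq_mul,
      mul_comm x]
    simp
  have h2 := H.fourierL2_coe hψ hμ (H.smul_mem _ _ (H.dilate_mem t ht _ φ.2)) h1
  refine Lp.ext ?_
  simp only [Function.comp]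
  refine Filter.EventuallyEq.trans ?_ h2.symm
  rw [fourierL2_toL2]
  filter_upwards [dilationL2_coe μ t (H.toL2 μ (H.fourierEquiv hψ hμ φ)),
    (quasiMeasurePreserving_div_const μ ht).ae (H.toL2_coe (μ := μ) (H.fourierEquiv hψ hμ φ))]
    with x h3 h4
  rw [h3, dilation, h4, fourier_smul, fourier_comp_mul ht, ← mul_assoc]
  congr 1
  rw [hs2]
  field_simp

end SchwartzBruhatLike

end FourierL2

/-! ### Quasi-characters: size, multiplicativity and measurability. -/

section QuasiCharacters

variable {F : Type} [NontriviallyNormedField F] [ProperSpace F]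

lemma quasiChar_of_ne (χ : Fˣ →ₜ* Circle) (z : ℂ) {x : F} (hx : x ≠ 0) :
    quasiChar χ z x = (χ (Units.mk0 x hx) : ℂ) * (modulus x : ℂ) ^ z := by
  simp [quasiChar, hx]

lemma norm_quasiChar (χ : Fˣ →ₜ* Circle) (z : ℂ) {x : F} (hx : x ≠ 0) :
    ‖quasiChar χ z x‖ = modulus x ^ z.re := by
  rw [quasiChar_of_ne χ z hx, norm_mul, Circle.norm_coe, one_mul,
    Complex.norm_cpow_eq_rpow_re_of_pos (modulus_pos hx)]

lemma quasiChar_div (χ : Fˣ →ₜ* Circle) (z : ℂ) {x t : F} (hx : x ≠ 0) (ht : t ≠ 0) :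
    quasiChar χ z (x / t) = quasiChar χ z x * quasiChar χ⁻¹ (-z) t := by
  rw [quasiChar_of_ne χ z (div_ne_zero hx ht), quasiChar_of_ne χ z hx, quasiChar_of_ne _ _ ht]
  have e : Units.mk0 (x / t) (div_ne_zero hx ht) = Units.mk0 x hx * (Units.mk0 t ht)⁻¹ := by
    ext; simp [div_eq_mul_inv]
  have e2 : (χ⁻¹ (Units.mk0 t ht) : Circle) = (χ (Units.mk0 t ht))⁻¹ := rfl
  rw [e, map_mul, map_inv, e2, modulus_div, Complex.ofReal_div, div_eq_mul_inv,
    ← Complex.ofReal_inv, Complex.mul_cpow_ofReal_nonneg (modulus_nonneg _)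
      (inv_nonneg.2 (modulus_nonneg _)), Complex.ofReal_inv, Complex.inv_cpow, Complex.cpow_neg]
  · push_cast; ring
  · rw [Complex.arg_ofReal_of_nonneg (modulus_nonneg t)]; exact Real.pi_pos.ne

lemma quasiChar_sub_one (χ : Fˣ →ₜ* Circle) (z : ℂ) {x : F} (hx : x ≠ 0) :
    quasiChar χ (z - 1) x = ((modulus x)⁻¹ : ℂ) * quasiChar χ z x := by
  have hp : (modulus x : ℂ) ≠ 0 := by exact_mod_cast modulus_ne_zero hx
  rw [quasiChar_of_ne _ _ hx, quasiChar_of_ne _ _ hx, Complex.cpow_sub _ _ hp, Complex.cpow_one]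
  ring

lemma continuousOn_quasiChar (χ : Fˣ →ₜ* Circle) (z : ℂ) :
    ContinuousOn (quasiChar χ z : F → ℂ) {x | x ≠ 0} := by
  rw [continuousOn_iff_continuous_domRestrict]
  have h1 : Continuous fun x : {x : F // x ≠ 0} => (unitsHomeomorphNeZero (G₀ := F)).symm x :=
    unitsHomeomorphNeZero.symm.continuous
  have h2 : Continuous fun x : {x : F // x ≠ 0} => ((χ ((unitsHomeomorphNeZero (G₀ := F)).symm x) :
      Circle) : ℂ) * (modulus (x : F) : ℂ) ^ z := by
    have h3 : Continuous fun z : Circle => (z : ℂ) := by fun_prop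
    refine (h3.comp (χ.continuous_toFun.comp h1)).mul ?_
    refine continuous_iff_continuousAt.2 fun x => ?_
    refine ContinuousAt.cpow ?_ continuousAt_const ?_
    · exact (Complex.continuous_ofReal.comp
        (continuous_modulus.comp continuous_subtype_val)).continuousAt
    · exact Complex.ofReal_mem_slitPlane.2 (modulus_pos x.2)
  refine h2.congr fun x => ?_
  rw [Set.domRestrict_apply, quasiChar_of_ne χ z x.2]
  congr 3
  exact Units.ext (congrArg Subtype.val
    ((unitsHomeomorphNeZero (G₀ := F)).apply_symm_apply x))

lemma measurable_quasiChar [MeasurableSpace F] [BorelSpace F] (χ : Fˣ →ₜ* Circle) (z : ℂ) :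
    Measurable (quasiChar χ z : F → ℂ) := by
  refine measurable_of_measurable_on_compl_singleton 0 ?_
  exact (continuousOn_iff_continuous_domRestrict.1 (continuousOn_quasiChar χ z)).measurable

end QuasiCharacters

/-! ### Mellin transforms in the strip and the local functional equation. -/

section Mellin

variable {F : Type} [NontriviallyNormedField F] [ProperSpace F] [MeasurableSpace F] [BorelSpace F]
  {ψ : AddChar F Circle} {𝒮 : Set (F → ℂ)} {μ : Measure F} [μ.IsAddHaarMeasure]

/-- The Mellin transform `∫ f(x) χ(x) |x|^z dx`. -/
def mellinInt (μ : Measure F) (f : F → ℂ) (χ : Fˣ →ₜ* Circle) (z : ℂ) : ℂ :=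
  ∫ x, f x * quasiChar χ z x ∂μ

/-- Functions bounded by `(1 + |log |x||) / (1 + |x|)`. -/
def MellinDecay (f : F → ℂ) : Prop :=
  Measurable f ∧ ∃ C : ℝ, ∀ x, ‖f x‖ * (1 + modulus x) ≤ C * (1 + |Real.log (modulus x)|)

/-- Functions bounded by `1 / (1 + |x|)`. -/
def StrongMellinDecay (f : F → ℂ) : Prop :=
  Measurable f ∧ ∃ C : ℝ, ∀ x, ‖f x‖ * (1 + modulus x) ≤ C

lemma StrongMellinDecay.mellinDecay {f : F → ℂ} (hf : StrongMellinDecay f) : MellinDecay f := by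
  obtain ⟨hm, C, hC⟩ := hf
  refine ⟨hm, C, fun x => (hC x).trans ?_⟩
  have h0 : 0 ≤ C := le_trans (by have := modulus_nonneg x; positivity) (hC x)
  nlinarith [abs_nonneg (Real.log (modulus x))]

lemma StrongMellinDecay.opA {f : F → ℂ} (hf : StrongMellinDecay f) : MellinDecay (opA f) := by
  obtain ⟨hm, C, hC⟩ := hf
  refine ⟨(Complex.measurable_ofReal.comp measurable_log_modulus).mul hm, C, fun x => ?_⟩
  have h0 : 0 ≤ C := le_trans (by have := modulus_nonneg x; positivity) (hC x)
  have h1 := abs_nonneg (Real.log (modulus x))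
  rw [CommutatorOperator.opA, norm_mul, Complex.norm_real, Real.norm_eq_abs, mul_assoc]
  have := mul_le_mul_of_nonneg_left (hC x) h1
  nlinarith

lemma SchwartzBruhatLike.strongMellinDecay (H : SchwartzBruhatLike ψ 𝒮) {φ : F → ℂ} (hφ : φ ∈ 𝒮) :
    StrongMellinDecay φ := by
  obtain ⟨C, hC⟩ := H.decay φ hφ
  refine ⟨H.measurable hφ, C, fun x => le_trans ?_ (hC x)⟩
  have h0 := modulus_nonneg x
  rw [sq, ← mul_assoc]
  exact le_mul_of_one_le_right (by positivity) (by linarith)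

lemma MellinDecay.norm_le {f : F → ℂ} (hf : MellinDecay f) : ∃ C : ℝ, ∀ x,
    ‖f x‖ ≤ C * (1 + |Real.log (modulus x)|) / (1 + modulus x) := by
  obtain ⟨-, C, hC⟩ := hf
  refine ⟨C, fun x => ?_⟩
  rw [le_div_iff₀ (by have := modulus_nonneg x; positivity)]
  exact hC x

lemma MellinDecay.integrable {f : F → ℂ} (hf : MellinDecay f) (χ : Fˣ →ₜ* Circle) {z : ℂ}
    (h0 : -1 < z.re) (h1 : z.re < 0) : Integrable (fun x => f x * quasiChar χ z x) μ := by
  obtain ⟨C, hC⟩ := hf.norm_le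
  refine ((integrable_log_weight (μ := μ) (σ := -z.re) (by linarith) (by linarith)).const_mul
    C).mono' (hf.1.mul (measurable_quasiChar χ z)).aestronglyMeasurable ?_
  filter_upwards [ae_ne_zero μ] with x hx
  rw [norm_mul, norm_quasiChar χ z hx, neg_neg]
  have := Real.rpow_pos_of_pos (modulus_pos hx) z.re
  calc _ ≤ C * (1 + |Real.log (modulus x)|) / (1 + modulus x) * modulus x ^ z.re := by
        gcongr; exact hC x
    _ = _ := by ring

/-- Differentiating `|x|^z` brings down `log|x|`, so the operator `A` becomes `d/dz`. The stronger
decay leaves room for this extra logarithm. -/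
lemma StrongMellinDecay.hasDerivAt {f : F → ℂ} (hf : StrongMellinDecay f) (χ : Fˣ →ₜ* Circle)
    {z : ℂ} (h0 : -1 < z.re) (h1 : z.re < 0) :
    HasDerivAt (mellinInt μ f χ) (mellinInt μ (CommutatorOperator.opA f) χ z) z := by
  obtain ⟨C, hC⟩ := hf.2
  -- Half the distance from `z` to the boundary of the strip. On the disc of radius `ε`, `|x| ^ Re
  -- w` is at most the sum of its two extreme powers, one for `|x| ≤ 1` and one for `|x| ≥ 1`.
  set ε : ℝ := min (1 + z.re) (-z.re) / 2 with hε
  have hε0 : 0 < ε := by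
    have : 0 < min (1 + z.re) (-z.re) := lt_min (by linarith) (by linarith)
    positivity
  have hε1 : -1 < z.re - ε := by
    have := min_le_left (1 + z.re) (-z.re)
    rw [hε]; linarith
  have hε2 : z.re + ε < 0 := by
    have := min_le_right (1 + z.re) (-z.re)
    rw [hε]; linarith
  set W : ℝ → F → ℝ := fun σ x =>
    (1 + |Real.log (modulus x)|) * modulus x ^ (-σ) / (1 + modulus x) with hW
  have hWi : ∀ σ, 0 < σ → σ < 1 → Integrable (W σ) μ := fun σ ha hb => integrable_log_weight ha hb
  have hA := hf.opA
  refine (hasDerivAt_integral_of_dominated_loc_of_deriv_le (μ := μ) (s := Metric.ball z ε)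
    (F := fun w x => f x * quasiChar χ w x)
    (F' := fun w x => CommutatorOperator.opA f x * quasiChar χ w x)
    (bound := fun x => C * (W (-(z.re - ε)) x + W (-(z.re + ε)) x))
    (Metric.ball_mem_nhds z hε0) ?_ ?_ ?_ ?_ ?_ ?_).2
  · exact Filter.Eventually.of_forall fun w =>
      (hf.1.mul (measurable_quasiChar χ w)).aestronglyMeasurable
  · exact hf.mellinDecay.integrable χ h0 h1
  · exact (hA.1.mul (measurable_quasiChar χ z)).aestronglyMeasurable
  · filter_upwards [ae_ne_zero μ] with x hx w hw
    have hp := modulus_pos hx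
    have hw1 : |(w - z).re| < ε := (Complex.abs_re_le_norm _).trans_lt (by simpa [dist_eq_norm] using hw)
    rw [Complex.sub_re, abs_lt] at hw1
    have hr : modulus x ^ w.re ≤ modulus x ^ (z.re - ε) + modulus x ^ (z.re + ε) := by
      have ha := Real.rpow_pos_of_pos hp (z.re - ε)
      have hb := Real.rpow_pos_of_pos hp (z.re + ε)
      rcases le_total 1 (modulus x) with h | h
      · have := Real.rpow_le_rpow_of_exponent_le h (by linarith : w.re ≤ z.re + ε)
        linarith
      · have := Real.rpow_le_rpow_of_exponent_ge hp h (by linarith : z.re - ε ≤ w.re)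
        linarith
    have hfC : ‖f x‖ ≤ C / (1 + modulus x) := by
      rw [le_div_iff₀ (by positivity)]; exact hC x
    rw [norm_mul, norm_quasiChar χ w hx, CommutatorOperator.opA, norm_mul, Complex.norm_real,
      Real.norm_eq_abs]
    have hC0 : 0 ≤ C := le_trans (by positivity) (hC x)
    have hl := abs_nonneg (Real.log (modulus x))
    calc |Real.log (modulus x)| * ‖f x‖ * modulus x ^ w.re
        ≤ (1 + |Real.log (modulus x)|) * (C / (1 + modulus x)) *
          (modulus x ^ (z.re - ε) + modulus x ^ (z.re + ε)) := by
          gcongr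
          linarith
      _ = _ := by simp only [hW, neg_neg]; ring
  · exact ((hWi _ (by linarith) (by linarith)).add (hWi _ (by linarith) (by linarith))).const_mul C
  · filter_upwards [ae_ne_zero μ] with x hx w _
    have hp : (modulus x : ℂ) ≠ 0 := by exact_mod_cast modulus_ne_zero hx
    simp only [quasiChar_of_ne χ _ hx, CommutatorOperator.opA]
    have h := ((hasDerivAt_id w).const_cpow (c := (modulus x : ℂ)) (Or.inl hp)).const_mul
      (f x * (χ (Units.mk0 x hx) : ℂ))
    simp only [id, mul_one, ← Complex.ofReal_log (modulus_nonneg x)] at h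
    have e : (fun y : ℂ => f x * ((χ (Units.mk0 x hx) : ℂ) * (modulus x : ℂ) ^ y)) =
        fun y => f x * (χ (Units.mk0 x hx) : ℂ) * (modulus x : ℂ) ^ y := by
      ext y; ring
    have e' : (Real.log (modulus x) : ℂ) * f x *
        ((χ (Units.mk0 x hx) : ℂ) * (modulus x : ℂ) ^ w) = f x * (χ (Units.mk0 x hx) : ℂ) *
          ((modulus x : ℂ) ^ w * (Real.log (modulus x) : ℂ)) := by ring
    rw [e, e']
    exact h

/-- The exchange formula behind the local functional equation. -/
lemma mellin_exchange {h₁ h₂ G₁ G₂ : F → ℂ} (hh₁ : MellinDecay h₁) (hh₂ : MellinDecay h₂)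
    (hG₁ : MellinDecay G₁) (hG₂ : MellinDecay G₂)
    (hrel : ∀ x, x ≠ 0 → ∫ t, h₂ t * G₁ (t * x) ∂μ = ∫ t, h₁ t * G₂ (t * x) ∂μ)
    (χ : Fˣ →ₜ* Circle) {s : ℂ} (hs : s ∈ criticalStrip) :
    mellinInt μ h₂ χ⁻¹ (-s) * mellinInt μ G₁ χ (s - 1) =
      mellinInt μ h₁ χ⁻¹ (-s) * mellinInt μ G₂ χ (s - 1) := by
  have hs0 := hs.1
  have hs1 := hs.2
  -- A product of two Mellin transforms is the Mellin transform of the multiplicative convolution `∫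
  -- h(t) G(tx) dt`; `hrel` says the two convolutions agree.
  have half : ∀ h G : F → ℂ, MellinDecay h → MellinDecay G →
      mellinInt μ h χ⁻¹ (-s) * mellinInt μ G χ (s - 1) =
        ∫ x, quasiChar χ (s - 1) x * ∫ t, h t * G (t * x) ∂μ ∂μ := by
    intro h G hh hG
    have hre : (s - 1).re = s.re - 1 := by simp
    have hhi := hh.integrable (μ := μ) χ⁻¹ (z := -s) (by simpa using hs1) (by simpa using hs0)
    have hGi := hG.integrable (μ := μ) χ (z := s - 1) (by linarith) (by linarith)
    rw [← mellin_fubini μ hh.1 hG.1 (measurable_quasiChar χ (s - 1))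
      (a := fun t => modulus t ^ (1 - s.re)) (b := fun x => modulus x ^ (s.re - 1)), mellinInt,
      mellinInt, ← integral_mul_const, integral_multHaar]
    · refine integral_congr_ae ?_
      filter_upwards [ae_ne_zero μ] with t ht
      have e1 : ∫ x, quasiChar χ (s - 1) (x / t) * G x ∂μ =
          quasiChar χ⁻¹ (-(s - 1)) t * ∫ x, G x * quasiChar χ (s - 1) x ∂μ := by
        rw [← integral_const_mul]
        refine integral_congr_ae ?_
        filter_upwards [ae_ne_zero μ] with x hx
        rw [quasiChar_div χ _ hx ht]
        ring
      rw [e1]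
      have e2 : -s = -(s - 1) - 1 := by ring
      rw [e2, quasiChar_sub_one _ _ ht, Complex.real_smul]
      push_cast
      ring
    · intro t x ht hx
      rw [norm_quasiChar χ _ (div_ne_zero hx ht), modulus_div,
        Real.div_rpow (modulus_nonneg _) (modulus_nonneg _), hre,
        show (1 - s.re) = -(s.re - 1) by ring, Real.rpow_neg (modulus_nonneg _), div_eq_inv_mul]
    · rw [integrable_multHaar]
      refine hhi.norm.congr ?_
      filter_upwards [ae_ne_zero μ] with t ht
      rw [norm_mul, norm_quasiChar _ _ ht, Complex.neg_re, smul_eq_mul, Real.rpow_sub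
        (modulus_pos ht), Real.rpow_one, Real.rpow_neg (modulus_nonneg t)]
      have := modulus_ne_zero ht
      field_simp
    · refine hGi.norm.congr ?_
      filter_upwards [ae_ne_zero μ] with x hx
      rw [norm_mul, norm_quasiChar _ _ hx, hre]
  rw [half _ _ hh₂ hG₁, half _ _ hh₁ hG₂]
  refine integral_congr_ae ?_
  filter_upwards [ae_ne_zero μ] with x hx
  rw [hrel x hx]

lemma SchwartzBruhatLike.tate (H : SchwartzBruhatLike ψ 𝒮) (hψ : Continuous ψ) {α β : F → ℂ}
    (hα : α ∈ 𝒮) (hβ : β ∈ 𝒮) (χ : Fˣ →ₜ* Circle) {s : ℂ} (hs : s ∈ criticalStrip) :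
    mellinInt μ β χ⁻¹ (-s) * mellinInt μ (fourier ψ μ α) χ (s - 1) =
      mellinInt μ α χ⁻¹ (-s) * mellinInt μ (fourier ψ μ β) χ (s - 1) :=
  mellin_exchange (H.strongMellinDecay hα).mellinDecay (H.strongMellinDecay hβ).mellinDecay
    (H.strongMellinDecay (H.fourier_mem μ _ hα)).mellinDecay
    (H.strongMellinDecay (H.fourier_mem μ _ hβ)).mellinDecay
    (fun _ hx => integral_mul_fourier_dilate hψ (H.integrable hα) (H.integrable hβ) hx) χ hs

lemma SchwartzBruhatLike.strongMellinDecay_opB (H : SchwartzBruhatLike ψ 𝒮) (hψ : Continuous ψ)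
    (hψ1 : ψ ≠ 1) {α : F → ℂ} (hα : α ∈ puncturedTestFunctions 𝒮) :
    StrongMellinDecay (opB ψ μ α) := by
  have h1 : Integrable (opA (fourierInv ψ μ α)) μ :=
    integrable_log_fourier H (H.neg_mem (H.fourier_mem μ _ hα.1))
  exact ⟨(continuous_fourier hψ h1).measurable, opB_decay H hψ hψ1 hα⟩

/-- The functional equation for `Bα`, whose Fourier transform is `log |y| ℱα(y)`. -/
lemma SchwartzBruhatLike.tate_opB (H : SchwartzBruhatLike ψ 𝒮) (hψ : Continuous ψ)
    (hψ1 : ψ ≠ 1) (hμ : IsSelfDualMeasure ψ μ 𝒮) {α β : F → ℂ}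
    (hα : α ∈ puncturedTestFunctions 𝒮) (hβ : β ∈ 𝒮) (χ : Fˣ →ₜ* Circle) {s : ℂ}
    (hs : s ∈ criticalStrip) :
    mellinInt μ β χ⁻¹ (-s) * mellinInt μ (opA (fourier ψ μ α)) χ (s - 1) =
      mellinInt μ (opB ψ μ α) χ⁻¹ (-s) * mellinInt μ (fourier ψ μ β) χ (s - 1) := by
  have hFα := H.fourier_mem μ _ hα.1
  have hFβ := H.fourier_mem μ _ hβ
  have hg : Integrable (opA (fourierInv ψ μ α)) μ := integrable_log_fourier H (H.neg_mem hFα)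
  refine mellin_exchange (H.strongMellinDecay_opB hψ hψ1 hα).mellinDecay
    (H.strongMellinDecay hβ).mellinDecay (H.strongMellinDecay hFα).opA
    (H.strongMellinDecay hFβ).mellinDecay (fun x hx => ?_) χ hs
  -- `Bα` is only known to be the transform of an integrable function; that transform is moved onto
  -- the dilate of `ℱβ`, where self-duality returns `β`.
  have h1 := integral_fourier_mul hψ hg (H.integrable (μ := μ) (H.dilate_mem x hx _ hFβ))
  simp only [fourier_comp_mul hx, hμ.2 _ hβ] at h1
  have h2 := integral_comp_mul_left μ (neg_ne_zero.2 hx)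
    (fun u => opA (fourierInv ψ μ α) u * β (-(u / x)))
  calc ∫ t, β t * opA (fourier ψ μ α) (t * x) ∂μ
      = ∫ t, opA (fourierInv ψ μ α) (-x * t) * β (-(-x * t / x)) ∂μ := by
        congr 1 with t
        have e : -(-x * t / x) = t := by field_simp
        rw [e, opA, opA, fourierInv_apply, neg_mul, neg_neg, modulus_neg, mul_comm t x, mul_comm]
    _ = ∫ t, opB ψ μ α t * fourier ψ μ β (t * x) ∂μ := by
        rw [h2, modulus_neg, ← integral_const_mul]
        simp only [mul_comm _ x]
        refine Eq.trans ?_ h1.symm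
        congr 1 with u
        ring

/-- A test function adapted to a quasi-character. -/
lemma SchwartzBruhatLike.exists_bump_mellin (H : SchwartzBruhatLike ψ 𝒮) (χ : Fˣ →ₜ* Circle)
    (z : ℂ) : ∃ r : F → ℝ, (fun x => (r x : ℂ)) ∈ puncturedTestFunctions 𝒮 ∧
      0 < ∫ x, r x ∂μ ∧ (∫ x, r x ∂μ) / 2 ≤ ‖mellinInt μ (fun x => (r x : ℂ)) χ z‖ ∧
      Integrable (fun x => (r x : ℂ) * quasiChar χ z x) μ ∧
      ∫ x, ‖(r x : ℂ) * quasiChar χ z x‖ ∂μ ≤ 2 * ∫ x, r x ∂μ := by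
  have h1 : quasiChar χ z (1 : F) = 1 := by
    rw [quasiChar_of_ne χ z one_ne_zero, modulus_one]
    have : Units.mk0 (1 : F) one_ne_zero = 1 := by ext; rfl
    rw [this, map_one]; simp
  have hc : ContinuousAt (quasiChar χ z : F → ℂ) 1 :=
    (continuousOn_quasiChar χ z).continuousAt (isOpen_ne.mem_nhds one_ne_zero)
  -- The bump is supported where the quasi-character is within `1/2` of `1`. The resulting constants
  -- `1/2` and `2` do not depend on the quasi-character, which makes the final spectral bound
  -- uniform.
  have hV : {x : F | ‖quasiChar χ z x - 1‖ < 1 / 2} ∈ 𝓝 (1 : F) := by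
    have := Metric.continuousAt_iff'.1 hc (1 / 2) (by norm_num)
    rw [h1] at this
    filter_upwards [this] with x hx
    simpa [dist_eq_norm] using hx
  obtain ⟨r, hr, hr0, hrV, hpos, -⟩ := H.exists_bump_integral (μ := μ) hV
  have hi : Integrable (fun x => (r x : ℂ)) μ := H.integrable hr.1
  have hir : Integrable r μ := by simpa using hi.re
  have hd : ∀ x, ‖(r x : ℂ) * quasiChar χ z x - r x‖ ≤ r x / 2 := by
    intro x
    by_cases hx : x ∈ {x : F | ‖quasiChar χ z x - 1‖ < 1 / 2}
    · have e : (r x : ℂ) * quasiChar χ z x - r x = r x * (quasiChar χ z x - 1) := by ring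
      rw [e, norm_mul, Complex.norm_real, Real.norm_of_nonneg (hr0 x)]
      have hx' : ‖quasiChar χ z x - 1‖ ≤ 1 / 2 := le_of_lt hx
      nlinarith [hr0 x]
    · simp [hrV x hx]
  have hm : AEStronglyMeasurable (fun x => (r x : ℂ) * quasiChar χ z x) μ :=
    ((H.measurable hr.1).mul (measurable_quasiChar χ z)).aestronglyMeasurable
  have hn : ∀ x, ‖(r x : ℂ) * quasiChar χ z x‖ ≤ 2 * r x := by
    intro x
    have h2 := norm_le_insert' ((r x : ℂ) * quasiChar χ z x) (r x)
    have h3 := hd x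
    rw [Complex.norm_real, Real.norm_of_nonneg (hr0 x)] at h2
    linarith [hr0 x]
  have hint : Integrable (fun x => (r x : ℂ) * quasiChar χ z x) μ :=
    (hir.const_mul 2).mono' hm (Filter.Eventually.of_forall hn)
  refine ⟨r, hr, hpos, ?_, hint, ?_⟩
  · have h2 : ‖mellinInt μ (fun x => (r x : ℂ)) χ z - ∫ x, (r x : ℂ) ∂μ‖ ≤ ∫ x, r x / 2 ∂μ := by
      rw [mellinInt, ← integral_sub hint hi]
      exact norm_integral_le_of_norm_le (hir.div_const 2) (Filter.Eventually.of_forall hd)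
    rw [integral_div, integral_complex_ofReal] at h2
    have h3 := norm_sub_norm_le ((∫ x, r x ∂μ : ℝ) : ℂ) (mellinInt μ (fun x => (r x : ℂ)) χ z)
    rw [norm_sub_rev, Complex.norm_real, Real.norm_of_nonneg hpos.le] at h3
    linarith
  · rw [← integral_const_mul]
    exact integral_mono hint.norm (hir.const_mul 2) hn

end Mellin

/-! ### The Gamma factor, the spectral function and the theorem for abstract test spaces. -/

section Gamma

variable {F : Type} [NontriviallyNormedField F] [ProperSpace F] [MeasurableSpace F] [BorelSpace F]
  {ψ : AddChar F Circle} {𝒮 : Set (F → ℂ)} {μ : Measure F} [μ.IsAddHaarMeasure]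

lemma isOpen_criticalStrip : IsOpen criticalStrip :=
  (isOpen_lt continuous_const Complex.continuous_re).inter
    (isOpen_lt Complex.continuous_re continuous_const)

namespace SchwartzBruhatLike

variable (H : SchwartzBruhatLike ψ 𝒮)

lemma exists_mellin_ne_zero (H : SchwartzBruhatLike ψ 𝒮) (μ : Measure F) [μ.IsAddHaarMeasure]
    (χ : Fˣ →ₜ* Circle) (z : ℂ) :
    ∃ β ∈ puncturedTestFunctions 𝒮, mellinInt μ β χ z ≠ 0 := by
  obtain ⟨r, hr, hpos, h, -⟩ := H.exists_bump_mellin (μ := μ) χ z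
  exact ⟨_, hr, norm_pos_iff.1 (by linarith)⟩

/-- The Gamma factor. -/
def gammaFactor (H : SchwartzBruhatLike ψ 𝒮) (μ : Measure F) [μ.IsAddHaarMeasure]
    (χ : Fˣ →ₜ* Circle) (s : ℂ) : ℂ :=
  mellinInt μ (fourier ψ μ (H.exists_mellin_ne_zero μ χ⁻¹ (-s)).choose) χ (s - 1) /
    mellinInt μ (H.exists_mellin_ne_zero μ χ⁻¹ (-s)).choose χ⁻¹ (-s)

/-- The test function chosen to define the factor varies with `s`; the exchange formula `tate` shows
that the quotient does not depend on it. -/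
lemma gammaFactor_spec (hψ : Continuous ψ) {α : F → ℂ} (hα : α ∈ 𝒮) (χ : Fˣ →ₜ* Circle) {s : ℂ}
    (hs : s ∈ criticalStrip) :
    mellinInt μ (fourier ψ μ α) χ (s - 1) = H.gammaFactor μ χ s * mellinInt μ α χ⁻¹ (-s) := by
  have h := (H.exists_mellin_ne_zero μ χ⁻¹ (-s)).choose_spec
  have h1 := H.tate (μ := μ) hψ hα h.1.1 χ hs
  have h2 := h.2
  rw [gammaFactor]
  field_simp
  linear_combination h1

lemma isTateGamma (hψ : Continuous ψ) (χ : Fˣ →ₜ* Circle) :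
    IsTateGamma ψ μ 𝒮 χ (H.gammaFactor μ χ) := by
  intro s hs α hα
  have hs0 := hs.1
  have hs1 := hs.2
  exact ⟨(H.strongMellinDecay (H.fourier_mem μ _ hα)).mellinDecay.integrable χ
      (by simpa using hs0) (by simpa using hs1),
    (H.strongMellinDecay hα).mellinDecay.integrable χ⁻¹ (by simpa using hs1) (by simpa using hs0),
    H.gammaFactor_spec hψ hα χ hs⟩

/-- By inversion every test function `β` is a Fourier transform, so the left side of the functional
equation can be made nonzero. -/
lemma gammaFactor_ne_zero (hψ : Continuous ψ) (hμ : IsSelfDualMeasure ψ μ 𝒮) (χ : Fˣ →ₜ* Circle)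
    {s : ℂ} (hs : s ∈ criticalStrip) : H.gammaFactor μ χ s ≠ 0 := by
  obtain ⟨β, hβ, hne⟩ := H.exists_mellin_ne_zero μ χ (s - 1)
  have h1 := H.gammaFactor_spec (μ := μ) hψ (H.neg_mem (H.fourier_mem μ _ hβ.1)) χ hs
  have h2 : fourier ψ μ (fun x => fourier ψ μ β (-x)) = β := by
    ext y
    have h := fourier_comp_mul (ψ := ψ) (μ := μ) (t := -1) (by simp) (fourier ψ μ β) y
    simp only [neg_one_mul, modulus_neg, modulus_one, hμ.2 _ hβ.1] at h
    simpa [div_neg] using h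
  rw [h2] at h1
  intro h0
  rw [h0, zero_mul] at h1
  exact hne h1

lemma hasDerivAt_mellin_left {f : F → ℂ} (hf : StrongMellinDecay f) (χ : Fˣ →ₜ* Circle) {s : ℂ}
    (hs : s ∈ criticalStrip) :
    HasDerivAt (fun s => mellinInt μ f χ (s - 1)) (mellinInt μ (opA f) χ (s - 1)) s := by
  have hs0 := hs.1
  have hs1 := hs.2
  have h := hf.hasDerivAt (μ := μ) χ (z := s - 1) (by simpa using hs0) (by simpa using hs1)
  exact h.comp_sub_const s 1

lemma hasDerivAt_mellin_right {f : F → ℂ} (hf : StrongMellinDecay f) (χ : Fˣ →ₜ* Circle) {s : ℂ}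
    (hs : s ∈ criticalStrip) :
    HasDerivAt (fun s => mellinInt μ f χ (-s)) (-mellinInt μ (opA f) χ (-s)) s := by
  have hs0 := hs.1
  have hs1 := hs.2
  have h := hf.hasDerivAt (μ := μ) χ (z := -s) (by simpa using hs1) (by simpa using hs0)
  have h2 := HasDerivAt.comp s h (hasDerivAt_neg s)
  rwa [mul_neg_one] at h2

/-- One test function whose Mellin transform is nonzero at `s` serves on a neighbourhood, where the
factor is a quotient of differentiable functions. -/
lemma differentiableOn_gammaFactor (hψ : Continuous ψ) (χ : Fˣ →ₜ* Circle) :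
    DifferentiableOn ℂ (H.gammaFactor μ χ) criticalStrip := by
  intro s hs
  obtain ⟨β, hβ, hne⟩ := H.exists_mellin_ne_zero μ χ⁻¹ (-s)
  have h1 := hasDerivAt_mellin_left (μ := μ) (H.strongMellinDecay (H.fourier_mem μ _ hβ.1)) χ hs
  have h2 := hasDerivAt_mellin_right (μ := μ) (H.strongMellinDecay hβ.1) χ⁻¹ hs
  refine DifferentiableAt.differentiableWithinAt ?_
  refine (h1.differentiableAt.div h2.differentiableAt hne).congr_of_eventuallyEq ?_
  filter_upwards [isOpen_criticalStrip.mem_nhds hs, h2.continuousAt.eventually_ne hne] with w hw hw2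
  rw [Pi.div_apply, H.gammaFactor_spec hψ hβ.1 χ hw, mul_div_cancel_right₀ _ hw2]

/-- The conductor operator `A + B` has spectral function `Γ'/Γ`. -/
lemma mellin_conductor (hψ : Continuous ψ) (hψ1 : ψ ≠ 1) (hμ : IsSelfDualMeasure ψ μ 𝒮)
    {α : F → ℂ} (hα : α ∈ puncturedTestFunctions 𝒮) (χ : Fˣ →ₜ* Circle) {s : ℂ}
    (hs : s ∈ criticalStrip) :
    mellinInt μ (opB ψ μ α) χ⁻¹ (-s) + mellinInt μ (opA α) χ⁻¹ (-s) =
      logDeriv (H.gammaFactor μ χ) s * mellinInt μ α χ⁻¹ (-s) := by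
  obtain ⟨β, hβ, hne⟩ := H.exists_mellin_ne_zero μ χ⁻¹ (-s)
  have hΓ := H.gammaFactor_ne_zero hψ hμ χ hs
  have h1 := hasDerivAt_mellin_left (μ := μ) (H.strongMellinDecay (H.fourier_mem μ _ hα.1)) χ hs
  have hd := ((H.differentiableOn_gammaFactor (μ := μ) hψ χ).differentiableAt
    (isOpen_criticalStrip.mem_nhds hs)).hasDerivAt
  have h2 := hd.mul (hasDerivAt_mellin_right (μ := μ) (H.strongMellinDecay hα.1) χ⁻¹ hs)
  have h3 : (fun s => mellinInt μ (fourier ψ μ α) χ (s - 1)) =ᶠ[𝓝 s]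
      (H.gammaFactor μ χ * fun s => mellinInt μ α χ⁻¹ (-s)) := by
    filter_upwards [isOpen_criticalStrip.mem_nhds hs] with w hw
    exact H.gammaFactor_spec hψ hα.1 χ hw
  -- The differentiated functional equation. Its left side is the Mellin transform of `Aℱα`, which
  -- the functional equation for `Bα` expresses as `Γ` times that of `Bα`; it remains to divide by
  -- `Γ`.
  have h4 := h1.unique (h2.congr_of_eventuallyEq h3)
  have h5 := H.tate_opB hψ hψ1 hμ hα hβ.1 χ hs
  rw [H.gammaFactor_spec hψ hβ.1 χ hs] at h5
  have h6 : mellinInt μ (opA (fourier ψ μ α)) χ (s - 1) =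
      H.gammaFactor μ χ s * mellinInt μ (opB ψ μ α) χ⁻¹ (-s) := by
    refine mul_left_cancel₀ hne ?_
    linear_combination h5
  rw [h6] at h4
  rw [logDeriv_apply]
  field_simp
  linear_combination h4

/-- Add the derivative in `s` of the conductor identity for `α` to the conductor identity for `Aα`:
the terms with `A²α` and with `Γ'/Γ` times the transform of `Aα` cancel. -/
lemma mellin_commutator (hψ : Continuous ψ) (hψ1 : ψ ≠ 1) (hμ : IsSelfDualMeasure ψ μ 𝒮)
    {α : F → ℂ} (hα : α ∈ puncturedTestFunctions 𝒮) (χ : Fˣ →ₜ* Circle) {s : ℂ}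
    (hs : s ∈ criticalStrip) :
    mellinInt μ (opB ψ μ (opA α)) χ⁻¹ (-s) - mellinInt μ (opA (opB ψ μ α)) χ⁻¹ (-s) =
      deriv (logDeriv (H.gammaFactor μ χ)) s * mellinInt μ α χ⁻¹ (-s) := by
  have hAα := opA_mem_punctured H hα
  have hΓd := H.differentiableOn_gammaFactor (μ := μ) hψ χ
  have hd : DifferentiableAt ℂ (logDeriv (H.gammaFactor μ χ)) s := by
    have h1 := (hΓd.deriv isOpen_criticalStrip).differentiableAt (isOpen_criticalStrip.mem_nhds hs)
    have h2 := hΓd.differentiableAt (isOpen_criticalStrip.mem_nhds hs)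
    exact h1.div h2 (H.gammaFactor_ne_zero (μ := μ) hψ hμ χ hs)
  have h1 := (hasDerivAt_mellin_right (μ := μ)
    (H.strongMellinDecay_opB (μ := μ) hψ hψ1 hα) χ⁻¹ hs).add
    (hasDerivAt_mellin_right (μ := μ) (H.strongMellinDecay hAα.1) χ⁻¹ hs)
  have h2 := hd.hasDerivAt.mul
    (hasDerivAt_mellin_right (μ := μ) (H.strongMellinDecay hα.1) χ⁻¹ hs)
  have h3 : ((fun s => mellinInt μ (opB ψ μ α) χ⁻¹ (-s)) +
      fun s => mellinInt μ (opA α) χ⁻¹ (-s)) =ᶠ[𝓝 s]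
      (logDeriv (H.gammaFactor μ χ) * fun s => mellinInt μ α χ⁻¹ (-s)) := by
    filter_upwards [isOpen_criticalStrip.mem_nhds hs] with w hw
    exact H.mellin_conductor hψ hψ1 hμ hα χ hw
  have h4 := h1.unique (h2.congr_of_eventuallyEq h3)
  have h5 := H.mellin_conductor hψ hψ1 hμ hAα χ hs
  linear_combination h5 + h4

lemma conj_logFunctional (f : F → ℂ) :
    conj (logFunctional ψ μ f) = logFunctional ψ μ fun x => conj (f x) := by
  rw [logFunctional, ← integral_conj, ← integral_neg_eq_self]
  simp only [map_mul, Complex.conj_ofReal, conj_fourier, modulus_neg, neg_neg]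
  rfl

/-- Both `A` and `B` commute with complex conjugation, so only the factor `i` changes sign; hence
the `-i` in the spectral function. -/
lemma conj_opK (φ : F → ℂ) (x : F) : conj (opK ψ μ φ x) =
    -Complex.I * (opB ψ μ (opA fun x => conj (φ x)) x - opA (opB ψ μ fun x => conj (φ x)) x) := by
  simp only [opK, opA, opB_eq_logFunctional, map_mul, map_sub, Complex.conj_I, conj_logFunctional,
    Complex.conj_ofReal]

lemma mellin_opK (hψ : Continuous ψ) (hψ1 : ψ ≠ 1) (hμ : IsSelfDualMeasure ψ μ 𝒮)
    {φ : F → ℂ} (hφ : φ ∈ puncturedTestFunctions 𝒮) (χ : Fˣ →ₜ* Circle) {s : ℂ}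
    (hs : s ∈ criticalStrip) :
    Integrable (fun x => conj (opK ψ μ φ x) * quasiChar χ⁻¹ (-s) x) μ ∧
      ∫ x, conj (opK ψ μ φ x) * quasiChar χ⁻¹ (-s) x ∂μ =
        spectralFunction (H.gammaFactor μ χ) s *
          ∫ x, conj (φ x) * quasiChar χ⁻¹ (-s) x ∂μ := by
  have hs0 := hs.1
  have hs1 := hs.2
  have hα := H.conj_mem_punctured hφ
  have hi1 := (H.strongMellinDecay_opB (μ := μ) hψ hψ1
    (opA_mem_punctured H hα)).mellinDecay.integrable (μ := μ) χ⁻¹ (z := -s) (by simpa using hs1)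
    (by simpa using hs0)
  have hi2 := (H.strongMellinDecay_opB (μ := μ) hψ hψ1 hα).opA.integrable (μ := μ) χ⁻¹ (z := -s)
    (by simpa using hs1) (by simpa using hs0)
  have e : (fun x => conj (opK ψ μ φ x) * quasiChar χ⁻¹ (-s) x) = fun x => -Complex.I *
      (opB ψ μ (opA fun x => conj (φ x)) x * quasiChar χ⁻¹ (-s) x -
        opA (opB ψ μ fun x => conj (φ x)) x * quasiChar χ⁻¹ (-s) x) := by
    ext x; rw [conj_opK]; ring
  rw [e]
  refine ⟨(hi1.sub hi2).const_mul _, ?_⟩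
  rw [integral_const_mul, integral_sub hi1 hi2, spectralFunction, mul_assoc]
  exact congrArg _ (H.mellin_commutator hψ hψ1 hμ hα χ hs)

end SchwartzBruhatLike

/-- Young's inequality in L¹ with weight `|x| ^ (-1/2)`. This weight is the absolute value of
`χ⁻¹|x|^{-s}` on the critical line, and the unitary dilations are isometric for it too. -/
lemma lintegral_convolution_le {κ φ k : F → ℂ} (hκ : Measurable κ) (hφ : Measurable φ)
    (hk : ∀ x, x ≠ 0 → k x =
      ∫ t, κ t * (((Real.sqrt (modulus t))⁻¹ : ℂ) * φ (x / t)) ∂(multHaar μ)) :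
    ∫⁻ x, ‖k x‖ₑ * ENNReal.ofReal (modulus x ^ (-(1 / 2) : ℝ)) ∂μ ≤
      (∫⁻ t, ‖κ t‖ₑ ∂(multHaar μ)) *
        ∫⁻ x, ‖φ x‖ₑ * ENNReal.ofReal (modulus x ^ (-(1 / 2) : ℝ)) ∂μ := by
  have hp : Measurable fun x : F => ENNReal.ofReal (modulus x ^ (-(1 / 2) : ℝ)) :=
    (measurable_modulus.pow_const _).ennreal_ofReal
  have hs : Measurable fun t : F => ((Real.sqrt (modulus t))⁻¹ : ℂ) :=
    (Complex.measurable_ofReal.comp (Real.continuous_sqrt.measurable.comp measurable_modulus)).inv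
  set Φ : F → F → ENNReal := fun x t => ‖κ t * (((Real.sqrt (modulus t))⁻¹ : ℂ) * φ (x / t))‖ₑ *
    ENNReal.ofReal (modulus x ^ (-(1 / 2) : ℝ)) with hΦ
  have hΦm : Measurable (Function.uncurry Φ) :=
    ((hκ.comp measurable_snd).mul ((hs.comp measurable_snd).mul
      (hφ.comp (measurable_fst.div measurable_snd)))).enorm.mul (hp.comp measurable_fst)
  calc ∫⁻ x, ‖k x‖ₑ * ENNReal.ofReal (modulus x ^ (-(1 / 2) : ℝ)) ∂μ
      ≤ ∫⁻ x, ∫⁻ t, Φ x t ∂(multHaar μ) ∂μ := by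
        refine lintegral_mono_ae ?_
        filter_upwards [ae_ne_zero μ] with x hx
        simp only [hΦ]
        rw [lintegral_mul_const' _ _ ENNReal.ofReal_ne_top, hk x hx]
        gcongr
        exact enorm_integral_le_lintegral_enorm _
    _ = ∫⁻ t, ∫⁻ x, Φ x t ∂μ ∂(multHaar μ) := lintegral_lintegral_swap hΦm.aemeasurable
    _ = ∫⁻ t, ‖κ t‖ₑ *
          ∫⁻ x, ‖φ x‖ₑ * ENNReal.ofReal (modulus x ^ (-(1 / 2) : ℝ)) ∂μ ∂(multHaar μ) := by
        refine lintegral_congr_ae ?_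
        filter_upwards [multHaar_ae_ne_zero μ] with t ht
        have htp := modulus_pos ht
        have h1 := lintegral_comp_mul_left μ (inv_ne_zero ht)
          (fun x => ‖φ x‖ₑ * ENNReal.ofReal (modulus x ^ (-(1 / 2) : ℝ)))
        have hsq : Real.sqrt (modulus t) = modulus t ^ (1 / 2 : ℝ) := Real.sqrt_eq_rpow _
        have e : ∀ x, Φ x t = ‖κ t‖ₑ * ENNReal.ofReal (modulus t)⁻¹ *
            (‖φ (t⁻¹ * x)‖ₑ * ENNReal.ofReal (modulus (t⁻¹ * x) ^ (-(1 / 2) : ℝ))) := by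
          intro x
          have e1 : ‖((Real.sqrt (modulus t))⁻¹ : ℂ)‖ₑ =
              ENNReal.ofReal (modulus t ^ (-(1 / 2) : ℝ)) := by
            rw [← ofReal_norm, norm_inv, Complex.norm_real,
              Real.norm_of_nonneg (Real.sqrt_nonneg _), hsq, Real.rpow_neg htp.le]
          have e2 : ENNReal.ofReal (modulus t ^ (-(1 / 2) : ℝ)) *
              ENNReal.ofReal (modulus x ^ (-(1 / 2) : ℝ)) = ENNReal.ofReal (modulus t)⁻¹ *
              ENNReal.ofReal (modulus (t⁻¹ * x) ^ (-(1 / 2) : ℝ)) := by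
            rw [← ENNReal.ofReal_mul (by positivity), ← ENNReal.ofReal_mul (by positivity),
              modulus_mul, modulus_inv, Real.mul_rpow (by positivity) (modulus_nonneg x),
              Real.inv_rpow htp.le, ← mul_assoc, Real.rpow_neg htp.le, inv_inv,
              ← Real.rpow_neg_one (modulus t), ← Real.rpow_neg htp.le, ← Real.rpow_add htp]
            norm_num
          simp only [hΦ, enorm_mul, e1, div_eq_inv_mul]
          calc _ = ‖κ t‖ₑ * ‖φ (t⁻¹ * x)‖ₑ * (ENNReal.ofReal (modulus t ^ (-(1 / 2) : ℝ)) *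
              ENNReal.ofReal (modulus x ^ (-(1 / 2) : ℝ))) := by ring_nf
            _ = _ := by rw [e2]; ring_nf
        simp only [e]
        rw [lintegral_const_mul' _ _ (ENNReal.mul_ne_top enorm_ne_top ENNReal.ofReal_ne_top), h1,
          modulus_inv, inv_inv, mul_assoc, ← mul_assoc (ENNReal.ofReal (modulus t)⁻¹),
          ← ENNReal.ofReal_mul (by positivity), inv_mul_cancel₀ htp.ne']
        simp
    _ = _ := lintegral_mul_const _ hκ.enorm

lemma SchwartzBruhatLike.spectralFunction_bounded (H : SchwartzBruhatLike ψ 𝒮)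
    (hψ : Continuous ψ) (hψ1 : ψ ≠ 1) (hμ : IsSelfDualMeasure ψ μ 𝒮) {c : ℝ}
    (hc : ∀ φ ∈ 𝒮, φ 0 = 0 → logFunctional ψ μ φ = c * ∫ x, φ x ∂(multHaar μ)) :
    ∃ C : ℝ, ∀ χ, ∀ s : ℂ, s.re = 1 / 2 → ‖spectralFunction (H.gammaFactor μ χ) s‖ ≤ C := by
  set κ : F → ℂ := fun t => -Complex.I * c * logKernel t with hκ
  have hκm : Measurable κ := (Complex.measurable_ofReal.comp measurable_logKernel).const_mul _
  have hκi : Integrable κ (multHaar μ) := ((integrable_logKernel H).ofReal).const_mul _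
  set N := ∫ t, ‖κ t‖ ∂(multHaar μ) with hN
  have hN0 : 0 ≤ N := integral_nonneg fun t => norm_nonneg _
  -- For the adapted bump, of integral `I₀`, the eigenvalue identity gives a product at least `I₀/2`
  -- times the eigenvalue and at most `N · 2I₀`.
  refine ⟨4 * N, fun χ s hs => ?_⟩
  have hstrip : s ∈ criticalStrip := by
    constructor <;> rw [hs] <;> norm_num
  obtain ⟨r, hr, hpos, hlow, hri, hup⟩ := H.exists_bump_mellin (μ := μ) χ⁻¹ (-s)
  set ρ : F → ℂ := fun x => r x with hρ
  have hconj : (fun x => conj (ρ x)) = ρ := by ext x; simp [hρ]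
  obtain ⟨hi, he⟩ := H.mellin_opK hψ hψ1 hμ hr χ hstrip
  simp only [hρ, Complex.conj_ofReal] at he
  have hqn : ∀ x : F, x ≠ 0 → ‖quasiChar χ⁻¹ (-s) x‖ₑ =
      ENNReal.ofReal (modulus x ^ (-(1 / 2) : ℝ)) := by
    intro x hx
    rw [← ofReal_norm, norm_quasiChar _ _ hx, Complex.neg_re, hs]
  have h1 := lintegral_convolution_le (μ := μ) hκm (H.measurable hr.1)
    (fun x hx => opK_eq_integral H hψ hc hr hx)
  have h2 : ∀ f : F → ℂ, ∫⁻ x, ‖f x‖ₑ * ENNReal.ofReal (modulus x ^ (-(1 / 2) : ℝ)) ∂μ =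
      ∫⁻ x, ‖f x * quasiChar χ⁻¹ (-s) x‖ₑ ∂μ := by
    intro f
    refine lintegral_congr_ae ?_
    filter_upwards [ae_ne_zero μ] with x hx
    rw [enorm_mul, hqn x hx]
  rw [h2, h2, ← ofReal_integral_norm_eq_lintegral_enorm hκi,
    ← ofReal_integral_norm_eq_lintegral_enorm hri, ← ENNReal.ofReal_mul hN0] at h1
  have h3 : ‖∫ x, conj (opK ψ μ ρ x) * quasiChar χ⁻¹ (-s) x ∂μ‖ ≤
      N * ∫ x, ‖(r x : ℂ) * quasiChar χ⁻¹ (-s) x‖ ∂μ := by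
    refine (norm_integral_le_integral_norm _).trans ?_
    rw [integral_norm_eq_lintegral_enorm hi.aestronglyMeasurable]
    refine ENNReal.toReal_le_of_le_ofReal (by positivity) (le_trans (le_of_eq ?_) h1)
    refine lintegral_congr fun x => ?_
    rw [enorm_mul, enorm_mul]
    congr 1
    rw [← ofReal_norm, ← ofReal_norm, RCLike.norm_conj]
  have h4 := congrArg norm he
  rw [norm_mul] at h4
  change ‖∫ x, conj (opK ψ μ ρ x) * quasiChar χ⁻¹ (-s) x ∂μ‖ =
    _ * ‖mellinInt μ (fun x => (r x : ℂ)) χ⁻¹ (-s)‖ at h4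
  rw [h4] at h3
  set I₀ := ∫ x, r x ∂μ
  have h5 : ‖spectralFunction (H.gammaFactor μ χ) s‖ * (I₀ / 2) ≤ N * (2 * I₀) :=
    (mul_le_mul_of_nonneg_left hlow (norm_nonneg _)).trans
      (h3.trans (mul_le_mul_of_nonneg_left hup hN0))
  nlinarith

/-- The theorem on the commutator operator, for a Schwartz-Bruhat-like space. -/
theorem SchwartzBruhatLike.commutator_theorem (H : SchwartzBruhatLike ψ 𝒮)
    (hψ : Continuous ψ) (hψ1 : ψ ≠ 1) (hμ : IsSelfDualMeasure ψ μ 𝒮) :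
    (∀ φ ∈ 𝒮, Integrable (fourierInv ψ μ φ) μ ∧ Integrable (opA (fourierInv ψ μ φ)) μ) ∧
      (∀ φ ∈ puncturedTestFunctions 𝒮, opA φ ∈ puncturedTestFunctions 𝒮) ∧
      ∃ T : Lp ℂ 2 μ →ₗ.[ℂ] Lp ℂ 2 μ, IsCommutatorOperator ψ μ 𝒮 T ∧
        IsEssentiallySelfAdjoint T ∧
        ∃ Kb : Lp ℂ 2 μ →L[ℂ] Lp ℂ 2 μ,
          T.closure = (Kb : Lp ℂ 2 μ →ₗ[ℂ] Lp ℂ 2 μ).toPMap ⊤ ∧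
          (∀ t : Fˣ, ∃ U : Lp ℂ 2 μ ≃ₗᵢ[ℂ] Lp ℂ 2 μ,
            (∀ f : Lp ℂ 2 μ, U f =ᵐ[μ] dilation t f) ∧
            ∀ f, Kb (U f) = U (Kb f)) ∧
          (∃ 𝓕 : Lp ℂ 2 μ ≃ₗᵢ[ℂ] Lp ℂ 2 μ,
            (∀ φ ∈ 𝒮, ∀ f : Lp ℂ 2 μ, f =ᵐ[μ] φ → 𝓕 f =ᵐ[μ] fourier ψ μ φ) ∧
            ∀ f, Kb (𝓕 f) = -𝓕 (Kb f)) ∧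
          (∃ I : Lp ℂ 2 μ ≃ₗᵢ[ℂ] Lp ℂ 2 μ,
            (∀ f : Lp ℂ 2 μ, I f =ᵐ[μ] inversion f) ∧
            ∀ f, Kb (I f) = -I (Kb f)) ∧
          ∃ Γ : (Fˣ →ₜ* Circle) → ℂ → ℂ,
            (∀ χ, IsTateGamma ψ μ 𝒮 χ (Γ χ) ∧ DifferentiableOn ℂ (Γ χ) criticalStrip ∧
              ∀ s ∈ criticalStrip, Γ χ s ≠ 0) ∧
            (∀ χ, ∀ s ∈ criticalStrip, ∀ φ ∈ puncturedTestFunctions 𝒮,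
              Integrable (fun x => conj (opK ψ μ φ x) * quasiChar χ⁻¹ (-s) x) μ ∧
              ∫ x, conj (opK ψ μ φ x) * quasiChar χ⁻¹ (-s) x ∂μ =
                spectralFunction (Γ χ) s * ∫ x, conj (φ x) * quasiChar χ⁻¹ (-s) x ∂μ) ∧
            ∃ C : ℝ, ∀ χ, ∀ s : ℂ, s.re = 1 / 2 → ‖spectralFunction (Γ χ) s‖ ≤ C := by
  obtain ⟨c, hc⟩ := exists_logFunctional (μ := μ) H hψ hψ1
  set κ : F → ℂ := fun t => -Complex.I * c * logKernel t with hκ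
  have hκm : Measurable κ := (Complex.measurable_ofReal.comp measurable_logKernel).const_mul _
  have hκi : Integrable κ (multHaar μ) := ((integrable_logKernel H).ofReal).const_mul _
  have hκinv : ∀ t, t ≠ 0 → κ t⁻¹ = -κ t := by
    intro t ht
    simp only [hκ, logKernel_inv ht]
    push_cast; ring
  -- Since `c` is real, `κ` is purely imaginary, and conjugation undoes the sign from inversion.
  have hκconj : ∀ t, t ≠ 0 → conj (κ t⁻¹) = κ t := by
    intro t ht
    rw [hκinv t ht]
    simp [hκ]
  obtain ⟨K, hK⟩ := exists_convolution hκi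
  have hdense := H.dense_initialDomain (μ := μ)
  refine ⟨fun φ hφ => ?_, fun φ hφ => opA_mem_punctured H hφ,
    (K : Lp ℂ 2 μ →ₗ[ℂ] Lp ℂ 2 μ).toPMap (H.initialDomain μ), ⟨fun f => Iff.rfl, ?_⟩,
    isEssentiallySelfAdjoint_toPMap K (hK.adjoint_eq hκconj) hdense, K,
    (closure_toPMap_of_dense K hdense).2, fun t => ⟨dilationL2 μ t, dilationL2_coe μ t,
      hK.commute _ fun s f => dilationL2_comm μ s t f⟩,
    ⟨H.fourierL2 hψ hμ, fun φ hφ f hf => H.fourierL2_coe hψ hμ hφ hf,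
      hK.anticommute hκinv _ (H.dilationL2_fourierL2 hψ hμ)⟩,
    ⟨inversionL2 μ, inversionL2_coe μ, hK.anticommute hκinv _ (dilationL2_inversionL2 μ)⟩,
    H.gammaFactor μ, fun χ => ⟨H.isTateGamma hψ χ, H.differentiableOn_gammaFactor hψ χ,
      fun s hs => H.gammaFactor_ne_zero hψ hμ χ hs⟩,
    fun χ s hs φ hφ => H.mellin_opK hψ hψ1 hμ hφ χ hs, H.spectralFunction_bounded hψ hψ1 hμ hc⟩
  · have h := H.neg_mem (H.fourier_mem μ _ hφ)
    exact ⟨H.integrable h, integrable_log_fourier H h⟩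
  · intro f φ hφ hf
    refine (hK.coe_ae hκi hκm f).trans ?_
    filter_upwards [ae_ne_zero μ] with x hx
    rw [opK_eq_integral H hψ hc hφ hx]
    refine integral_congr_ae ?_
    have h0 : ∀ᵐ t ∂(multHaar μ), (f : Lp ℂ 2 μ) t = φ t :=
      (multHaar_absolutelyContinuous μ).ae_le hf
    have h1 := (measurePreserving_div μ hx).quasiMeasurePreserving.tendsto_ae.eventually h0
    filter_upwards [h1] with t ht
    rw [ht]

end Gamma

/-! ### Non-archimedean fields -/

/-- The circle has no small subgroups: while the powers stay within `1/2` of `1`, `w² - 1 = (w +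
1)(w - 1)` with `|w + 1| ≥ 3/2`, so each squaring multiplies the distance to `1` by at least `3/2`.
-/
lemma Circle.eq_one_of_pow_near_one {z : Circle}
    (h : ∀ n : ℕ, ‖((z ^ 2 ^ n : Circle) : ℂ) - 1‖ ≤ 1 / 2) : z = 1 := by
  have key : ∀ n : ℕ, (3 / 2 : ℝ) ^ n * ‖(z : ℂ) - 1‖ ≤ ‖((z ^ 2 ^ n : Circle) : ℂ) - 1‖ := by
    intro n
    induction n with
    | zero => simp
    | succ n ih =>
      set w : ℂ := ((z ^ 2 ^ n : Circle) : ℂ) with hw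
      have h1 : ((z ^ 2 ^ (n + 1) : Circle) : ℂ) - 1 = (w + 1) * (w - 1) := by
        rw [hw, pow_succ, pow_mul, Circle.coe_pow _ 2]; ring
      have h2 : 3 / 2 ≤ ‖w + 1‖ := by
        have h3 := norm_sub_norm_le (2 : ℂ) (1 - w)
        have h4 : (2 : ℂ) - (1 - w) = w + 1 := by ring
        rw [h4, norm_sub_rev] at h3
        have h5 := h n
        have h6 : ‖(2 : ℂ)‖ = 2 := by simp
        rw [h6] at h3
        linarith
      rw [h1, norm_mul, pow_succ]
      calc (3 / 2 : ℝ) ^ n * (3 / 2) * ‖(z : ℂ) - 1‖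
          = 3 / 2 * ((3 / 2 : ℝ) ^ n * ‖(z : ℂ) - 1‖) := by ring
        _ ≤ _ := by gcongr
  by_contra hz
  have hpos : 0 < ‖(z : ℂ) - 1‖ := by
    rw [norm_pos_iff, sub_ne_zero]
    exact fun h => hz (Circle.ext h)
  obtain ⟨n, hn⟩ := pow_unbounded_of_one_lt (1 / 2 / ‖(z : ℂ) - 1‖) (by norm_num : (1 : ℝ) < 3 / 2)
  rw [div_lt_iff₀ hpos] at hn
  linarith [key n, h n]

section Nonarchimedean

variable {F : Type} [NontriviallyNormedField F] [IsUltrametricDist F]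

lemma exists_ball_char_eq_one {ψ : AddChar F Circle} (hψ : Continuous ψ) :
    ∃ δ > 0, ∀ x : F, ‖x‖ < δ → ψ x = 1 := by
  have hc : Continuous fun x => (ψ x : ℂ) := by fun_prop
  obtain ⟨δ, hδ, h⟩ := Metric.continuousAt_iff.1 (hc.continuousAt (x := (0 : F))) (1 / 2) (by norm_num)
  refine ⟨δ, hδ, fun x hx => Circle.eq_one_of_pow_near_one fun n => ?_⟩
  have h1 : ‖(2 ^ n : ℕ) • x‖ ≤ ‖x‖ := by
    rw [nsmul_eq_mul, norm_mul]
    exact mul_le_of_le_one_left (norm_nonneg _) (IsUltrametricDist.norm_natCast_le_one F _)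
  have h2 := @h ((2 ^ n : ℕ) • x) (by rw [dist_zero_right]; exact h1.trans_lt hx)
  rw [AddChar.map_zero_eq_one, AddChar.map_nsmul_eq_pow, dist_eq_norm, Circle.coe_one] at h2
  exact h2.le

/-- A Lebesgue number for the cover of the compact support by the open fibres of `φ`. -/
lemma exists_ball_translate_eq {φ : F → ℂ} (h : IsLocallyConstant φ) (hc : HasCompactSupport φ) :
    ∃ δ > 0, ∀ x a : F, ‖a‖ < δ → φ (x + a) = φ x := by
  obtain ⟨δ, hδ, hcov⟩ := lebesgue_number_lemma_of_metric (s := tsupport φ)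
    (c := fun c : ℂ => φ ⁻¹' {c}) hc (fun c => h.isOpen_fiber c) (fun x _ => by simp)
  have key : ∀ x ∈ tsupport φ, ∀ y, ‖y - x‖ < δ → φ y = φ x := by
    intro x hx y hy
    obtain ⟨c, hsub⟩ := hcov x hx
    have h1 : φ x = c := hsub (Metric.mem_ball_self hδ)
    have h2 : φ y = c := hsub (by rwa [Metric.mem_ball, dist_eq_norm])
    rw [h1, h2]
  refine ⟨δ, hδ, fun x a ha => ?_⟩
  by_cases hx : x ∈ tsupport φ
  · exact key x hx _ (by simpa using ha)
  by_cases hxa : x + a ∈ tsupport φ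
  · exact (key _ hxa x (by simpa using ha)).symm
  · rw [image_eq_zero_of_notMem_tsupport hx, image_eq_zero_of_notMem_tsupport hxa]

lemma isClopen_thickening (s : Set F) {r : ℝ} : IsClopen (Metric.thickening r s) := by
  refine ⟨⟨?_⟩, Metric.isOpen_thickening⟩
  rw [Metric.isOpen_iff]
  intro y hy
  rcases le_or_gt r 0 with hr | hr
  · refine ⟨1, one_pos, ?_⟩
    rw [Metric.thickening_of_nonpos hr]
    simp
  refine ⟨r, hr, fun z hz hzs => hy ?_⟩
  rw [Metric.mem_thickening_iff] at hzs ⊢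
  obtain ⟨p, hp, hzp⟩ := hzs
  refine ⟨p, hp, (dist_triangle_max y z p).trans_lt (max_lt ?_ hzp)⟩
  rwa [dist_comm]

lemma isLocallyConstant_indicator {s : Set F} (hs : IsClopen s) (c : ℂ) :
    IsLocallyConstant (s.indicator fun _ => c) := by
  rw [IsLocallyConstant.iff_eventually_eq]
  intro x
  by_cases hx : x ∈ s
  · filter_upwards [hs.isOpen.mem_nhds hx] with y hy
    rw [Set.indicator_of_mem hx, Set.indicator_of_mem hy]
  · filter_upwards [hs.compl.isOpen.mem_nhds hx] with y hy
    rw [Set.indicator_of_notMem hx, Set.indicator_of_notMem hy]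

variable [ProperSpace F]

variable (F) in
/-- The locally constant functions with compact support. -/
def locallyConstantSpace : Set (F → ℂ) := {φ | IsLocallyConstant φ ∧ HasCompactSupport φ}

lemma indicator_mem_punctured {s : Set F} (hs : IsClopen s) (hb : Bornology.IsBounded s)
    (h0 : (0 : F) ∉ s) :
    (s.indicator fun _ => (1 : ℂ)) ∈ puncturedTestFunctions (locallyConstantSpace F) := by
  have hc : HasCompactSupport (s.indicator fun _ => (1 : ℂ)) :=
    HasCompactSupport.of_support_subset_isCompact
      (Metric.isCompact_of_isClosed_isBounded hs.isClosed hb) Set.support_indicator_subset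
  refine ⟨⟨isLocallyConstant_indicator hs 1, hc⟩, hc, ?_⟩
  filter_upwards [hs.compl.isOpen.mem_nhds h0] with y hy
  exact Set.indicator_of_notMem hy _

lemma modulus_eq_of_norm_sub_lt {x y : F} (h : ‖y - x‖ < ‖x‖) : modulus y = modulus x := by
  have h1 : ‖y‖ = ‖x‖ := by
    have := IsUltrametricDist.norm_add_eq_max_of_norm_ne_norm h.ne
    rwa [sub_add_cancel, max_eq_right h.le] at this
  exact le_antisymm (modulus_le_of_norm_le h1.le) (modulus_le_of_norm_le h1.ge)

variable [MeasurableSpace F] [BorelSpace F]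

/-- The two properties are exchanged: compact support of `φ` and triviality of `ψ` near `0` make the
transform locally constant, while invariance of `φ` under small translations `a` forces `ℱφ(y) = 0`
unless `ψ(ay) = 1`. For large `y` the choice `a = x₀/y` with `ψ(x₀) ≠ 1` is small enough. -/
lemma fourier_mem_locallyConstantSpace {ψ : AddChar F Circle} (hψ : Continuous ψ) (hψ1 : ψ ≠ 1)
    (μ : Measure F) [μ.IsAddHaarMeasure] {φ : F → ℂ} (hφ : φ ∈ locallyConstantSpace F) :
    fourier ψ μ φ ∈ locallyConstantSpace F := by
  obtain ⟨hl, hc⟩ := hφ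
  constructor
  · rw [IsLocallyConstant.iff_eventually_eq]
    intro y
    obtain ⟨δ, hδ, hψδ⟩ := exists_ball_char_eq_one hψ
    obtain ⟨R, hR⟩ := hc.isBounded.exists_norm_le
    have hR1 : 0 < max R 1 := lt_max_of_lt_right one_pos
    filter_upwards [Metric.ball_mem_nhds y (div_pos hδ hR1)] with z hz
    rw [Metric.mem_ball, dist_eq_norm, lt_div_iff₀ hR1] at hz
    rw [fourier_apply, fourier_apply]
    congr 1 with x
    by_cases hx : x ∈ tsupport φ
    · have h1 : -(x * z) = -(x * y) + (-(x * (z - y))) := by ring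
      rw [h1, AddChar.map_add_eq_mul, hψδ (-(x * (z - y))), mul_one]
      rw [norm_neg, norm_mul, mul_comm]
      exact (mul_le_mul_of_nonneg_left ((hR x hx).trans (le_max_left _ _))
        (norm_nonneg _)).trans_lt hz
    · rw [image_eq_zero_of_notMem_tsupport hx, mul_zero, mul_zero]
  · obtain ⟨δ, hδ, htr⟩ := exists_ball_translate_eq hl hc
    obtain ⟨x₀, hx₀⟩ : ∃ x₀, ψ x₀ ≠ 1 := by
      by_contra! h
      exact hψ1 (by ext x; simp [h x])
    refine HasCompactSupport.of_support_subset_isCompact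
      (isCompact_closedBall (0 : F) (‖x₀‖ / δ)) fun y hy => ?_
    rw [mem_closedBall_zero_iff]
    by_contra! hlt
    have hy0 : y ≠ 0 := by
      rintro rfl
      rw [norm_zero] at hlt
      exact absurd hlt (not_lt.2 (by positivity))
    have ha : ‖x₀ / y‖ < δ := by
      rw [norm_div, div_lt_iff₀ (norm_pos_iff.2 hy0), mul_comm]
      rwa [div_lt_iff₀ hδ] at hlt
    have h1 := fourier_comp_add (ψ := ψ) (μ := μ) (x₀ / y) φ y
    have h2 : (fun x => φ (x + x₀ / y)) = φ := by ext x; exact htr x _ ha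
    rw [h2, div_mul_cancel₀ _ hy0] at h1
    have h3 : (ψ x₀ : ℂ) = 1 := mul_right_cancel₀ hy (by rw [one_mul]; exact h1.symm)
    exact hx₀ (Circle.ext h3)

/-- Up to the null set `{0}`, a compact set is the limit of its clopen thickenings with a small ball
at the origin removed, whose indicators are admissible test functions; dominated convergence
concludes. -/
lemma ae_eq_zero_of_integral_clopen (μ : Measure F) [μ.IsAddHaarMeasure] {f : F → ℂ}
    (hf : LocallyIntegrable f μ)
    (h : ∀ φ ∈ puncturedTestFunctions (locallyConstantSpace F), ∫ x, φ x * f x ∂μ = 0) :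
    f =ᵐ[μ] 0 := by
  refine ae_eq_zero_of_forall_setIntegral_isCompact_eq_zero' hf fun s hs => ?_
  set u : ℕ → ℝ := fun n => 1 / ((n : ℝ) + 1) with hu
  have hu0 : ∀ n, 0 < u n := fun n => Nat.one_div_pos_of_nat
  have hu1 : ∀ n, u n ≤ 1 := fun n => by
    rw [hu]; exact (div_le_one (by positivity)).2 (by linarith [(n.cast_nonneg : (0 : ℝ) ≤ n)])
  have hulim : Filter.Tendsto u Filter.atTop (𝓝 0) := tendsto_one_div_add_atTop_nhds_zero_nat
  set t : ℕ → Set F := fun n => Metric.thickening (u n) s \ Metric.ball 0 (u n) with ht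
  have hz : ∀ n, ∫ x, (t n).indicator f x ∂μ = 0 := by
    intro n
    have hcl : IsClopen (t n) :=
      (isClopen_thickening s).diff (IsUltrametricDist.isClopen_ball 0 (u n))
    have h1 := h _ (indicator_mem_punctured hcl ((hs.isBounded.thickening).subset Set.sdiff_subset)
      (fun h0 => h0.2 (Metric.mem_ball_self (hu0 n))))
    rw [← h1]
    congr 1 with x
    by_cases hx : x ∈ t n <;> simp [hx]
  have hbd : IntegrableOn f (Metric.cthickening 1 s) μ :=
    hf.integrableOn_isCompact hs.cthickening
  have hlim : Filter.Tendsto (fun n => ∫ x, (t n).indicator f x ∂μ) Filter.atTop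
      (𝓝 (∫ x, s.indicator f x ∂μ)) := by
    refine tendsto_integral_of_dominated_convergence
      (fun x => ‖(Metric.cthickening 1 s).indicator f x‖) (fun n => ?_) ?_ (fun n => ?_) ?_
    · exact hf.aestronglyMeasurable.indicator
        (Metric.isOpen_thickening.measurableSet.diff Metric.isOpen_ball.measurableSet)
    · exact ((integrable_indicator_iff Metric.isClosed_cthickening.measurableSet).2 hbd).norm
    · refine Filter.Eventually.of_forall fun x => norm_indicator_le_of_subset ?_ f x
      exact Set.sdiff_subset.trans
        ((Metric.thickening_mono (hu1 n) s).trans (Metric.thickening_subset_cthickening 1 s))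
    · filter_upwards [ae_ne_zero μ] with x hx
      refine tendsto_const_nhds.congr' ?_
      by_cases hxs : x ∈ s
      · filter_upwards [hulim.eventually (gt_mem_nhds (norm_pos_iff.2 hx))] with n hn
        have : x ∈ t n := ⟨Metric.self_subset_thickening (hu0 n) s hxs, fun hb => by
          rw [mem_ball_zero_iff] at hb
          linarith⟩
        rw [Set.indicator_of_mem hxs, Set.indicator_of_mem this]
      · obtain ⟨ε, hε, hball⟩ := Metric.isOpen_iff.1 hs.isClosed.isOpen_compl x hxs
        filter_upwards [hulim.eventually (gt_mem_nhds hε)] with n hn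
        have : x ∉ t n := fun hb => by
          obtain ⟨p, hp, hxp⟩ := Metric.mem_thickening_iff.1 hb.1
          have hpb : p ∈ Metric.ball x ε := by
            rw [Metric.mem_ball, dist_comm]
            linarith
          exact hball hpb hp
        rw [Set.indicator_of_notMem hxs, Set.indicator_of_notMem this]
  rw [← integral_indicator hs.isClosed.measurableSet]
  refine tendsto_nhds_unique hlim ?_
  simp only [hz]
  exact tendsto_const_nhds

theorem schwartzBruhatLike_nonarchimedean {ψ : AddChar F Circle} (hψ : Continuous ψ)
    (hψ1 : ψ ≠ 1) : SchwartzBruhatLike ψ (locallyConstantSpace F) where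
  add_mem φ hφ η hη := ⟨hφ.1.add hη.1, hφ.2.add hη.2⟩
  smul_mem c φ hφ := ⟨hφ.1.comp (c * ·), hφ.2.mul_left⟩
  translate_mem a φ hφ := ⟨hφ.1.comp_continuous (continuous_add_const a),
    hφ.2.comp_homeomorph (Homeomorph.addRight a)⟩
  dilate_mem t ht φ hφ := ⟨hφ.1.comp_continuous (continuous_const_mul t),
    hφ.2.comp_homeomorph (Homeomorph.mulLeft₀ t ht)⟩
  conj_mem φ hφ := ⟨hφ.1.comp conj, hφ.2.comp_left (map_zero _)⟩
  continuous φ hφ := hφ.1.continuous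
  decay φ hφ := by
    have hc : Continuous fun x => φ x * ((1 + modulus x) ^ 2 : ℝ) :=
      hφ.1.continuous.mul (Complex.continuous_ofReal.comp
        ((continuous_const.add continuous_modulus).pow 2))
    obtain ⟨C, hC⟩ := (hφ.2.mul_right (f' := fun x => (((1 + modulus x) ^ 2 : ℝ) : ℂ))
      ).exists_bound_of_continuous hc
    refine ⟨C, fun x => ?_⟩
    have h := hC x
    rwa [Pi.mul_apply, norm_mul, Complex.norm_real, Real.norm_of_nonneg (by positivity)] at h
  holder φ hφ := by
    obtain ⟨C, hC⟩ := hφ.2.exists_bound_of_continuous hφ.1.continuous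
    obtain ⟨δ, hδ, hd⟩ := exists_ball_translate_eq hφ.1 hφ.2
    obtain ⟨t, ht0, ht⟩ := exists_small F δ hδ
    have hC0 : 0 ≤ C := (norm_nonneg _).trans (hC 0)
    have hm := Real.rpow_pos_of_pos (modulus_pos ht0) (1 / 2 : ℝ)
    refine ⟨2 * C / modulus t ^ (1 / 2 : ℝ), fun x => ?_⟩
    rcases lt_or_ge ‖x‖ δ with hx | hx
    · have h := hd 0 x hx
      rw [zero_add] at h
      rw [h, sub_self, norm_zero]
      have := Real.rpow_nonneg (modulus_nonneg x) (1 / 2 : ℝ)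
      positivity
    · have h1 : modulus t ^ (1 / 2 : ℝ) ≤ modulus x ^ (1 / 2 : ℝ) :=
        Real.rpow_le_rpow (modulus_nonneg _) (modulus_le_of_norm_le (ht.le.trans hx))
          (by norm_num)
      calc ‖φ x - φ 0‖ ≤ ‖φ x‖ + ‖φ 0‖ := norm_sub_le _ _
        _ ≤ 2 * C := by linarith [hC x, hC 0]
        _ = 2 * C / modulus t ^ (1 / 2 : ℝ) * modulus t ^ (1 / 2 : ℝ) := by field_simp
        _ ≤ _ := by gcongr
  fourier_mem μ _ φ hφ := fourier_mem_locallyConstantSpace hψ hψ1 μ hφ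
  opA_mem φ hφ := by
    refine ⟨?_, hφ.2.1.mul_left⟩
    rw [IsLocallyConstant.iff_eventually_eq]
    intro x
    rcases eq_or_ne x 0 with rfl | hx
    · filter_upwards [hφ.2.2] with y hy
      simp [opA, hy]
    · filter_upwards [(IsLocallyConstant.iff_eventually_eq _).1 hφ.1.1 x,
        Metric.ball_mem_nhds x (norm_pos_iff.2 hx)] with y hy hb
      rw [Metric.mem_ball, dist_eq_norm] at hb
      rw [opA, opA, hy, modulus_eq_of_norm_sub_lt hb]
  bump V hV := by
    obtain ⟨ε, hε, hb⟩ := Metric.mem_nhds_iff.1 hV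
    have hε' : 0 < min ε 1 := lt_min hε one_pos
    refine ⟨(Metric.ball 1 (min ε 1)).indicator fun _ => 1, ?_, fun x => ?_, ?_, fun x hx => ?_⟩
    · have h := indicator_mem_punctured (IsUltrametricDist.isClopen_ball (1 : F) (min ε 1))
        Metric.isBounded_ball (by simp)
      convert h using 2 with x
      by_cases hx : x ∈ Metric.ball (1 : F) (min ε 1) <;> simp only [hx, Set.indicator_of_mem,
        Set.indicator_of_notMem, not_false_eq_true, Complex.ofReal_one, Complex.ofReal_zero]
    · exact Set.indicator_nonneg (fun _ _ => zero_le_one) x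
    · rw [Set.indicator_of_mem (Metric.mem_ball_self hε')]
      exact one_ne_zero
    · exact Set.indicator_of_notMem
        (fun h => hx (hb (Metric.ball_subset_ball (min_le_left _ _) h))) _
  ae_eq_zero μ _ f hf h := ae_eq_zero_of_integral_clopen μ (hf.locallyIntegrable (by norm_num)) h

end Nonarchimedean

/-! ### The real and complex fields -/

/-- A continuous unitary character of a real vector space is the exponential of a linear form. -/
lemma exists_linear_lift_char {V : Type*} [NormedAddCommGroup V] [NormedSpace ℝ V]
    {ψ : AddChar V Circle} (hψ : Continuous ψ) : ∃ ℓ : V →L[ℝ] ℝ, ∀ x, ψ x = Circle.exp (ℓ x) := by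
  obtain ⟨L, ⟨hL0, hL⟩, huniq⟩ := Circle.isCoveringMap_exp.existsUnique_continuousMap_lifts
    (⟨ψ, hψ⟩ : C(V, Circle)) 0 0 (by simp)
  have hexp : ∀ x, Circle.exp (L x) = ψ x := fun x => congrFun hL x
  have hadd : ∀ x y, L (x + y) = L x + L y := by
    intro x y
    -- This also lifts `ψ` and vanishes at `0`, so uniqueness of lifts is additivity of `L`.
    have h := huniq ⟨fun z => L (z + y) - L y, by fun_prop⟩
      ⟨by simp, by
        ext1 z
        simp only [Function.comp_apply, ContinuousMap.coe_mk]
        rw [Circle.exp_sub, hexp, hexp, AddChar.map_add_eq_mul, mul_div_cancel_right]⟩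
    have h2 := DFunLike.congr_fun h x
    simp only [ContinuousMap.coe_mk] at h2
    linarith
  exact ⟨(AddMonoidHom.mk' L hadd).toRealLinearMap L.continuous, fun x => (hexp x).symm⟩

section Archimedean

variable {𝕜 : Type} [RCLike 𝕜]

lemma modulus_eq_norm_pow (x : 𝕜) : modulus x = ‖x‖ ^ Module.finrank ℝ 𝕜 := by
  rcases eq_or_ne x 0 with rfl | hx
  · simp [Module.finrank_pos.ne']
  let _ : MeasurableSpace 𝕜 := borel 𝕜
  have : BorelSpace 𝕜 := ⟨rfl⟩
  let μ : Measure 𝕜 := Measure.addHaar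
  have h1 := modulus_mul_measure (μ := μ) hx (Metric.closedBall 0 1)
  have h2 : (fun y => x * y) '' Metric.closedBall 0 1 = Metric.closedBall 0 ‖x‖ := by
    have := smul_closedBall x (0 : 𝕜) zero_le_one
    rw [smul_zero, mul_one] at this
    exact this
  rw [h2, Measure.addHaar_closedBall' μ _ (norm_nonneg x)] at h1
  have h3 : μ (Metric.closedBall 0 1) ≠ 0 := (Metric.measure_closedBall_pos μ 0 one_pos).ne'
  have h4 : μ (Metric.closedBall 0 1) ≠ ⊤ := (isCompact_closedBall _ _).measure_lt_top.ne
  have h5 := (ENNReal.mul_left_inj h3 h4).1 h1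
  exact ((ENNReal.ofReal_eq_ofReal_iff (by positivity) (modulus_nonneg x)).1 h5).symm

variable (𝕜) in
/-- The Schwartz functions. -/
def schwartzSpace : Set (𝕜 → ℂ) := {φ | ∃ f : 𝓢(𝕜, ℂ), φ = f}

lemma mem_schwartzSpace_of_hasCompactSupport {φ : 𝕜 → ℂ} (hc : HasCompactSupport φ)
    (h : ContDiff ℝ (⊤ : ℕ∞) φ) : φ ∈ schwartzSpace 𝕜 :=
  ⟨hc.toSchwartzMap h, rfl⟩

lemma ofReal_mem_punctured {g : 𝕜 → ℝ} (hc : HasCompactSupport g) (h : ContDiff ℝ (⊤ : ℕ∞) g)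
    (h0 : (0 : 𝕜) ∉ tsupport g) :
    (fun x => (g x : ℂ)) ∈ puncturedTestFunctions (schwartzSpace 𝕜) := by
  have hc' : HasCompactSupport fun x => (g x : ℂ) := hc.comp_left Complex.ofReal_zero
  refine ⟨mem_schwartzSpace_of_hasCompactSupport hc' (Complex.ofRealCLM.contDiff.comp h), hc', ?_⟩
  filter_upwards [(isClosed_tsupport g).isOpen_compl.mem_nhds h0] with x hx
  rw [image_eq_zero_of_notMem_tsupport hx, Complex.ofReal_zero]

/-- In terms of the norm the exponent is half the real dimension, hence at most `1`: the Lipschitz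
bound suffices in the unit ball and boundedness outside. -/
lemma schwartz_holder (f : 𝓢(𝕜, ℂ)) :
    ∃ C : ℝ, ∀ x, ‖f x - f 0‖ ≤ C * modulus x ^ (1 / 2 : ℝ) := by
  set A := SchwartzMap.seminorm ℝ 0 0 f
  set D := SchwartzMap.seminorm ℝ 0 1 f
  have hA : ∀ x, ‖f x‖ ≤ A := SchwartzMap.norm_le_seminorm ℝ f
  have hA0 : 0 ≤ A := (norm_nonneg _).trans (hA 0)
  have hD : ∀ x, ‖fderiv ℝ f x‖ ≤ D := by
    intro x
    rw [← norm_iteratedFDeriv_one]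
    exact SchwartzMap.norm_iteratedFDeriv_le_seminorm ℝ f 1 x
  have hD0 : 0 ≤ D := (norm_nonneg _).trans (hD 0)
  have hlip : ∀ x, ‖f x - f 0‖ ≤ D * ‖x‖ := by
    intro x
    have := convex_univ.norm_image_sub_le_of_norm_fderiv_le (𝕜 := ℝ) (f := f) (x := 0) (y := x)
      (fun y _ => f.differentiable.differentiableAt) (fun y _ => hD y) trivial trivial
    simpa using this
  refine ⟨D + 2 * A, fun x => ?_⟩
  have hmod : modulus x ^ (1 / 2 : ℝ) = ‖x‖ ^ ((Module.finrank ℝ 𝕜 : ℝ) / 2) := by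
    rw [modulus_eq_norm_pow, ← Real.rpow_natCast, ← Real.rpow_mul (norm_nonneg x)]
    ring_nf
  rw [hmod]
  have hd : ((Module.finrank ℝ 𝕜 : ℝ) / 2) ≤ 1 := by
    have : (Module.finrank ℝ 𝕜 : ℝ) ≤ 2 := by exact_mod_cast RCLike.finrank_le_two 𝕜
    linarith
  have hd0 : 0 ≤ ((Module.finrank ℝ 𝕜 : ℝ) / 2) := by positivity
  rcases le_or_gt ‖x‖ 1 with hx | hx
  · have h1 : ‖x‖ ≤ ‖x‖ ^ ((Module.finrank ℝ 𝕜 : ℝ) / 2) := by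
      rcases eq_or_ne x 0 with rfl | hx0
      · rw [norm_zero]; exact Real.rpow_nonneg le_rfl _
      · have := Real.rpow_le_rpow_of_exponent_ge (norm_pos_iff.2 hx0) hx hd
        rwa [Real.rpow_one] at this
    calc ‖f x - f 0‖ ≤ D * ‖x‖ := hlip x
      _ ≤ (D + 2 * A) * ‖x‖ ^ ((Module.finrank ℝ 𝕜 : ℝ) / 2) := by gcongr; linarith
  · have h1 : 1 ≤ ‖x‖ ^ ((Module.finrank ℝ 𝕜 : ℝ) / 2) := Real.one_le_rpow hx.le hd0
    calc ‖f x - f 0‖ ≤ ‖f x‖ + ‖f 0‖ := norm_sub_le _ _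
      _ ≤ (D + 2 * A) * 1 := by linarith [hA x, hA 0]
      _ ≤ _ := by gcongr

lemma schwartz_decay (f : 𝓢(𝕜, ℂ)) : ∃ C : ℝ, ∀ x, ‖f x‖ * (1 + modulus x) ^ 2 ≤ C := by
  set d := Module.finrank ℝ 𝕜
  -- From `(1 + m)² ≤ 2 + 2m²` with `m = ‖x‖ ^ d`.
  refine ⟨2 * SchwartzMap.seminorm ℝ 0 0 f + 2 * SchwartzMap.seminorm ℝ (d * 2) 0 f, fun x => ?_⟩
  have h1 := SchwartzMap.norm_le_seminorm ℝ f x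
  have h2 := SchwartzMap.norm_pow_mul_le_seminorm ℝ f (d * 2) x
  rw [pow_mul, ← modulus_eq_norm_pow] at h2
  nlinarith [mul_nonneg (norm_nonneg (f x)) (sq_nonneg (1 - modulus x))]

lemma contDiffAt_log_modulus {x : 𝕜} (hx : x ≠ 0) :
    ContDiffAt ℝ (⊤ : ℕ∞) (fun y : 𝕜 => (Real.log (modulus y) : ℂ)) x := by
  simp only [modulus_eq_norm_pow]
  exact Complex.ofRealCLM.contDiff.contDiffAt.comp x
    (((contDiffAt_norm ℝ hx).pow _).log (pow_ne_zero _ (norm_ne_zero_iff.2 hx)))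

variable [MeasurableSpace 𝕜] [BorelSpace 𝕜]

lemma fourier_mem_schwartzSpace {ψ : AddChar 𝕜 Circle} (hψ : Continuous ψ) (hψ1 : ψ ≠ 1)
    (μ : Measure 𝕜) [μ.IsAddHaarMeasure] (f : 𝓢(𝕜, ℂ)) : fourier ψ μ f ∈ schwartzSpace 𝕜 := by
  obtain ⟨ℓ, hℓ⟩ := exists_linear_lift_char hψ
  -- By Riesz representation `ψ(xy) = exp(2πi ⟨Ly, x⟩)`. Nontriviality of `ψ` makes `L` injective,
  -- hence invertible, so this transform is a multiple of the standard one composed with `L`.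
  set L : 𝕜 →ₗ[ℝ] 𝕜 :=
    { toFun := fun y => (2 * Real.pi)⁻¹ • (InnerProductSpace.toDual ℝ 𝕜).symm
        (ℓ.comp (ContinuousLinearMap.mul ℝ 𝕜 y))
      map_add' := fun y z => by simp [ContinuousLinearMap.comp_add]
      map_smul' := fun c y => by
        rw [map_smul, ContinuousLinearMap.comp_smul, map_smulₛₗ, conj_trivial, RingHom.id_apply,
          smul_comm] } with hLdef
  have hL : ∀ x y, inner ℝ (L y) x = (2 * Real.pi)⁻¹ * ℓ (y * x) := by
    intro x y
    simp [hLdef, inner_smul_left]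
  have hinj : Function.Injective L := by
    rw [injective_iff_map_eq_zero]
    intro y hy
    by_contra hy0
    refine hψ1 ?_
    ext x
    have h1 := hL (y⁻¹ * x) y
    rw [hy, inner_zero_left, mul_inv_cancel_left₀ hy0] at h1
    have h2 : ℓ x = 0 := by
      rcases mul_eq_zero.1 h1.symm with h | h
      · exact absurd h (by positivity)
      · exact h
    simp [hℓ, h2]
  set e : 𝕜 ≃L[ℝ] 𝕜 := (LinearEquiv.ofInjectiveEndo L hinj).toContinuousLinearEquiv with he
  have hμ : μ = Measure.addHaarScalarFactor μ volume • volume :=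
    Measure.isAddLeftInvariant_eq_smul μ volume
  set k := Measure.addHaarScalarFactor μ (volume : Measure 𝕜)
  refine ⟨((k : ℝ) : ℂ) • SchwartzMap.compCLMOfContinuousLinearEquiv ℂ e
    (FourierTransform.fourier f), ?_⟩
  ext y
  rw [fourier_apply, hμ, integral_smul_nnreal_measure, smul_apply,
    SchwartzMap.compCLMOfContinuousLinearEquiv_apply, Function.comp_apply,
    SchwartzMap.fourier_coe, Real.fourier_eq', NNReal.smul_def, Complex.real_smul, smul_eq_mul]
  congr 2 with x
  have hey : e y = L y := rfl
  rw [hℓ, Circle.coe_exp, smul_eq_mul, hey, real_inner_comm, hL]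
  congr 2
  have hpi : (Real.pi : ℂ) ≠ 0 := by exact_mod_cast Real.pi_ne_zero
  rw [map_neg, mul_comm y x]
  push_cast
  field_simp

theorem schwartzBruhatLike_archimedean {ψ : AddChar 𝕜 Circle} (hψ : Continuous ψ)
    (hψ1 : ψ ≠ 1) : SchwartzBruhatLike ψ (schwartzSpace 𝕜) where
  add_mem := by
    rintro _ ⟨f, rfl⟩ _ ⟨g, rfl⟩
    exact ⟨f + g, rfl⟩
  smul_mem := by
    rintro c _ ⟨f, rfl⟩
    exact ⟨c • f, rfl⟩
  translate_mem := by
    rintro a _ ⟨f, rfl⟩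
    refine ⟨SchwartzMap.compSubConstCLM ℝ (-a) f, ?_⟩
    ext x
    simp
  dilate_mem := by
    rintro t ht _ ⟨f, rfl⟩
    exact ⟨SchwartzMap.compCLMOfContinuousLinearEquiv ℝ
      (LinearEquiv.ofInjectiveEndo (LinearMap.mulLeft ℝ t)
        (mul_right_injective₀ ht)).toContinuousLinearEquiv f, rfl⟩
  conj_mem := by
    rintro _ ⟨f, rfl⟩
    exact ⟨f.postcompCLM (Complex.conjCLE : ℂ →L[ℝ] ℂ), rfl⟩
  continuous := by
    rintro _ ⟨f, rfl⟩
    exact f.continuous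
  decay := by
    rintro _ ⟨f, rfl⟩
    exact schwartz_decay f
  holder := by
    rintro _ ⟨f, rfl⟩
    exact schwartz_holder f
  fourier_mem := by
    rintro μ _ _ ⟨f, rfl⟩
    exact fourier_mem_schwartzSpace hψ hψ1 μ f
  opA_mem := by
    rintro _ ⟨⟨f, rfl⟩, hc, h0⟩
    refine mem_schwartzSpace_of_hasCompactSupport hc.mul_left (contDiff_iff_contDiffAt.2 fun x => ?_)
    rcases eq_or_ne x 0 with rfl | hx
    · refine (contDiffAt_const (c := (0 : ℂ))).congr_of_eventuallyEq ?_
      filter_upwards [h0] with y hy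
      simp [opA, hy]
    · exact (contDiffAt_log_modulus hx).mul (f.contDiffAt ⊤)
  bump V hV := by
    obtain ⟨ε, hε, hb⟩ := Metric.mem_nhds_iff.1 hV
    have hε' : 0 < min ε 1 / 2 := half_pos (lt_min hε one_pos)
    -- The outer radius is below `ε`, to stay in `V`, and at most `1/2`, to keep the origin out of
    -- the support.
    let g : ContDiffBump (1 : 𝕜) := ⟨min ε 1 / 4, min ε 1 / 2, by linarith, by linarith⟩
    refine ⟨g, ofReal_mem_punctured g.hasCompactSupport g.contDiff ?_, fun x => g.nonneg, ?_,
      fun x hx => ?_⟩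
    · rw [g.tsupport_eq, Metric.mem_closedBall, dist_zero_left, norm_one]
      change ¬ (1 ≤ min ε 1 / 2)
      linarith [min_le_right ε 1]
    · rw [g.one_of_mem_closedBall (Metric.mem_closedBall_self g.rIn_pos.le)]
      exact one_ne_zero
    · refine g.zero_of_le_dist (not_lt.1 fun h => hx (hb ?_))
      exact Metric.mem_ball.2 (lt_of_lt_of_le h (by
        change min ε 1 / 2 ≤ ε
        linarith [min_le_left ε 1]))
  ae_eq_zero μ _ f hf h := by
    have h1 := (isOpen_compl_singleton (x := (0 : 𝕜))).ae_eq_zero_of_integral_contDiff_smul_eq_zero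
      (μ := μ) (f := f) ((hf.locallyIntegrable (by norm_num)).locallyIntegrableOn _)
      (fun g hg hgc hgs => by
        have := h _ (ofReal_mem_punctured hgc hg fun h0 => hgs h0 rfl)
        simpa only [Complex.real_smul] using this)
    filter_upwards [h1, ae_ne_zero μ] with x hx hx0 using hx hx0

end Archimedean

end CommutatorOperator

end

open CommutatorOperator in
theorem theoremE3
    (F : Type) [Field F] [TopologicalSpace F] [IsTopologicalRing F] [LocallyCompactSpace F]
    [MeasurableSpace F] [BorelSpace F]
    (𝒮 : Set (F → ℂ)) (h𝒮 : IsSchwartzBruhatSpace F 𝒮)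
    (ψ : AddChar F Circle) (hψ : Continuous ψ) (hψ1 : ψ ≠ 1) :
    -- the self-dual measure exists and is unique
    (∃! μ : Measure F, IsSelfDualMeasure ψ μ 𝒮) ∧
    ∀ μ : Measure F, IsSelfDualMeasure ψ μ 𝒮 →
      -- the integrals that define `K` on its initial domain converge
      (∀ φ ∈ 𝒮, Integrable (fourierInv ψ μ φ) μ ∧ Integrable (opA (fourierInv ψ μ φ)) μ) ∧
      (∀ φ ∈ puncturedTestFunctions 𝒮, opA φ ∈ puncturedTestFunctions 𝒮) ∧
      ∃ T : Lp ℂ 2 μ →ₗ.[ℂ] Lp ℂ 2 μ, IsCommutatorOperator ψ μ 𝒮 T ∧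
        -- `K` is essentially self-adjoint
        IsEssentiallySelfAdjoint T ∧
        -- `K` is bounded: its closure is a bounded operator defined everywhere
        ∃ Kb : Lp ℂ 2 μ →L[ℂ] Lp ℂ 2 μ,
          T.closure = (Kb : Lp ℂ 2 μ →ₗ[ℂ] Lp ℂ 2 μ).toPMap ⊤ ∧
          -- `K` commutes with the unitary dilations
          (∀ t : Fˣ, ∃ U : Lp ℂ 2 μ ≃ₗᵢ[ℂ] Lp ℂ 2 μ,
            (∀ f : Lp ℂ 2 μ, U f =ᵐ[μ] dilation t f) ∧
            ∀ f, Kb (U f) = U (Kb f)) ∧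
          -- `K` anticommutes with the Fourier transform of `L²`
          (∃ 𝓕 : Lp ℂ 2 μ ≃ₗᵢ[ℂ] Lp ℂ 2 μ,
            (∀ φ ∈ 𝒮, ∀ f : Lp ℂ 2 μ, f =ᵐ[μ] φ → 𝓕 f =ᵐ[μ] fourier ψ μ φ) ∧
            ∀ f, Kb (𝓕 f) = -𝓕 (Kb f)) ∧
          -- `K` anticommutes with the inversion
          (∃ I : Lp ℂ 2 μ ≃ₗᵢ[ℂ] Lp ℂ 2 μ,
            (∀ f : Lp ℂ 2 μ, I f =ᵐ[μ] inversion f) ∧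
            ∀ f, Kb (I f) = -I (Kb f)) ∧
          -- the spectral function of `K` is `-i ∂²/∂s² log Γ(χ, s)`: tested against the initial
          -- domain, `χ⁻¹(x)|x|^{-s}` is a generalized eigenvector with this eigenvalue;
          -- and the spectral function is bounded on the critical line
          ∃ Γ : (Fˣ →ₜ* Circle) → ℂ → ℂ,
            (∀ χ, IsTateGamma ψ μ 𝒮 χ (Γ χ) ∧ DifferentiableOn ℂ (Γ χ) criticalStrip ∧
              ∀ s ∈ criticalStrip, Γ χ s ≠ 0) ∧
            (∀ χ, ∀ s ∈ criticalStrip, ∀ φ ∈ puncturedTestFunctions 𝒮,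
              Integrable (fun x => conj (opK ψ μ φ x) * quasiChar χ⁻¹ (-s) x) μ ∧
              ∫ x, conj (opK ψ μ φ x) * quasiChar χ⁻¹ (-s) x ∂μ =
                spectralFunction (Γ χ) s * ∫ x, conj (φ x) * quasiChar χ⁻¹ (-s) x ∂μ) ∧
            ∃ C : ℝ, ∀ χ, ∀ s : ℂ, s.re = 1 / 2 → ‖spectralFunction (Γ χ) s‖ ≤ C := by
  cases h𝒮 with
  | nonarchimedean =>
    have : ProperSpace F :=
      ProperSpace.of_nontriviallyNormedField_of_weaklyLocallyCompactSpace F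
    have H := schwartzBruhatLike_nonarchimedean hψ hψ1
    exact ⟨H.existsUnique_selfDual hψ hψ1, fun μ hμ => by
      have := hμ.1
      exact H.commutator_theorem hψ hψ1 hμ⟩
  | real =>
    have H := schwartzBruhatLike_archimedean (𝕜 := ℝ) hψ hψ1
    exact ⟨H.existsUnique_selfDual hψ hψ1, fun μ hμ => by
      have := hμ.1
      exact H.commutator_theorem hψ hψ1 hμ⟩
  | complex =>
    have H := schwartzBruhatLike_archimedean (𝕜 := ℂ) hψ hψ1
    exact ⟨H.existsUnique_selfDual hψ hψ1, fun μ hμ => by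
      have := hμ.1
      exact H.commutator_theorem hψ hψ1 hμ⟩
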